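/- **Setup.** Let $\Bbbk$ be a field. A *seed* $S$ consists of a lattice $N$ of finite rank, a finite set $I$, a basis $\{e_i\}_{i\in I}$ of a saturated sublattice $N_I\subseteq N$, a subset $F\subseteq I$ of frozen indices, and a $\mathbb Z$-valued bilinear form $[\cdot,\cdot]$ on $N$ (not necessarily skew-symmetrizable) with $[e_i,e_i]=0$ for all $i\in I\setminus F$. Put $M=\operatorname{Hom}(N,\mathbb Z)$, $M_I=\operatorname{Hom}(N_I,\mathbb Z)$, $p_1(n)=[n,\cdot]$ and $p_2(n)=[\cdot,n]$ in $M$, $\bar p_1(n)=p_1(n)|_{N_I}\in M_I$, and $K_1=\ker(\bar p_1)\subseteq N$. Assume that $p_2(e_i)\neq0$ for all $i\in I$ and that $p_2(e_i)$ is primitive in $M$ for all $i\in F$. **Cluster varieties.** For a lattice $P$, elements $u_i\in \operatorname{Hom}(P,\mathbb Z)$ and $\psi_i\in P$ ($i\in I$) with $u_i(\psi_i)=0$ for $i\notin F$, glue to the central torus $\operatorname{Spec}\Bbbk[P]$: for each $i\notin F$ a copy of $\operatorname{Spec}\Bbbk[P]$, along the locus $1+z^{\psi_i}\neq0$, via $z^p\mapsto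 z^p(1+z^{\psi_i})^{-u_i(p)}$; for each $i\in F$ the partial compactification $\operatorname{Spec}\Bbbk[p\in P: u_i(p)\ge0]$, via the inclusion of the torus. (Two charts are glued only through the central torus.) The variety $\mathcal X^\star$ is obtained from $P=N$, $u_i=p_2(e_i)$, $\psi_i=e_i$; denote its central torus by $U_0$ and its other charts by $U_i$. The variety $\mathcal A^\star_{\rm prin}$ is obtained from $P=\operatorname{Hom}(N_I\oplus M,\mathbb Z)=M_I\oplus N$, $u_i=(e_i,0)$, $\psi_i=(\bar p_1(e_i),e_i)$ (this is the cluster $\mathcal A$-variety of the seed $S_{\rm prin}$ with lattice $N_I\oplus M$, basis $(e_i,0)$ and form $[n_1,n_2]+\langle n_1,m_2\rangle-\langle n_2,m_1\rangle$). Let $$\lambda:\mathcal X^\star\to T_{K_1^*}=\operatorname{Spec}\Bbbk[K_1],\qquad i:T_M=\operatorname{Spec}\Bbbk[N]\to T_{K_1^*},\qquad \pi:\mathcal A^\star_{\rm prin}\to T_M,\qquad \tilde p_2:\mathcal A^\star_{\rm prin}\to\mathcal X^\star$$ be the morphisms given on central tori by $z^k\mapsto z^k$, $z^k\mapsto z^k$,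 $z^n\mapsto z^{(0,n)}$, $z^n\mapsto z^{(\bar p_1(n),n)}$. Then $\lambda\tilde p_2=i\pi$. For $\phi\in T_{K_1^*}(\Bbbk)=\operatorname{Hom}(K_1,\Bbbk^\times)$ and $t\in T_M(\Bbbk)=\operatorname{Hom}(N,\Bbbk^\times)$ with $i(t)=\phi$ (that is, $t|_{K_1}=\phi$), let $\mathcal X^\star_\phi=\lambda^{-1}(\phi)$ and $\mathcal A^\star_t=\pi^{-1}(t)$ be the scheme-theoretic fibers, so that $\tilde p_2$ restricts to $\mathcal A^\star_t\to\mathcal X^\star_\phi$. Assume moreover that for no $i\in I\setminus F$ does $1+z^{e_i}$ vanish identically on $\mathcal X^\star_\phi\cap U_0$, i.e. that $\phi(e_i)\neq-1$ whenever $i\in I\setminus F$ and $e_i\in K_1$. **Cox ring.** For $i\notin F$ let $E_{i,\phi}$ be the divisor on $\mathcal X^\star_\phi$ given by $1+z^{e_i}=0$ in $U_i$, and for $i\in F$ let $D_{i,\phi}$ be the restriction to $\mathcal X^\star_\phi$ of the boundary divisor of $U_i$. For $m\in M_I$ put $W_\phi(m)=\sum_{i\notin F}\langle e_i,m\rangle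 E_{i,\phi}+\sum_{i\in F}\langle e_i,m\rangle D_{i,\phi}$, let $\mathcal O(m)$ be the sheaf of rational functions $f$ with $\operatorname{div} f+W_\phi(m)\ge0$, and let $\mathcal R=\bigoplus_{m\in M_I}\mathcal O(m)z^m$, a sheaf of $M_I$-graded algebras. Let $\Lambda_0=\bar p_1(N)\subseteq M_I$. A *shifting family* is a homomorphism $\rho:\Lambda_0\to K(\mathcal X^\star_\phi)^\times$ with $\rho(m_0)\mathcal O(m)\subseteq\mathcal O(m+m_0)$ for all $m_0\in\Lambda_0$, $m\in M_I$. Let $\mathcal I_\rho\subseteq\mathcal R$ be the sheaf of ideals generated by the sections $f-f\rho(m_0)z^{m_0}$. The Cox ring formed with $\rho$ is $$\operatorname{Cox}(\mathcal X^\star_\phi)=\Gamma(\mathcal X^\star_\phi,\mathcal R/\mathcal I_\rho).$$ **Statement.** For all such $\phi$ and $t$: 1. the leaf $\mathcal X^\star_\phi$ is an integral scheme; 2. there is a shifting family $\rho$ with $\rho(\bar p_1(n))=t(n)\,z^{-n}$ for all $n\in N$ (in the coordinates of $U_0$); 3. for the Cox ring formed with this $\rho$, the map $\tilde p_2$ induces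 a ring isomorphism $$\tilde p_2|_{\mathcal A^\star_t}^\sharp:\operatorname{Cox}(\mathcal X^\star_\phi)\xrightarrow{\ \sim\ }\Gamma(\mathcal A^\star_t,\mathcal O_{\mathcal A^\star_t}),$$ namely the one which at the points of the central torus of $\mathcal A^\star_t$ is given by $f z^m\mapsto \tilde p_2^*(f)\cdot z^{(m,0)}$. Thus the $\star$-upper cluster algebra with coefficients $t$, $\Gamma(\mathcal A^\star_t,\mathcal O)$, is the Cox ring of the leaf $\mathcal X^\star_\phi$. -/

import Mathlib

open CategoryTheory CategoryTheory.Limits AlgebraicGeometry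
universe u
noncomputable section
namespace ClusterCox

/-- Data for gluing a family of schemes `chart i` to one scheme `center`, each along an open subscheme
`overlap i` of both. -/
structure OpenStar (I : Type u) where
  center : Scheme.{u}
  chart : I → Scheme.{u}
  overlap : I → Scheme.{u}
  toCenter : ∀ i, overlap i ⟶ center
  toChart : ∀ i, overlap i ⟶ chart i
  toCenter_open : ∀ i, IsOpenImmersion (toCenter i)
  toChart_open : ∀ i, IsOpenImmersion (toChart i)

namespace OpenStar
variable {I : Type u} (D : OpenStar I)

/-- The pieces to be glued: the center (`none`) and the charts. -/
def U : Option I → Scheme.{u}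
  | none => D.center
  | some i => D.chart i

/-- The part of each piece that is identified with an open part of the center. -/
def V : Option I → Scheme.{u}
  | none => D.center
  | some i => D.overlap i

def a : ∀ j, D.V j ⟶ D.center
  | none => 𝟙 D.center
  | some i => D.toCenter i

def b : ∀ j, D.V j ⟶ D.U j
  | none => 𝟙 D.center
  | some i => D.toChart i

instance (j : Option I) : IsOpenImmersion (D.a j) := by
  cases j with
  | none => exact inferInstanceAs (IsOpenImmersion (𝟙 D.center))
  | some i => exact D.toCenter_open i

instance (j : Option I) : IsOpenImmersion (D.b j) := by
  cases j with
  | none => exact inferInstanceAs (IsOpenImmersion (𝟙 D.center))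
  | some i => exact D.toChart_open i

/-- Two pieces are glued along the intersection, inside the center, of the parts of the center that
they are glued to; in particular two charts are glued only through the center. -/
def f (i j : Option I) : pullback (D.a i) (D.a j) ⟶ D.U i := pullback.fst (D.a i) (D.a j) ≫ D.b i

instance f_isOpenImmersion (i j : Option I) : IsOpenImmersion (D.f i j) := by
  unfold f; infer_instance

lemma fst_fst (i j k : Option I) :
    pullback.fst (D.f i j) (D.f i k) ≫ pullback.fst (D.a i) (D.a j)
      = pullback.snd (D.f i j) (D.f i k) ≫ pullback.fst (D.a i) (D.a k) := by
  rw [← cancel_mono (D.b i)]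
  simpa [f] using pullback.condition (f := D.f i j) (g := D.f i k)

def t' (i j k : Option I) :
    pullback (D.f i j) (D.f i k) ⟶ pullback (D.f j k) (D.f j i) :=
  pullback.lift
    (pullback.lift
      (pullback.fst (D.f i j) (D.f i k) ≫ pullback.snd (D.a i) (D.a j))
      (pullback.snd (D.f i j) (D.f i k) ≫ pullback.snd (D.a i) (D.a k))
      (by
        rw [Category.assoc, Category.assoc, ← pullback.condition, ← pullback.condition,
          reassoc_of% (D.fst_fst i j k)]))
    (pullback.fst (D.f i j) (D.f i k) ≫ (pullbackSymmetry (D.a i) (D.a j)).hom)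
    (by simp [f, pullback.lift_fst_assoc])

def glueData' : GlueData' Scheme.{u} where
  J := Option I
  U := D.U
  V i j _ := pullback (D.a i) (D.a j)
  f i j _ := D.f i j
  t i j _ := (pullbackSymmetry (D.a i) (D.a j)).hom
  t' i j k _ _ _ := D.t' i j k
  t_fac i j k _ _ _ := by simp [t', pullback.lift_snd]
  t_inv i j _ := by
    rw [← cancel_mono (pullback.fst _ _)]; simp
  cocycle i j k _ _ _ := by
    rw [← cancel_mono (pullback.fst _ _), ← cancel_mono (pullback.fst _ _)]
    simp [t', fst_fst, pullback.lift_fst, pullback.lift_snd, pullback.lift_fst_assoc, pullback.lift_snd_assoc]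

lemma isOpenImmersion_f' (E : GlueData' Scheme.{u}) (H : ∀ i j h, IsOpenImmersion (E.f i j h))
    (i j : E.J) : IsOpenImmersion (E.f' i j) := by
  dsimp only [GlueData'.f']
  split_ifs with h
  · infer_instance
  · have := H i j h
    infer_instance

def glueData : Scheme.GlueData.{u} where
  toGlueData := GlueData.ofGlueData' D.glueData'
  f_open := isOpenImmersion_f' D.glueData' (fun i j _ => D.f_isOpenImmersion i j)

/-- The scheme obtained by gluing every chart to the center. -/
def glued : Scheme.{u} := D.glueData.glued

def ι (j : Option I) : D.U j ⟶ D.glued := D.glueData.ι j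

instance (j : Option I) : IsOpenImmersion (D.ι j) :=
  Scheme.GlueData.ι_isOpenImmersion D.glueData j

/-- The center as an open subscheme of the glued scheme. -/
def ι₀ : D.center ⟶ D.glued := D.ι none

/-- The charts as open subschemes of the glued scheme. -/
def ι₁ (i : I) : D.chart i ⟶ D.glued := D.ι (some i)

instance : IsOpenImmersion D.ι₀ := inferInstanceAs (IsOpenImmersion (D.ι none))
instance (i : I) : IsOpenImmersion (D.ι₁ i) := inferInstanceAs (IsOpenImmersion (D.ι (some i)))

lemma exists_ι_eq (x : D.glued) : ∃ (j : Option I) (y : D.U j), D.ι j y = x :=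
  D.glueData.ι_jointly_surjective x

lemma f_comp {i j : Option I} (h : i ≠ j) {Y : Scheme.{u}} (k : D.U i ⟶ Y) :
    ∃ e : D.glueData.V (i, j) = pullback (D.a i) (D.a j),
      D.glueData.f i j ≫ k = eqToHom e ≫ D.f i j ≫ k := by
  refine ⟨dif_neg h, ?_⟩
  have e : D.glueData.f i j = eqToHom (dif_neg h) ≫ D.f i j := dif_neg h
  exact (congrArg (· ≫ k) e).trans (Category.assoc _ _ _)

lemma eqToHom_aux {A B C E F : Scheme.{u}} (h₁ : A = B) (m : B ⟶ C) (h₂ : C = E) (h₃ : E = C)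
    (g : C ⟶ F) : (eqToHom h₁ ≫ m ≫ eqToHom h₂) ≫ eqToHom h₃ ≫ g = eqToHom h₁ ≫ m ≫ g := by
  subst h₁ h₂; simp

lemma t_f_comp {i j : Option I} (h : i ≠ j) {Y : Scheme.{u}} (k : D.U j ⟶ Y) :
    ∃ e : D.glueData.V (i, j) = pullback (D.a i) (D.a j),
      (D.glueData.t i j ≫ D.glueData.f j i) ≫ k =
        eqToHom e ≫ (pullbackSymmetry (D.a i) (D.a j)).hom ≫ D.f j i ≫ k := by
  refine ⟨dif_neg h, ?_⟩
  obtain ⟨e', h'⟩ := D.f_comp h.symm k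
  have e : D.glueData.t i j = eqToHom (dif_neg h) ≫ (pullbackSymmetry (D.a i) (D.a j)).hom ≫
      eqToHom (dif_neg h.symm).symm := dif_neg h
  refine (Category.assoc _ _ _).trans ?_
  refine (congrArg (D.glueData.t i j ≫ ·) h').trans ?_
  exact (congrArg (· ≫ (eqToHom e' ≫ D.f j i ≫ k)) e).trans (eqToHom_aux _ _ _ _ _)

lemma desc_condition {Y : Scheme.{u}} (k₀ : D.center ⟶ Y)
    (k : ∀ j, D.U j ⟶ Y) (h : ∀ j, D.b j ≫ k j = D.a j ≫ k₀) (i j : Option I) :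
    D.f i j ≫ k i = (pullbackSymmetry (D.a i) (D.a j)).hom ≫ D.f j i ≫ k j := by
  rw [f, f, Category.assoc, Category.assoc, h, h, pullbackSymmetry_hom_comp_fst_assoc,
    pullback.condition_assoc]

def descAux {Y : Scheme.{u}} (k₀ : D.center ⟶ Y)
    (k : ∀ j, D.U j ⟶ Y) (h : ∀ j, D.b j ≫ k j = D.a j ≫ k₀) : D.glued ⟶ Y :=
  Multicoequalizer.desc D.glueData.diagram _ k (by
    rintro ⟨i, j⟩
    change D.glueData.f i j ≫ k i = (D.glueData.t i j ≫ D.glueData.f j i) ≫ k j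
    by_cases hij : i = j
    · subst hij
      exact congrArg (· ≫ k i) ((Category.id_comp _).symm.trans
        (congrArg (· ≫ D.glueData.f i i) (D.glueData.t_id i).symm))
    · obtain ⟨e₁, h₁⟩ := D.f_comp hij (k i)
      obtain ⟨e₂, h₂⟩ := D.t_f_comp hij (k j)
      refine h₁.trans (Eq.trans (congrArg (eqToHom e₁ ≫ ·) ?_) h₂.symm)
      exact D.desc_condition k₀ k h i j)

/-- Morphisms out of the glued scheme: a morphism on the center and on each chart which agree on the
overlaps. -/
def desc {Y : Scheme.{u}} (k₀ : D.center ⟶ Y) (k : ∀ i, D.chart i ⟶ Y)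
    (h : ∀ i, D.toChart i ≫ k i = D.toCenter i ≫ k₀) : D.glued ⟶ Y :=
  D.descAux k₀ (fun j => match j with | none => k₀ | some i => k i)
    (fun j => match j with | none => rfl | some i => h i)

lemma ι_descAux {Y : Scheme.{u}} (k₀ : D.center ⟶ Y)
    (k : ∀ j, D.U j ⟶ Y) (h : ∀ j, D.b j ≫ k j = D.a j ≫ k₀) (j) : D.ι j ≫ D.descAux k₀ k h = k j :=
  Multicoequalizer.π_desc _ _ _ _ _

lemma ι₀_desc {Y : Scheme.{u}} (k₀ : D.center ⟶ Y) (k : ∀ i, D.chart i ⟶ Y)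
    (h : ∀ i, D.toChart i ≫ k i = D.toCenter i ≫ k₀) : D.ι₀ ≫ D.desc k₀ k h = k₀ :=
  D.ι_descAux _ _ _ none

lemma ι₁_desc {Y : Scheme.{u}} (k₀ : D.center ⟶ Y) (k : ∀ i, D.chart i ⟶ Y)
    (h : ∀ i, D.toChart i ≫ k i = D.toCenter i ≫ k₀) (i : I) : D.ι₁ i ≫ D.desc k₀ k h = k i :=
  D.ι_descAux _ _ _ (some i)

lemma glue_comp (i : I) : D.toChart i ≫ D.ι₁ i = D.toCenter i ≫ D.ι₀ := by
  have hij : (some i : Option I) ≠ none := by simp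
  obtain ⟨e₁, h₁⟩ := D.f_comp hij (D.ι (some i))
  obtain ⟨e₂, h₂⟩ := D.t_f_comp hij (D.ι none)
  have h : (D.glueData.t (some i) none ≫ D.glueData.f none (some i)) ≫ D.ι none =
      D.glueData.f (some i) none ≫ D.ι (some i) :=
    (Category.assoc _ _ _).trans (D.glueData.glue_condition (some i) none)
  have h' := h₂.symm.trans (h.trans h₁)
  rw [cancel_epi] at h'
  simp only [f, Category.assoc, pullbackSymmetry_hom_comp_fst_assoc] at h'
  have e : IsIso (D.a none) := inferInstanceAs (IsIso (𝟙 D.center))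
  have h2 : pullback.snd (D.a (some i)) (D.a none) =
      pullback.fst (D.a (some i)) (D.a none) ≫ D.toCenter i :=
    ((Category.comp_id _).symm.trans
      (pullback.condition (f := D.a (some i)) (g := D.a none)).symm)
  rw [h2] at h'
  have h3 : pullback.fst (D.a (some i)) (D.a none) ≫ (D.toCenter i ≫ D.ι₀) =
      pullback.fst (D.a (some i)) (D.a none) ≫ (D.toChart i ≫ D.ι₁ i) :=
    (congrArg (pullback.fst (D.a (some i)) (D.a none) ≫ ·)
      (congrArg (D.toCenter i ≫ ·) (Category.id_comp D.ι₀).symm)).trans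
        ((Category.assoc _ _ _).symm.trans h')
  rw [cancel_epi] at h3
  exact h3.symm

lemma hom_ext {Y : Scheme.{u}} {p q : D.glued ⟶ Y} (h₀ : D.ι₀ ≫ p = D.ι₀ ≫ q)
    (h : ∀ i, D.ι₁ i ≫ p = D.ι₁ i ≫ q) : p = q :=
  Multicoequalizer.hom_ext _ _ _ (fun j => match j with | none => h₀ | some i => h i)

end OpenStar
section Mutation
variable {kk : Type u} [Field kk] {P : Type u} [AddCommGroup P]

/-- The monomial `z^p` of the (Laurent) monoid algebra `kk[P]`. -/
abbrev monomial (kk : Type u) [Field kk] {P : Type*} [AddCommMonoid P] (p : P) :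
    AddMonoidAlgebra kk P := AddMonoidAlgebra.single p 1

/-- The element `c` as a unit of the localization `kk[P]_c`. -/
def denUnit (c : AddMonoidAlgebra kk P) : (Localization.Away c)ˣ :=
  (IsLocalization.Away.algebraMap_isUnit c).unit

lemma coe_denUnit (c : AddMonoidAlgebra kk P) :
    (denUnit c : Localization.Away c) = algebraMap _ _ c := rfl

/-- The mutation `z^p ↦ z^p c^{-u(p)}`, as a ring homomorphism `kk[P] → kk[P]_c`. -/
def mutation (c : AddMonoidAlgebra kk P) (u : P →+ ℤ) :
    AddMonoidAlgebra kk P →ₐ[kk] Localization.Away c :=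
  AddMonoidAlgebra.lift kk (Localization.Away c) P
    { toFun := fun p => algebraMap _ _ (monomial kk p.toAdd) *
        ((denUnit c ^ (-(u p.toAdd)) : (Localization.Away c)ˣ) : Localization.Away c)
      map_one' := by
        simp [← AddMonoidAlgebra.one_def]
      map_mul' := fun p q => by
        have h : monomial kk (p.toAdd + q.toAdd) = monomial kk p.toAdd * monomial kk q.toAdd := by
          simp [monomial, AddMonoidAlgebra.single_mul_single]
        simp only [toAdd_mul, h, map_mul, map_add, neg_add, zpow_add, Units.val_mul]
        ring }

lemma mutation_monomial (c : AddMonoidAlgebra kk P) (u : P →+ ℤ) (p : P) :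
    mutation c u (monomial kk p) = algebraMap _ _ (monomial kk p) *
        ((denUnit c ^ (-(u p)) : (Localization.Away c)ˣ) : Localization.Away c) := by
  simp [mutation]

/-- The automorphism of the localization extending a mutation which fixes `c`. -/
def mutationLoc (c : AddMonoidAlgebra kk P) (u : P →+ ℤ)
    (h : mutation c u c = algebraMap _ _ c) : Localization.Away c →+* Localization.Away c :=
  IsLocalization.Away.lift (S := Localization.Away c) c (g := (mutation c u).toRingHom)
    (by
      change IsUnit (mutation c u c)
      rw [h]; exact IsLocalization.Away.algebraMap_isUnit c)

lemma mutationLoc_algebraMap (c : AddMonoidAlgebra kk P) (u : P →+ ℤ)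
    (h : mutation c u c = algebraMap _ _ c) (x) :
    mutationLoc c u h (algebraMap _ _ x) = mutation c u x :=
  IsLocalization.Away.lift_eq _ _ _

lemma mutationLoc_comp (c : AddMonoidAlgebra kk P) (u : P →+ ℤ)
    (h : mutation c u c = algebraMap _ _ c) (h' : mutation c (-u) c = algebraMap _ _ c) :
    (mutationLoc c u h).comp (mutationLoc c (-u) h') = RingHom.id _ := by
  apply IsLocalization.ringHom_ext (Submonoid.powers c)
  have hw : ∀ k : ℤ, mutationLoc c u h ((denUnit c ^ k : (Localization.Away c)ˣ) :
      Localization.Away c) = ((denUnit c ^ k : (Localization.Away c)ˣ) : Localization.Away c) := by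
    intro k
    have h1 : Units.map (mutationLoc c u h).toMonoidHom (denUnit c) = denUnit c := by
      ext
      change mutationLoc c u h (denUnit c : Localization.Away c) = _
      rw [coe_denUnit, mutationLoc_algebraMap, h]
    calc _ = ((Units.map (mutationLoc c u h).toMonoidHom (denUnit c ^ k) :
          (Localization.Away c)ˣ) : Localization.Away c) := rfl
      _ = _ := by rw [map_zpow, h1]
  apply AddMonoidAlgebra.ringHom_ext
  · intro a
    have key : ∀ (v : P →+ ℤ), mutation c v (AddMonoidAlgebra.single (0 : P) a) =
        algebraMap _ _ (AddMonoidAlgebra.single (0 : P) a) := by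
      intro v
      have : (AddMonoidAlgebra.single 0 a : AddMonoidAlgebra kk P) = algebraMap kk _ a := rfl
      rw [this, AlgHom.commutes, ← IsScalarTower.algebraMap_apply]
    simp only [RingHom.comp_apply, mutationLoc_algebraMap, key, RingHom.id_apply]
  · intro p
    simp only [RingHom.comp_apply, mutationLoc_algebraMap, RingHom.id_apply]
    rw [mutation_monomial, map_mul, mutationLoc_algebraMap, mutation_monomial, hw, mul_assoc,
      ← Units.val_mul, ← zpow_add]
    simp

/-- Shorthand for the morphism of affine schemes attached to a ring homomorphism. -/
abbrev specMap {A B : Type u} [CommRing A] [CommRing B] (f : A →+* B) :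
    Spec (CommRingCat.of B) ⟶ Spec (CommRingCat.of A) :=
  Spec.map (CommRingCat.ofHom f)

lemma mutation_isOpenImmersion (c : AddMonoidAlgebra kk P) (u : P →+ ℤ)
    (h : mutation c u c = algebraMap _ _ c) (h' : mutation c (-u) c = algebraMap _ _ c) :
    IsOpenImmersion (specMap (mutation c u).toRingHom) := by
  have h'' : mutation c (-(-u)) c = algebraMap _ _ c := by rwa [neg_neg]
  let σ : Localization.Away c ≃+* Localization.Away c :=
    RingEquiv.ofRingHom (mutationLoc c u h) (mutationLoc c (-u) h') (mutationLoc_comp c u h h')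
      (by have := mutationLoc_comp c (-u) h' h''; simpa only [neg_neg] using this)
  have e : (mutation c u).toRingHom = σ.toRingHom.comp (algebraMap _ _) := by
    exact RingHom.ext fun x => (mutationLoc_algebraMap c u h x).symm
  have e2 : specMap (mutation c u).toRingHom =
      specMap σ.toRingHom ≫ specMap (algebraMap (AddMonoidAlgebra kk P) (Localization.Away c)) := by
    rw [specMap, specMap, specMap, ← Spec.map_comp, ← CommRingCat.ofHom_comp, e]
  have i1 : IsIso (specMap σ.toRingHom) := by
    have : IsIso (CommRingCat.ofHom σ.toRingHom) := σ.toCommRingCatIso.isIso_hom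
    infer_instance
  rw [e2]
  infer_instance

end Mutation

/-- Mutation data on the torus `Spec kk[P]`: for each index a cocharacter `u i` and a character `ψ i`,
with `⟨u i, ψ i⟩ = 0` for the unfrozen indices. -/
structure ClusterData (P : Type u) [AddCommGroup P] (I : Type u) where
  u : I → P →+ ℤ
  ψ : I → P
  frozen : Set I
  u_ψ : ∀ i, i ∉ frozen → u i (ψ i) = 0

namespace ClusterData
section
variable {P : Type u} [AddCommGroup P] {I : Type u} (D : ClusterData P I)
variable (kk : Type u) [Field kk]

/-- The characters that are regular on the chart with index `i`: all of them if `i` is unfrozen, the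
characters with `⟨u i, p⟩ ≥ 0` if `i` is frozen. -/
def cone (i : I) : AddSubmonoid P where
  carrier := {p | i ∈ D.frozen → 0 ≤ D.u i p}
  zero_mem' := by simp
  add_mem' {p q} hp hq hi := by
    have h₁ := hp hi
    have h₂ := hq hi
    rw [map_add]; omega

open scoped Classical in
/-- The function whose nonvanishing locus in the central torus is the overlap with the chart `i`:
`1 + z^{ψ i}` (the locus where the mutation is biregular) if `i` is unfrozen, `1` if `i` is frozen. -/
def den (i : I) : AddMonoidAlgebra kk P :=
  if i ∈ D.frozen then 1 else 1 + monomial kk (D.ψ i)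

/-- The gluing of the chart `i` to the center. For `i` unfrozen it is the mutation
`z^p ↦ z^p (1 + z^{ψ i})^{-⟨u i, p⟩}`; for `i` frozen the denominator is `1` and it is the inclusion
of the torus into its partial compactification. -/
def chartRing (i : I) : AddMonoidAlgebra kk (D.cone i) →ₐ[kk] Localization.Away (D.den kk i) :=
  (mutation (D.den kk i) (D.u i)).comp
    (AddMonoidAlgebra.mapDomainAlgHom kk kk (D.cone i).subtype)

lemma mutation_den (i : I) (n : ℤ) : mutation (D.den kk i) (n • D.u i) (D.den kk i) =
    algebraMap _ _ (D.den kk i) := by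
  by_cases hi : i ∈ D.frozen
  · have : D.den kk i = 1 := if_pos hi
    rw [this, map_one, map_one]
  · have h2 : D.den kk i = 1 + monomial kk (D.ψ i) := if_neg hi
    have h3 : mutation (D.den kk i) (n • D.u i) (1 + monomial kk (D.ψ i)) =
        algebraMap _ _ (1 + monomial kk (D.ψ i)) := by
      rw [map_add, map_add, mutation_monomial, map_one, map_one]
      simp [D.u_ψ i hi]
    rw [← h2] at h3
    exact h3

lemma exists_cone (i : I) : ∃ p₀ ∈ D.cone i, ∀ p : P, ∃ k : ℕ, p + k • p₀ ∈ D.cone i := by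
  by_cases h : ∃ p₀, 0 < D.u i p₀
  · obtain ⟨p₀, h₀⟩ := h
    refine ⟨p₀, fun _ => h₀.le, fun p => ⟨(D.u i p).natAbs, fun _ => ?_⟩⟩
    rw [map_add, map_nsmul, nsmul_eq_mul]
    have h1 : -((D.u i p).natAbs : ℤ) ≤ D.u i p := by omega
    have h2 : (0 : ℤ) ≤ ((D.u i p).natAbs : ℤ) := by omega
    nlinarith
  · push Not at h
    refine ⟨0, (D.cone i).zero_mem, fun p => ⟨0, fun _ => ?_⟩⟩
    have h1 := h (-p)
    rw [map_neg] at h1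
    simp only [zero_smul, add_zero]
    omega

lemma cone_isOpenImmersion (i : I) : IsOpenImmersion (specMap
    (AddMonoidAlgebra.mapDomainAlgHom kk kk (D.cone i).subtype).toRingHom) := by
  obtain ⟨p₀, hp₀, H⟩ := D.exists_cone i
  let f := AddMonoidAlgebra.mapDomainAlgHom kk kk (D.cone i).subtype
  have hf : ∀ (p : D.cone i) (a : kk), f (AddMonoidAlgebra.single p a) =
      AddMonoidAlgebra.single (p : P) a := fun p a => by simp [f]
  let _ : Algebra (AddMonoidAlgebra kk (D.cone i)) (AddMonoidAlgebra kk P) := f.toRingHom.toAlgebra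
  have hinj : Function.Injective f :=
    AddMonoidAlgebra.mapDomain_injective (Subtype.val_injective)
  let x : AddMonoidAlgebra kk (D.cone i) := monomial kk ⟨p₀, hp₀⟩
  have hx : ∀ k : ℕ, f (x ^ k) = monomial kk (k • p₀) := fun k => by
    rw [map_pow, hf, AddMonoidAlgebra.single_pow, one_pow]
  have hunit : ∀ p : P, IsUnit (monomial kk p) := fun p =>
    IsUnit.of_mul_eq_one (monomial kk (-p)) (by
      simp [monomial, AddMonoidAlgebra.single_mul_single, AddMonoidAlgebra.one_def])
  have : IsLocalization.Away x (AddMonoidAlgebra kk P) := by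
    refine ⟨?_, ?_, ?_⟩
    · rintro ⟨_, k, rfl⟩
      change IsUnit (f (x ^ k))
      rw [hx]; exact hunit _
    · intro z
      have : ∃ (k : ℕ) (y : AddMonoidAlgebra kk (D.cone i)), z * f (x ^ k) = f y := by
        induction z using AddMonoidAlgebra.induction_linear with
        | zero => exact ⟨0, 0, by simp⟩
        | add a b ha hb =>
          obtain ⟨k, y, hy⟩ := ha
          obtain ⟨l, w, hw⟩ := hb
          refine ⟨k + l, y * x ^ l + w * x ^ k, ?_⟩
          rw [pow_add, map_mul, map_add, map_mul, map_mul, ← hy, ← hw]; ring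
        | single p a =>
          obtain ⟨k, hk⟩ := H p
          refine ⟨k, AddMonoidAlgebra.single ⟨_, hk⟩ a, ?_⟩
          rw [hx, hf, AddMonoidAlgebra.single_mul_single, mul_one]
      obtain ⟨k, y, hy⟩ := this
      exact ⟨(y, ⟨x ^ k, k, rfl⟩), hy⟩
    · intro a b h
      exact ⟨1, by rw [hinj h]⟩
  exact IsOpenImmersion.of_isLocalization x

lemma chartRing_isOpenImmersion (i : I) :
    IsOpenImmersion (specMap (D.chartRing kk i).toRingHom) := by
  have e : specMap (D.chartRing kk i).toRingHom =
      specMap (mutation (D.den kk i) (D.u i)).toRingHom ≫ specMap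
        (AddMonoidAlgebra.mapDomainAlgHom kk kk (D.cone i).subtype).toRingHom := by
    rw [specMap, specMap, specMap, ← Spec.map_comp, ← CommRingCat.ofHom_comp]
    rfl
  have h1 := mutation_isOpenImmersion (D.den kk i) (D.u i)
    (by simpa using D.mutation_den kk i 1) (by simpa using D.mutation_den kk i (-1))
  have h2 := D.cone_isOpenImmersion kk i
  rw [e]
  infer_instance

/-- The central torus `Spec kk[P]` together with the tori (for unfrozen indices) and the partially
compactified tori `Spec kk[p | ⟨u i, p⟩ ≥ 0]` (for frozen indices) to be glued to it. -/
def star : OpenStar.{u} I where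
  center := Spec (CommRingCat.of (AddMonoidAlgebra kk P))
  chart i := Spec (CommRingCat.of (AddMonoidAlgebra kk (D.cone i)))
  overlap i := Spec (CommRingCat.of (Localization.Away (D.den kk i)))
  toCenter i := specMap (algebraMap (AddMonoidAlgebra kk P) (Localization.Away (D.den kk i)))
  toChart i := specMap (D.chartRing kk i).toRingHom
  toCenter_open _ := inferInstance
  toChart_open i := D.chartRing_isOpenImmersion kk i

/-- The cluster variety with respect to the given mutation data. -/
def variety : Scheme.{u} := (D.star kk).glued

/-- The central torus as an open subscheme of the cluster variety. -/
def centralChart : Spec (CommRingCat.of (AddMonoidAlgebra kk P)) ⟶ D.variety kk := (D.star kk).ι₀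

/-- The chart with index `i` as an open subscheme of the cluster variety. -/
def chart (i : I) : Spec (CommRingCat.of (AddMonoidAlgebra kk (D.cone i))) ⟶ D.variety kk :=
  (D.star kk).ι₁ i

instance : IsOpenImmersion (D.centralChart kk) :=
  inferInstanceAs (IsOpenImmersion (D.star kk).ι₀)

instance (i : I) : IsOpenImmersion (D.chart kk i) :=
  inferInstanceAs (IsOpenImmersion ((D.star kk).ι₁ i))

/-- The map of group algebras `z^q ↦ z^{h q}`. -/
def charHom {Q : Type u} [AddCommGroup Q] (h : Q →+ P) :
    AddMonoidAlgebra kk Q →ₐ[kk] AddMonoidAlgebra kk P :=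
  AddMonoidAlgebra.mapDomainAlgHom kk kk h

lemma charHom_single {Q : Type u} [AddCommGroup Q] (h : Q →+ P) (q : Q) (a : kk) :
    charHom kk h (AddMonoidAlgebra.single q a) = AddMonoidAlgebra.single (h q) a := by
  simp [charHom]

lemma chartRing_single (i : I) (p : D.cone i) : D.chartRing kk i (monomial kk p) =
    algebraMap _ _ (monomial kk (p : P)) * ((denUnit (D.den kk i) ^ (-(D.u i p)) :
      (Localization.Away (D.den kk i))ˣ) : Localization.Away (D.den kk i)) := by
  rw [chartRing, AlgHom.comp_apply, AddMonoidAlgebra.mapDomainAlgHom_apply,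
    AddMonoidAlgebra.mapDomain_single]
  exact mutation_monomial _ _ _

section toTorus
variable {Q : Type u} [AddCommGroup Q] (h : Q →+ P) (hu : ∀ i q, D.u i (h q) = 0)

/-- The map `z^q ↦ z^{h q}` with values in the functions on the chart `i`. -/
def toTorusChart (i : I) : AddMonoidAlgebra kk Q →ₐ[kk] AddMonoidAlgebra kk (D.cone i) :=
  AddMonoidAlgebra.mapDomainAlgHom kk kk
    (h.codRestrict (D.cone i) (fun q _ => (hu i q).ge))

lemma toTorus_condition (i : I) :
    (D.chartRing kk i).toRingHom.comp (toTorusChart D kk h hu i).toRingHom =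
      (algebraMap _ (Localization.Away (D.den kk i))).comp (charHom kk h).toRingHom := by
  have : (D.chartRing kk i).comp (toTorusChart D kk h hu i) =
      (IsScalarTower.toAlgHom kk (AddMonoidAlgebra kk P) (Localization.Away (D.den kk i))).comp
        (charHom kk h) := by
    apply AddMonoidAlgebra.algHom_ext
    · intro q
      rw [AlgHom.comp_apply, AlgHom.comp_apply, charHom_single, toTorusChart,
        AddMonoidAlgebra.mapDomainAlgHom_apply, AddMonoidAlgebra.mapDomain_single]
      refine (chartRing_single D kk i _).trans ?_
      have e : D.u i ((h.codRestrict (D.cone i) (fun q _ => (hu i q).ge)) q : P) = 0 := hu i q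
      rw [e]
      simp only [neg_zero, zpow_zero, Units.val_one, mul_one]
      rfl
    · exact Subsingleton.elim _ _
  exact congrArg AlgHom.toRingHom this

/-- The morphism to the torus `Spec kk[Q]` given by `z^q ↦ z^{h q}` on the central torus and on every
chart, for characters `h q` that are invariant under all mutations. -/
def toTorus : D.variety kk ⟶ Spec (CommRingCat.of (AddMonoidAlgebra kk Q)) :=
  (D.star kk).desc (specMap (charHom kk h).toRingHom)
    (fun i => specMap (toTorusChart D kk h hu i).toRingHom)
    (fun i => by
      change specMap _ ≫ specMap _ = specMap _ ≫ specMap _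
      rw [specMap, specMap, specMap, specMap, ← Spec.map_comp, ← Spec.map_comp,
        ← CommRingCat.ofHom_comp, ← CommRingCat.ofHom_comp, toTorus_condition])

end toTorus

lemma square_paste {A B C E F G H : Scheme.{u}} {a : A ⟶ B} {m : B ⟶ C} {n : A ⟶ E} {b : E ⟶ C}
    {j₁ : C ⟶ F} {c : E ⟶ G} {j₀ : G ⟶ F} {d : A ⟶ H} {k : H ⟶ G} (h₁ : a ≫ m = n ≫ b)
    (h : b ≫ j₁ = c ≫ j₀) (h₂ : n ≫ c = d ≫ k) : a ≫ m ≫ j₁ = d ≫ k ≫ j₀ := by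
  rw [reassoc_of% h₁, h, reassoc_of% h₂]

lemma square_paste' {A B C E F G : Scheme.{u}} {a : A ⟶ B} {m : B ⟶ C} {n : A ⟶ E} {b : E ⟶ C}
    {p : C ⟶ F} {q : E ⟶ F} {r : A ⟶ G} {r' : B ⟶ G} {j : G ⟶ F} (h₁ : a ≫ m = n ≫ b)
    (h₂ : b ≫ p = q) (h₃ : a ≫ r' = r) (h₄ : n ≫ q = r ≫ j) : a ≫ m ≫ p = a ≫ r' ≫ j := by
  rw [reassoc_of% h₁, h₂, h₄, reassoc_of% h₃]

section map
variable {P' : Type u} [AddCommGroup P'] (D' : ClusterData P' I) (h : P' →+ P)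
  (hF : D.frozen = D'.frozen) (hu : ∀ i p, D.u i (h p) = D'.u i p)
  (hψ : ∀ i, i ∉ D.frozen → h (D'.ψ i) = D.ψ i)

lemma map_mem_cone {P' : Type u} [AddCommGroup P'] (D' : ClusterData P' I) (h : P' →+ P)
    (hF : D.frozen = D'.frozen) (hu : ∀ i p, D.u i (h p) = D'.u i p) {i : I} {p : P'}
    (hp : p ∈ D'.cone i) : h p ∈ D.cone i :=
  fun hi => (hp (hF ▸ hi)).trans_eq (hu i p).symm

/-- The map `z^p ↦ z^{h p}` between the coordinate rings of the charts with index `i`. -/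
def mapChart (i : I) : AddMonoidAlgebra kk (D'.cone i) →ₐ[kk] AddMonoidAlgebra kk (D.cone i) :=
  AddMonoidAlgebra.mapDomainAlgHom kk kk
    ((h.comp (D'.cone i).subtype).codRestrict (D.cone i)
      (fun p => map_mem_cone D D' h hF hu p.2))

lemma charHom_den {P' : Type u} [AddCommGroup P'] (D' : ClusterData P' I) (h : P' →+ P)
    (hF : D.frozen = D'.frozen) (hψ : ∀ i, i ∉ D.frozen → h (D'.ψ i) = D.ψ i) (i : I) :
    charHom kk h (D'.den kk i) = D.den kk i := by
  by_cases hi : i ∈ D.frozen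
  · have h1 : D.den kk i = 1 := if_pos hi
    have h2 : D'.den kk i = 1 := if_pos (hF ▸ hi)
    rw [h1, h2, map_one]
  · have h1 : D.den kk i = 1 + monomial kk (D.ψ i) := if_neg hi
    have h2 : D'.den kk i = 1 + monomial kk (D'.ψ i) := if_neg (hF ▸ hi)
    rw [h1, h2, map_add, map_one, charHom_single, hψ i hi]

/-- The map `z^p ↦ z^{h p}` between the coordinate rings of the overlaps. -/
def mapLoc (i : I) : Localization.Away (D'.den kk i) →+* Localization.Away (D.den kk i) :=
  IsLocalization.Away.lift (S := Localization.Away (D'.den kk i)) (D'.den kk i)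
    (g := (algebraMap _ (Localization.Away (D.den kk i))).comp (charHom kk h).toRingHom)
    (by
      change IsUnit (algebraMap _ (Localization.Away (D.den kk i)) (charHom kk h (D'.den kk i)))
      rw [charHom_den D kk D' h hF hψ i]
      exact IsLocalization.Away.algebraMap_isUnit _)

lemma mapLoc_algebraMap (i : I) (x : AddMonoidAlgebra kk P') :
    mapLoc D kk D' h hF hψ i (algebraMap _ _ x) = algebraMap _ _ (charHom kk h x) :=
  IsLocalization.Away.lift_eq _ _ _

lemma mapLoc_denUnit (i : I) (k : ℤ) :
    mapLoc D kk D' h hF hψ i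
      ((denUnit (D'.den kk i) ^ k : (Localization.Away (D'.den kk i))ˣ) : Localization.Away _) =
      ((denUnit (D.den kk i) ^ k : (Localization.Away (D.den kk i))ˣ) : Localization.Away _) := by
  have h1 : Units.map (mapLoc D kk D' h hF hψ i).toMonoidHom (denUnit (D'.den kk i)) =
      denUnit (D.den kk i) := by
    ext
    change mapLoc D kk D' h hF hψ i (denUnit (D'.den kk i) : Localization.Away _) = _
    rw [coe_denUnit, mapLoc_algebraMap, charHom_den D kk D' h hF hψ i, coe_denUnit]
  have h2 : Units.map (mapLoc D kk D' h hF hψ i).toMonoidHom (denUnit (D'.den kk i) ^ k) =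
      denUnit (D.den kk i) ^ k := by rw [map_zpow, h1]
  exact congrArg Units.val h2

lemma map_condition (i : I) :
    (D.chartRing kk i).toRingHom.comp (mapChart D kk D' h hF hu i).toRingHom =
      (mapLoc D kk D' h hF hψ i).comp (D'.chartRing kk i).toRingHom := by
  apply AddMonoidAlgebra.ringHom_ext
  · intro a
    have e : (AddMonoidAlgebra.single (0 : D'.cone i) a : AddMonoidAlgebra kk (D'.cone i)) =
      algebraMap kk _ a := rfl
    change D.chartRing kk i (mapChart D kk D' h hF hu i _) =
      mapLoc D kk D' h hF hψ i (D'.chartRing kk i _)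
    rw [e, AlgHom.commutes, AlgHom.commutes, AlgHom.commutes,
      IsScalarTower.algebraMap_apply kk (AddMonoidAlgebra kk P')
        (Localization.Away (D'.den kk i)),
      mapLoc_algebraMap, AlgHom.commutes, ← IsScalarTower.algebraMap_apply]
  · intro p
    change D.chartRing kk i (mapChart D kk D' h hF hu i (monomial kk p)) =
      mapLoc D kk D' h hF hψ i (D'.chartRing kk i (monomial kk p))
    have e : mapChart D kk D' h hF hu i (monomial kk p) =
        monomial kk (⟨h p, map_mem_cone D D' h hF hu p.2⟩ : D.cone i) := by
      simp only [mapChart, AddMonoidAlgebra.mapDomainAlgHom_apply, monomial,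
        AddMonoidAlgebra.mapDomain_single]
      rfl
    rw [e, chartRing_single, chartRing_single, map_mul, mapLoc_algebraMap, mapLoc_denUnit,
      charHom_single, hu]

/-- The morphism of glued schemes which is the monomial map `z^p ↦ z^{h p}` on the central torus and
on every chart. -/
def map : D.variety kk ⟶ D'.variety kk :=
  (D.star kk).desc (specMap (charHom kk h).toRingHom ≫ (D'.star kk).ι₀)
    (fun i => specMap (mapChart D kk D' h hF hu i).toRingHom ≫ (D'.star kk).ι₁ i)
    (fun i => by
      have h1 : (D.star kk).toChart i ≫ specMap (mapChart D kk D' h hF hu i).toRingHom =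
          specMap (mapLoc D kk D' h hF hψ i) ≫ (D'.star kk).toChart i := by
        change specMap _ ≫ specMap _ = specMap _ ≫ specMap _
        rw [specMap, specMap, specMap, specMap, ← Spec.map_comp, ← Spec.map_comp,
          ← CommRingCat.ofHom_comp, ← CommRingCat.ofHom_comp,
          map_condition D kk D' h hF hu hψ i]
      have h2 : specMap (mapLoc D kk D' h hF hψ i) ≫ (D'.star kk).toCenter i =
          (D.star kk).toCenter i ≫ specMap (charHom kk h).toRingHom := by
        change specMap _ ≫ specMap _ = specMap _ ≫ specMap _
        rw [specMap, specMap, specMap, specMap, ← Spec.map_comp, ← Spec.map_comp,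
          ← CommRingCat.ofHom_comp, ← CommRingCat.ofHom_comp]
        congr 2
        exact RingHom.ext fun x => mapLoc_algebraMap D kk D' h hF hψ i x
      exact square_paste h1 ((D'.star kk).glue_comp i) h2)

lemma ι₀_map : (D.star kk).ι₀ ≫ map D kk D' h hF hu hψ =
    specMap (charHom kk h).toRingHom ≫ (D'.star kk).ι₀ :=
  (D.star kk).ι₀_desc _ _ _

lemma ι₁_map (i : I) : (D.star kk).ι₁ i ≫ map D kk D' h hF hu hψ =
    specMap (mapChart D kk D' h hF hu i).toRingHom ≫ (D'.star kk).ι₁ i :=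
  (D.star kk).ι₁_desc _ _ _ i

/-- A monomial morphism of glued schemes followed by a monomial morphism to a torus only depends on
the composite on characters. -/
lemma map_toTorus {Q Q' : Type u} [AddCommGroup Q] [AddCommGroup Q'] (g : Q →+ P')
    (hg : ∀ i q, D'.u i (g q) = 0) (g' : Q' →+ P) (hg' : ∀ i q, D.u i (g' q) = 0) (j : Q →+ Q')
    (hj : ∀ q, h (g q) = g' (j q)) :
    map D kk D' h hF hu hψ ≫ toTorus D' kk g hg =
      toTorus D kk g' hg' ≫ specMap (charHom kk j).toRingHom := by
  have aux : ∀ {A B C E : Type u} [CommRing A] [CommRing B] [CommRing C] [CommRing E]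
      (a : A →+* B) (b : B →+* C) (c : A →+* E) (d : E →+* C), b.comp a = d.comp c →
      specMap b ≫ specMap a = specMap d ≫ specMap c := by
    intro A B C E _ _ _ _ a b c d h
    rw [specMap, specMap, specMap, specMap, ← Spec.map_comp, ← Spec.map_comp,
      ← CommRingCat.ofHom_comp, ← CommRingCat.ofHom_comp, h]
  refine (D.star kk).hom_ext ?_ (fun i => ?_)
  · have e1 : (D.star kk).ι₀ ≫ toTorus D kk g' hg' = specMap (charHom kk g').toRingHom :=
      (D.star kk).ι₀_desc _ _ _
    have e2 : (D'.star kk).ι₀ ≫ toTorus D' kk g hg = specMap (charHom kk g).toRingHom :=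
      (D'.star kk).ι₀_desc _ _ _
    have e3 := ι₀_map D kk D' h hF hu hψ
    have e4 : specMap (charHom kk h).toRingHom ≫ specMap (charHom kk g).toRingHom =
        specMap (charHom kk g').toRingHom ≫ specMap (charHom kk j).toRingHom := by
      apply aux
      have : (charHom kk h).comp (charHom kk g) = (charHom kk g').comp (charHom kk j) := by
        apply AddMonoidAlgebra.algHom_ext
        · intro q
          simp only [AlgHom.comp_apply, charHom_single, hj]
        · exact Subsingleton.elim _ _
      exact congrArg AlgHom.toRingHom this
    exact (square_paste' e3 e2 e1 e4)
  · have e1 : (D.star kk).ι₁ i ≫ toTorus D kk g' hg' =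
        specMap (toTorusChart D kk g' hg' i).toRingHom :=
      (D.star kk).ι₁_desc _ _ _ i
    have e2 : (D'.star kk).ι₁ i ≫ toTorus D' kk g hg =
        specMap (toTorusChart D' kk g hg i).toRingHom :=
      (D'.star kk).ι₁_desc _ _ _ i
    have e3 := ι₁_map D kk D' h hF hu hψ i
    have e4 : specMap (mapChart D kk D' h hF hu i).toRingHom ≫
        specMap (toTorusChart D' kk g hg i).toRingHom =
        specMap (toTorusChart D kk g' hg' i).toRingHom ≫ specMap (charHom kk j).toRingHom := by
      apply aux
      have : (mapChart D kk D' h hF hu i).comp (toTorusChart D' kk g hg i) =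
          (toTorusChart D kk g' hg' i).comp (charHom kk j) := by
        apply AddMonoidAlgebra.algHom_ext
        · intro q
          simp only [AlgHom.comp_apply, charHom_single, mapChart, toTorusChart,
            AddMonoidAlgebra.mapDomainAlgHom_apply, AddMonoidAlgebra.mapDomain_single]
          congr 1
          exact Subtype.ext (hj q)
        · exact Subsingleton.elim _ _
      exact congrArg AlgHom.toRingHom this
    exact (square_paste' e3 e2 e1 e4)

end map
end
end ClusterData

/-- A seed: a basis `e` of a saturated sublattice of `N`, a subset of frozen indices, and an integral
bilinear form `[·,·]` with `[e i, e i] = 0` for every unfrozen `i` (no symmetry is required). -/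
structure Seed (N : Type u) [AddCommGroup N] (I : Type u) where
  e : I → N
  linearIndependent : LinearIndependent ℤ e
  saturated : ∀ (k : ℤ) (n : N), k ≠ 0 → k • n ∈ Submodule.span ℤ (Set.range e) →
    n ∈ Submodule.span ℤ (Set.range e)
  frozen : Set I
  form : N →ₗ[ℤ] N →ₗ[ℤ] ℤ
  form_self : ∀ i, i ∉ frozen → form (e i) (e i) = 0

namespace Seed
section
variable {N : Type u} [AddCommGroup N] {I : Type u} (S : Seed N I)

/-- The saturated sublattice `N_I` of `N` with basis `e`. -/
def NI : Submodule ℤ N := Submodule.span ℤ (Set.range S.e)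

/-- The dual lattice `M_I` of `N_I`. The dual lattice `M` of `N` is `Module.Dual ℤ N`. -/
abbrev MI : Type u := Module.Dual ℤ S.NI

/-- The basis vectors, as elements of `N_I`. -/
def eI (i : I) : S.NI := ⟨S.e i, Submodule.subset_span ⟨i, rfl⟩⟩

/-- `p₁ n = [n, ·]`. -/
def p₁ : N →ₗ[ℤ] Module.Dual ℤ N := S.form

/-- `p₂ n = [·, n]`. -/
def p₂ : N →ₗ[ℤ] Module.Dual ℤ N := S.form.flip

/-- The map `p̄₁ : N → M_I`, that is `p₁` followed by restriction to `N_I`. -/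
def p₁bar : N →ₗ[ℤ] S.MI := S.NI.dualRestrict ∘ₗ S.p₁

/-- The lattice `K₁` of the `k` in `N` with `[k, ·] = 0` on `N_I`. These are the characters `z^k` of the
central torus of the `𝒳`-variety whose image under `p̃₂` is a function of the coefficients alone. -/
def K₁ : AddSubgroup N := (LinearMap.ker S.p₁bar).toAddSubgroup

lemma form_of_mem_K₁ {k n : N} (hk : k ∈ S.K₁) (hn : n ∈ S.NI) : S.form k n = 0 :=
  congr($(show S.p₁bar k = 0 from hk) ⟨n, hn⟩)

/-- The data of the cluster `𝒜`-variety, with central torus `Spec kk[M]`, cocharacters `e i` and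
characters `p₁ (e i)`. -/
def aData : ClusterData (Module.Dual ℤ N) I where
  u i := (Module.Dual.eval ℤ N (S.e i)).toAddMonoidHom
  ψ i := S.p₁ (S.e i)
  frozen := S.frozen
  u_ψ i hi := S.form_self i hi

/-- The data of the cluster `𝒳`-variety, with central torus `Spec kk[N]`, cocharacters `p₂ (e i)` and
characters `e i`. -/
def xData : ClusterData N I where
  u i := (S.p₂ (S.e i)).toAddMonoidHom
  ψ i := S.e i
  frozen := S.frozen
  u_ψ i hi := S.form_self i hi

lemma span_eI : Submodule.span ℤ (Set.range S.eI) = ⊤ := by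
  have h := Submodule.span_span_coe_preimage (R := ℤ) (s := Set.range S.e)
  rw [eq_top_iff]
  refine h.ge.trans (Submodule.span_mono ?_)
  rintro x ⟨i, hi⟩
  exact ⟨i, Subtype.ext hi⟩

lemma mem_span_prin (x : S.NI × Module.Dual ℤ N) :
    x ∈ Submodule.span ℤ (Set.range fun i => ((S.eI i, 0) : S.NI × Module.Dual ℤ N)) ↔
      x.2 = 0 := by
  have h1 : Submodule.span ℤ (Set.range fun i => ((S.eI i, 0) : S.NI × Module.Dual ℤ N)) =
      LinearMap.range (LinearMap.inl ℤ S.NI (Module.Dual ℤ N)) := by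
    rw [LinearMap.range_eq_map, ← S.span_eI, Submodule.map_span, ← Set.range_comp]
    rfl
  rw [h1, LinearMap.range_inl, LinearMap.mem_ker, LinearMap.snd_apply]

lemma linearIndependent_inl {A B : Type u} [AddCommGroup A] [AddCommGroup B] {v : I → A}
    (h : LinearIndependent ℤ v) : @LinearIndependent I ℤ (A × B) (fun i => ((v i, 0) : A × B)) _ _
      (AddCommGroup.toIntModule _) := by
  refine LinearIndependent.of_comp (AddMonoidHom.fst A B).toIntLinearMap ?_
  exact h

lemma linearIndependent_eI : @LinearIndependent I ℤ S.NI S.eI _ _ (AddCommGroup.toIntModule _) := by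
  refine LinearIndependent.of_comp (S.NI.subtype.toAddMonoidHom).toIntLinearMap ?_
  exact S.linearIndependent

/-- The form `[(n₁, m₁), (n₂, m₂)] = [n₁, n₂] + ⟨n₁, m₂⟩ - ⟨n₂, m₁⟩` on `N_I ⊕ M`. -/
def prinForm : (S.NI × Module.Dual ℤ N) →ₗ[ℤ] (S.NI × Module.Dual ℤ N) →ₗ[ℤ] ℤ :=
  LinearMap.mk₂ ℤ (fun x y => S.form (x.1 : N) (y.1 : N) + y.2 (x.1 : N) - x.2 (y.1 : N))
    (fun x x' y => by
      simp only [Prod.fst_add, Prod.snd_add, Submodule.coe_add, map_add, LinearMap.add_apply]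
      ring)
    (fun c x y => by
      simp only [Prod.smul_fst, Prod.smul_snd, Submodule.coe_smul, map_smul, LinearMap.smul_apply]
      simp only [smul_eq_mul]; ring)
    (fun x y y' => by
      simp only [Prod.fst_add, Prod.snd_add, Submodule.coe_add, map_add, LinearMap.add_apply]
      ring)
    (fun c x y => by
      simp only [Prod.smul_fst, Prod.smul_snd, Submodule.coe_smul, map_smul, LinearMap.smul_apply]
      simp only [smul_eq_mul]; ring)

lemma prinForm_apply (x y : S.NI × Module.Dual ℤ N) :
    S.prinForm x y = S.form (x.1 : N) (y.1 : N) + y.2 (x.1 : N) - x.2 (y.1 : N) := rfl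

lemma prin_saturated (k : ℤ) (x : S.NI × Module.Dual ℤ N) (hk : k ≠ 0)
    (hx : k • x ∈ Submodule.span ℤ
      (Set.range fun i => ((S.eI i, 0) : S.NI × Module.Dual ℤ N))) :
    x ∈ Submodule.span ℤ (Set.range fun i => ((S.eI i, 0) : S.NI × Module.Dual ℤ N)) := by
  rw [mem_span_prin] at hx ⊢
  ext n
  have h4 : k • x.2 n = 0 := congr($hx n)
  simpa [hk] using h4

/-- The seed with principal coefficients, on the lattice `N_prin = N_I ⊕ M`, with basis `(e i, 0)`. -/
def prin : Seed (S.NI × Module.Dual ℤ N) I where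
  e i := (S.eI i, 0)
  linearIndependent := linearIndependent_inl S.linearIndependent_eI
  saturated k x hk hx := S.prin_saturated k x hk hx
  frozen := S.frozen
  form := S.prinForm
  form_self i hi := by
    rw [prinForm_apply]
    have h : S.form (S.eI i : N) (S.eI i : N) = 0 := S.form_self i hi
    simpa using h

/-- `p̃₂ : N_prin → M`, `(n, m) ↦ p₂ n + m`. -/
def ptilde : (S.NI × Module.Dual ℤ N) →ₗ[ℤ] Module.Dual ℤ N :=
  (S.p₂ ∘ₗ S.NI.subtype).coprod LinearMap.id

/-- `π : N_prin → M`, `(n, m) ↦ m`. -/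
def piLat : (S.NI × Module.Dual ℤ N) →ₗ[ℤ] Module.Dual ℤ N := LinearMap.snd ℤ _ _

/-- The map on characters `N → L^*` of a homomorphism of lattices `L → M`. -/
def dualChar {L : Type u} [AddCommGroup L] (f : L →ₗ[ℤ] Module.Dual ℤ N) :
    N →+ Module.Dual ℤ L :=
  (f.dualMap ∘ₗ Module.Dual.eval ℤ N).toAddMonoidHom

lemma dualChar_apply {L : Type u} [AddCommGroup L] (f : L →ₗ[ℤ] Module.Dual ℤ N) (n : N) (l : L) :
    dualChar f n l = f l n := rfl

variable (kk : Type u) [Field kk]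

/-- The cluster variety `𝒜^⋆` of the seed. -/
abbrev aVar : Scheme.{u} := S.aData.variety kk

/-- The cluster variety `𝒳^⋆` of the seed. -/
abbrev xVar : Scheme.{u} := S.xData.variety kk

/-- The cluster variety `𝒜_prin^⋆`. -/
abbrev aPrin : Scheme.{u} := S.prin.aVar kk

/-- The torus `T_M = Spec kk[N]` of coefficients. -/
abbrev TM : Scheme.{u} := Spec (CommRingCat.of (AddMonoidAlgebra kk N))

/-- The torus `T_{K₁^*} = Spec kk[K₁]`. -/
abbrev TK : Scheme.{u} := Spec (CommRingCat.of (AddMonoidAlgebra kk S.K₁))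

/-- `λ : 𝒳^⋆ → T_{K₁^*}`, given by `z^k ↦ z^k`. -/
def lamMor : S.xVar kk ⟶ S.TK kk :=
  S.xData.toTorus kk S.K₁.subtype (fun i k => S.form_of_mem_K₁ k.2 (S.eI i).2)

/-- `π : 𝒜_prin^⋆ → T_M`, given by `z^n ↦ z^{(0, n)}`. -/
def piMor : S.aPrin kk ⟶ TM (N := N) kk :=
  S.prin.aData.toTorus kk (dualChar S.piLat) (fun _ _ => rfl)

/-- `i : T_M → T_{K₁^*}`, given by `z^k ↦ z^k`. -/
def iotaMor : TM (N := N) kk ⟶ S.TK kk :=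
  specMap (ClusterData.charHom kk S.K₁.subtype).toRingHom

/-- `p̃₂ : 𝒜_prin^⋆ → 𝒳^⋆`, given by `z^n ↦ z^{(p̄₁ n, n)}` on the central tori. -/
def pTildeMor : S.aPrin kk ⟶ S.xVar kk :=
  S.prin.aData.map kk S.xData (dualChar S.ptilde) rfl
    (fun i n => by
      change S.form n (S.e i) + (0 : Module.Dual ℤ N) n = S.form n (S.e i)
      simp)
    (fun i _ => LinearMap.ext fun x => by
      change S.form (S.e i) (x.1 : N) + x.2 (S.e i) = S.prinForm (S.eI i, 0) x
      rw [prinForm_apply]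
      simp [eI])

/-- The square `λ ∘ p̃₂ = i ∘ π` commutes. -/
lemma pTildeMor_lamMor : S.pTildeMor kk ≫ S.lamMor kk = S.piMor kk ≫ S.iotaMor kk :=
  ClusterData.map_toTorus _ _ _ _ _ _ _ _ _ _ _ _ (fun k => LinearMap.ext fun x => by
    change S.form (k : N) (x.1 : N) + x.2 (k : N) = x.2 (k : N)
    rw [S.form_of_mem_K₁ k.2 x.1.2, zero_add])

/-- The `kk`-point of the torus `Spec kk[P]` given by a homomorphism `χ : P → kkˣ`, `z^p ↦ χ p`. -/
def point {P : Type u} [AddCommGroup P] (χ : Multiplicative P →* kkˣ) :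
    Spec (CommRingCat.of kk) ⟶ Spec (CommRingCat.of (AddMonoidAlgebra kk P)) :=
  specMap (AddMonoidAlgebra.lift kk kk P ((Units.coeHom kk).comp χ)).toRingHom

variable {kk}

/-- The image of the point `t` of `T_M` in `T_{K₁^*}`: the restriction of the character to `K₁`. -/
def res (t : Multiplicative N →* kkˣ) : Multiplicative S.K₁ →* kkˣ :=
  t.comp S.K₁.subtype.toMultiplicative

lemma point_iotaMor (t : Multiplicative N →* kkˣ) :
    point kk t ≫ S.iotaMor kk = point kk (S.res t) := by
  rw [point, iotaMor, point, specMap, specMap, specMap, ← Spec.map_comp, ← CommRingCat.ofHom_comp]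
  have : (AddMonoidAlgebra.lift kk kk N ((Units.coeHom kk).comp t)).comp
      (ClusterData.charHom kk S.K₁.subtype) =
      AddMonoidAlgebra.lift kk kk S.K₁ ((Units.coeHom kk).comp (S.res t)) := by
    apply AddMonoidAlgebra.algHom_ext
    · intro k
      rw [AlgHom.comp_apply, ClusterData.charHom_single, AddMonoidAlgebra.lift_single,
        AddMonoidAlgebra.lift_single]
      rfl
    · exact Subsingleton.elim _ _
  exact congrArg (fun f => Spec.map (CommRingCat.ofHom f)) (congrArg AlgHom.toRingHom this)

/-- The leaf `𝒳_φ^⋆`, the fiber of `λ` over `φ`. -/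
def leaf (φ : Multiplicative S.K₁ →* kkˣ) : Scheme.{u} := pullback (S.lamMor kk) (point kk φ)

/-- The inclusion of the leaf into `𝒳^⋆`. -/
def leafIncl (φ : Multiplicative S.K₁ →* kkˣ) : S.leaf φ ⟶ S.xVar kk :=
  pullback.fst (S.lamMor kk) (point kk φ)

/-- The variety `𝒜_t^⋆` with coefficients `t`, the fiber of `π` over `t`. Its ring of global functions
is the `⋆`-upper cluster algebra with coefficients `t`. -/
def aFiber (t : Multiplicative N →* kkˣ) : Scheme.{u} := pullback (S.piMor kk) (point kk t)

/-- The inclusion of `𝒜_t^⋆` into `𝒜_prin^⋆`. -/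
def aIncl (t : Multiplicative N →* kkˣ) : S.aFiber t ⟶ S.aPrin kk :=
  pullback.fst (S.piMor kk) (point kk t)

lemma pLeaf_condition (φ : Multiplicative S.K₁ →* kkˣ) (t : Multiplicative N →* kkˣ)
    (ht : S.res t = φ) :
    (pullback.fst (S.piMor kk) (point kk t) ≫ S.pTildeMor kk) ≫ S.lamMor kk =
      pullback.snd (S.piMor kk) (point kk t) ≫ point kk φ := by
  rw [Category.assoc, pTildeMor_lamMor, pullback.condition_assoc, point_iotaMor, ht]

/-- The restriction `p_{2,t} : 𝒜_t^⋆ → 𝒳_φ^⋆` of `p̃₂`, for `t` in the fiber of `i` over `φ`. -/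
def pLeaf (φ : Multiplicative S.K₁ →* kkˣ) (t : Multiplicative N →* kkˣ) (ht : S.res t = φ) :
    S.aFiber t ⟶ S.leaf φ :=
  pullback.lift (pullback.fst (S.piMor kk) (point kk t) ≫ S.pTildeMor kk)
    (pullback.snd (S.piMor kk) (point kk t)) (S.pLeaf_condition φ t ht)

end
end Seed

/-- The pullback along `g` of a function on the affine open subscheme `j`. -/
def pulledFun {X Y : Scheme.{u}} (g : Y ⟶ X) {A : Type u} [CommRing A]
    (j : Spec (CommRingCat.of A) ⟶ X) [IsOpenImmersion j] : A →+* Γ(Y, g ⁻¹ᵁ (j ''ᵁ ⊤)) :=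
  ((Scheme.ΓSpecIso (CommRingCat.of A)).inv ≫ (j.appIso ⊤).inv ≫ g.app (j ''ᵁ ⊤)).hom

open scoped Classical in
/-- The rational function on an integral scheme defined by a section over a nonempty open subset. -/
def ratFun {X : Scheme.{u}} [IsIntegral X] {U : X.Opens} (s : Γ(X, U)) : X.functionField :=
  if h : genericPoint X ∈ U then X.presheaf.germ U (genericPoint X) h s else 0

section Cox
variable (X : Scheme.{u}) [IsIntegral X]

/-- The local ring `𝒪_{X,x}` as a subring of the function field. -/
def localRing (x : X) : Subring X.functionField :=
  (algebraMap (X.presheaf.stalk x) X.functionField).range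

variable {X} {Λ : Type u} [AddCommGroup Λ] (d : X → (Multiplicative Λ →* X.functionFieldˣ))

/-- Let `d x m` be local equations at the points `x` of Cartier divisors `D m` depending additively on
`m`. This is the stalk at `x` of `𝒪_X(D m)`, the rational functions `f` with `f * d x m` regular at `x`. -/
def divStalk (x : X) (m : Λ) : AddSubgroup X.functionField where
  carrier := {f | f * (d x (Multiplicative.ofAdd m) : X.functionField) ∈ localRing X x}
  zero_mem' := by simp [zero_mem]
  add_mem' {f g} hf hg := by
    simpa [add_mul] using add_mem (S := Subring X.functionField) hf hg
  neg_mem' {f} hf := by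
    simpa using neg_mem (S := Subring X.functionField) hf

lemma mul_mem_divStalk {x : X} {m m' : Λ} {f g : X.functionField} (hf : f ∈ divStalk d x m)
    (hg : g ∈ divStalk d x m') : f * g ∈ divStalk d x (m + m') := by
  have hf' : f * (d x (Multiplicative.ofAdd m) : X.functionField) ∈ localRing X x := hf
  have hg' : g * (d x (Multiplicative.ofAdd m') : X.functionField) ∈ localRing X x := hg
  have h := mul_mem hf' hg'
  have e : f * g * (d x (Multiplicative.ofAdd (m + m')) : X.functionField) =
      f * (d x (Multiplicative.ofAdd m) : X.functionField) *
        (g * (d x (Multiplicative.ofAdd m') : X.functionField)) := by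
    rw [ofAdd_add, map_mul, Units.val_mul]; ring
  change _ ∈ localRing X x
  rw [e]; exact h

lemma one_mem_divStalk (x : X) : (1 : X.functionField) ∈ divStalk d x 0 := by
  change _ ∈ localRing X x
  rw [ofAdd_zero, map_one, Units.val_one, one_mul]
  exact one_mem _

/-- The stalk at `x` of the sheaf of graded algebras `ℛ = ⊕_m 𝒪_X(D m) z^m`, as a subring of `K(X)[Λ]`. -/
def rStalk (x : X) : Subring (AddMonoidAlgebra X.functionField Λ) where
  carrier := {F | ∀ m, F.coeff m ∈ divStalk d x m}
  zero_mem' m := zero_mem _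
  one_mem' m := by
    rw [AddMonoidAlgebra.one_def, AddMonoidAlgebra.coeff_single]
    by_cases h : m = 0
    · subst h
      rw [Finsupp.single_eq_same]
      exact one_mem_divStalk d x
    · rw [Finsupp.single_eq_of_ne h]
      exact zero_mem _
  add_mem' {F G} hF hG m := add_mem (hF m) (hG m)
  neg_mem' {F} hF m := neg_mem (hF m)
  mul_mem' {F G} hF hG m := by
    classical
    rw [AddMonoidAlgebra.coeff_mul]
    refine sum_mem fun a _ => sum_mem fun b _ => ?_
    dsimp only
    split_ifs with h
    · rw [← h]; exact mul_mem_divStalk d (hF a) (hG b)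
    · exact zero_mem _

/-- A shifting family: a homomorphism `ρ : Λ₀ → K(X)ˣ` with `ρ(m₀) 𝒪_X(D m) ⊆ 𝒪_X(D (m₀ + m))`. -/
structure ShiftingFamily (Λ₀ : AddSubgroup Λ) where
  toHom : Multiplicative Λ₀ →* X.functionFieldˣ
  shift : ∀ (x : X) (m₀ : Λ₀) (m : Λ), ∀ f ∈ divStalk d x m,
    (toHom (Multiplicative.ofAdd m₀) : X.functionField) * f ∈ divStalk d x (m₀ + m)

variable {d} {Λ₀ : AddSubgroup Λ} (ρ : ShiftingFamily d Λ₀)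

/-- The stalk at `x` of the ideal sheaf `ℐ` of `ℛ` generated by the `F - F ρ(m₀) z^{m₀}`. -/
def relIdeal (x : X) : Ideal (rStalk d x) :=
  Ideal.span {r | ∃ (F : rStalk d x) (m₀ : Λ₀), (r : AddMonoidAlgebra X.functionField Λ) =
    F - F * AddMonoidAlgebra.single (m₀ : Λ) (ρ.toHom (Multiplicative.ofAdd m₀) : X.functionField)}

/-- The Cox ring, i.e. the ring of global sections of the quotient sheaf `ℛ / ℐ`: families of elements
of the stalks `ℛ_x / ℐ_x` that are, locally on `X`, given by sections of `ℛ`. -/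
def Cox : Subring (∀ x, rStalk d x ⧸ relIdeal ρ x) where
  carrier := {s | ∀ x, ∃ U : X.Opens, x ∈ U ∧ ∃ (F : AddMonoidAlgebra X.functionField Λ)
    (hF : ∀ y ∈ U, F ∈ rStalk d y), ∀ (y) (hy : y ∈ U), s y = Ideal.Quotient.mk _ ⟨F, hF y hy⟩}
  zero_mem' x := ⟨⊤, trivial, 0, fun y _ => zero_mem _, fun y _ => (map_zero _).symm⟩
  one_mem' x := ⟨⊤, trivial, 1, fun y _ => one_mem _, fun y _ => (map_one _).symm⟩
  add_mem' {s s'} hs hs' x := by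
    obtain ⟨U, hU, F, hF, h⟩ := hs x
    obtain ⟨U', hU', F', hF', h'⟩ := hs' x
    exact ⟨U ⊓ U', ⟨hU, hU'⟩, F + F', fun y hy => add_mem (hF y hy.1) (hF' y hy.2),
      fun y hy => (congrArg₂ (· + ·) (h y hy.1) (h' y hy.2)).trans (map_add _ _ _).symm⟩
  neg_mem' {s} hs x := by
    obtain ⟨U, hU, F, hF, h⟩ := hs x
    exact ⟨U, hU, -F, fun y hy => neg_mem (hF y hy),
      fun y hy => (congrArg (- ·) (h y hy)).trans (map_neg _ _).symm⟩
  mul_mem' {s s'} hs hs' x := by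
    obtain ⟨U, hU, F, hF, h⟩ := hs x
    obtain ⟨U', hU', F', hF', h'⟩ := hs' x
    exact ⟨U ⊓ U', ⟨hU, hU'⟩, F * F', fun y hy => mul_mem (hF y hy.1) (hF' y hy.2),
      fun y hy => (congrArg₂ (· * ·) (h y hy.1) (h' y hy.2)).trans (map_mul _ _ _).symm⟩

end Cox

namespace Seed
variable {N : Type u} [AddCommGroup N] {I : Type u} (S : Seed N I) {kk : Type u} [Field kk]
variable (φ : Multiplicative S.K₁ →* kkˣ) (t : Multiplicative N →* kkˣ)

/-- The open subset of the leaf covered by the chart `i`. -/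
def leafOpen (i : I) : (S.leaf φ).Opens := S.leafIncl φ ⁻¹ᵁ (S.xData.chart kk i).opensRange

/-- A function on the central torus, restricted to the leaf. -/
def leafFun : AddMonoidAlgebra kk N →+*
    Γ(S.leaf φ, S.leafIncl φ ⁻¹ᵁ (S.xData.centralChart kk ''ᵁ ⊤)) :=
  pulledFun (S.leafIncl φ) (X := S.xVar kk) (S.xData.centralChart kk)

section
variable [IsIntegral (S.leaf φ)]

/-- A function on the central torus, as a rational function on the leaf. -/
def leafRat (f : AddMonoidAlgebra kk N) : (S.leaf φ).functionField := ratFun (S.leafFun φ f)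

open scoped Classical in
/-- The equation, on the chart `i`, of the exceptional divisor `E_i` (`i` unfrozen) or of the boundary
divisor `D_i` (`i` frozen). It is `1 + z^{e i}` in the unfrozen case (this function is the same in the
coordinates of the chart and of the center). In the frozen case it is `z^n` for any `n` with
`[n, e i] = 1`, which exists if `p₂ (e i)` is primitive. -/
def divisorFun (i : I) : AddMonoidAlgebra kk N :=
  if i ∈ S.frozen then monomial kk (Classical.epsilon fun n : N => S.form n (S.e i) = 1)
  else 1 + monomial kk (S.e i)

open scoped Classical in
/-- The local equation at a point `x` of the divisor `E_{i,φ}` or `D_{i,φ}` of the leaf: the equation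
above if `x` is on the chart `i`, and `1` elsewhere, as the divisor is closed and lies in the chart. -/
def localEqn (i : I) (x : S.leaf φ) : (S.leaf φ).functionFieldˣ :=
  if h : x ∈ S.leafOpen φ i ∧ S.leafRat φ (S.divisorFun i) ≠ 0 then Units.mk0 _ h.2 else 1

/-- The local equations of the divisors `W_φ(m) = ∑_i ⟨e i, m⟩ E_{i,φ}` (with `D_{i,φ}` for `i` frozen). -/
def W [Fintype I] (x : S.leaf φ) : Multiplicative S.MI →* (S.leaf φ).functionFieldˣ where
  toFun m := ∏ i, S.localEqn φ i x ^ (m.toAdd (S.eI i))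
  map_one' := by simp
  map_mul' m m' := by simp [zpow_add, Finset.prod_mul_distrib]

end

/-- The sublattice `p̄₁(N)` of `M_I`. -/
def Λ₀ : AddSubgroup S.MI := (LinearMap.range S.p₁bar).toAddSubgroup

/-- The part of `𝒜_t^⋆` on the central torus of `𝒜_prin^⋆`. -/
def aCentral : (S.aFiber t).Opens := S.aIncl t ⁻¹ᵁ (S.prin.aData.centralChart kk ''ᵁ ⊤)

/-- A function on the central torus of `𝒜_prin^⋆`, restricted to `𝒜_t^⋆`. -/
def aFun : AddMonoidAlgebra kk (Module.Dual ℤ (S.NI × Module.Dual ℤ N)) →+*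
    Γ(S.aFiber t, S.aCentral t) :=
  pulledFun (S.aIncl t) (X := S.aPrin kk) (S.prin.aData.centralChart kk)

/-- The monomials `z^{(m, 0)}`, for `m` in `M_I`, as functions on `𝒜_t^⋆`. -/
def zM : Multiplicative S.MI →* Γ(S.aFiber t, S.aCentral t) where
  toFun m := S.aFun t (monomial kk (m.toAdd ∘ₗ LinearMap.fst ℤ S.NI (Module.Dual ℤ N)))
  map_one' := by
    rw [toAdd_one, LinearMap.zero_comp]
    exact map_one _
  map_mul' m m' := by
    rw [← map_mul, monomial, monomial, monomial, AddMonoidAlgebra.single_mul_single, one_mul,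
      toAdd_mul, LinearMap.add_comp]

variable {φ t}

/-- The map `p̃₂^♯` at a point `y` of the central torus of `𝒜_t^⋆`: it sends `f z^m`, where `f` is a
regular function on the leaf at the image of `y`, to `p̃₂^*(f) z^{(m, 0)}`. -/
def pSharp (ht : S.res t = φ) (y : S.aFiber t) (hy : y ∈ S.aCentral t) :
    AddMonoidAlgebra ((S.leaf φ).presheaf.stalk (S.pLeaf φ t ht y)) S.MI →+*
      (S.aFiber t).presheaf.stalk y :=
  AddMonoidAlgebra.liftNCRingHom ((S.pLeaf φ t ht).stalkMap y).hom
    (((S.aFiber t).presheaf.germ (S.aCentral t) y hy).hom.toMonoidHom.comp (S.zM t))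
    (fun _ _ => Commute.all _ _)

end Seed
end ClusterCox

end

open ClusterCox

/-!
The leaf `𝒳_φ` and the variety `𝒜_t` are fibers of morphisms from cluster varieties to tori that
are monomial on every chart. The fiber of a chart `Spec kk[C]` (with `C` a monoid of characters in
a lattice `P`) over a point of the torus is again the spectrum of a monoid algebra, `kk[π(C)]`,
where `π` is the quotient of `P` by the characters of the torus: the character `t` serves to split
off the characters that become constant (`twistHom_isPushout`). For both fibers `π` takes values in
the lattice `M_I`, with `π = p̄₁` for the leaf and `π` the restriction to `N_I` for `𝒜_t`. These
algebras are domains, and the hypothesis on `φ` makes every chart of the leaf meet its central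
torus, so both fibers are integral (`ClusterData.fiber_isIntegral`).

Everything then takes place in the function fields `K(𝒳_φ)` and `K(𝒜_t)`. A function on a piece of
a fiber is a rational function, and the coordinate functions of a chart and of the center differ by
powers of `1 + z^{ψ i}` (`ClusterData.pieceRat_some`). On the piece `k` of the leaf the sheaf
`𝒪(W(m))` is generated by a single function (`Seed.mem_divStalk_iff`), and `t(n) z^{-n}` is a
shifting family (`Seed.xShift`), because the divisor of `z^n` on the leaf is `W(p̄₁ n)`.

The homomorphism `f z^m ↦ p̃₂^*(f) z^{(m, 0)}` from `K(𝒳_φ)[M_I]` to `K(𝒜_t)` kills the relations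
(`Seed.pEval_shift`). Conversely, the relations reduce every section of `ℛ` over a piece of the
leaf to a combination of the lifts of the coordinate functions of the corresponding piece of `𝒜_t`
(`Seed.exists_relIdeal_sub_xLift`), and on these lifts the homomorphism is injective
(`Seed.pEval_xLift`). So the stalks of `ℛ / ℐ` embed into `K(𝒜_t)`
(`Seed.mem_relIdeal_of_pEval_eq_zero`), and with them the Cox ring. Its image is the set of
rational functions that are coordinate functions on every piece of `𝒜_t`: an element of the image
is locally on the leaf a fraction of such functions, and the denominators generate the unit ideal
(`Seed.exists_aRat_eq_coxRat`); in the other direction the lifts glue (`Seed.exists_coxRat_eq`).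
The same set is the image of the ring of global functions of `𝒜_t`, which gives the isomorphism
(`Seed.exists_cox_ringEquiv`).
-/

noncomputable section
namespace ClusterCox

/-! ### Functions on affine open subschemes and their germs -/

namespace OpenStar
variable {I : Type u} (D : OpenStar I)

lemma b_ι (j : Option I) : D.b j ≫ D.ι j = D.a j ≫ D.ι₀ := by
  cases j with
  | none => rfl
  | some i => exact D.glue_comp i

/-- Distinct pieces only meet inside the center. -/
lemma exists_ι_eq_ι₀ {i j : Option I} (h : i ≠ j) {x : D.U i} {y : D.U j}
    (e : D.ι i x = D.ι j y) : ∃ z : D.V i, D.ι i x = D.ι₀ (D.a i z) := by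
  obtain ⟨w, hw, -⟩ := (D.glueData.ι_eq_iff i j x y).mp e
  obtain ⟨e', he⟩ := D.f_comp h (D.ι i)
  let w' := (eqToHom e') w
  refine ⟨pullback.fst (D.a i) (D.a j) w', ?_⟩
  have h1 : (D.glueData.f i j ≫ D.ι i) w = D.ι i x := congrArg (D.ι i) hw
  refine h1.symm.trans ((congrArg (fun m => m w) he).trans ?_)
  rw [f, Category.assoc, b_ι]
  rfl

end OpenStar

section StalkEval
variable {X V : Scheme.{u}} (g : X ⟶ V) {A : Type u} [CommRing A]
  (j : Spec (CommRingCat.of A) ⟶ V) [IsOpenImmersion j]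

/-- The germ at `x` of the pullback along `g` of a function on the affine open subscheme `j`. -/
def stalkEval (x : X) (h : x ∈ g ⁻¹ᵁ (j ''ᵁ ⊤)) : A →+* X.presheaf.stalk x :=
  (X.presheaf.germ _ x h).hom.comp (pulledFun g j)

lemma mem_preimage_iff (x : X) : x ∈ g ⁻¹ᵁ (j ''ᵁ ⊤) ↔ ∃ p, j p = g x := by
  constructor
  · rintro ⟨p, -, hp⟩; exact ⟨p, hp⟩
  · rintro ⟨p, hp⟩; exact ⟨p, trivial, hp⟩

/-- The germ at `v` of a function on the affine open subscheme `j`. -/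
def chartGerm (v : V) (hv : v ∈ j ''ᵁ ⊤) : CommRingCat.of A ⟶ V.presheaf.stalk v :=
  (Scheme.ΓSpecIso (CommRingCat.of A)).inv ≫ (j.appIso ⊤).inv ≫ V.presheaf.germ _ v hv

lemma chartGerm_comp_stalkMap (p : Spec (CommRingCat.of A)) (h : j p ∈ j ''ᵁ ⊤) :
    chartGerm j (j p) h ≫ j.stalkMap p =
      (Scheme.ΓSpecIso (CommRingCat.of A)).inv ≫
        (Spec (CommRingCat.of A)).presheaf.germ ⊤ p trivial := by
  simp only [chartGerm, Category.assoc, Scheme.Hom.germ_stalkMap, Scheme.Hom.appIso_inv_app_assoc]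
  congr 1
  exact (Spec (CommRingCat.of A)).presheaf.germ_res _ p h

lemma stalkEval_eq (x : X) (h : x ∈ g ⁻¹ᵁ (j ''ᵁ ⊤)) (h' : g x ∈ j ''ᵁ ⊤) :
    CommRingCat.ofHom (stalkEval g j x h) = chartGerm j (g x) h' ≫ g.stalkMap x := by
  have e : CommRingCat.ofHom (stalkEval g j x h) =
      ((Scheme.ΓSpecIso (CommRingCat.of A)).inv ≫ (j.appIso ⊤).inv ≫ g.app (j ''ᵁ ⊤)) ≫
        X.presheaf.germ _ x h := rfl
  rw [e]
  unfold chartGerm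
  simp only [Category.assoc]
  rw [Scheme.Hom.germ_stalkMap]

lemma specMap_chartGerm (v : V) (hv : v ∈ j ''ᵁ ⊤) :
    Spec.map (chartGerm j v hv) ≫ j = V.fromSpecStalk v := by
  obtain ⟨p, -, hp⟩ := id hv
  replace hp : j p = v := hp
  subst hp
  rw [← cancel_epi (Spec.map (j.stalkMap p)), Scheme.SpecMap_stalkMap_fromSpecStalk,
    ← Spec.map_comp_assoc, chartGerm_comp_stalkMap, Spec.fromSpecStalk_eq]

lemma specMap_stalkEval (x : X) (h : x ∈ g ⁻¹ᵁ (j ''ᵁ ⊤)) :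
    specMap (stalkEval g j x h) ≫ j = X.fromSpecStalk x ≫ g := by
  have h' : g x ∈ j ''ᵁ ⊤ := h
  rw [specMap, stalkEval_eq g j x h h', Spec.map_comp, Category.assoc, specMap_chartGerm,
    Scheme.SpecMap_stalkMap_fromSpecStalk]

variable {j} in
lemma isUnit_chartGerm (p : Spec (CommRingCat.of A)) (h : j p ∈ j ''ᵁ ⊤) (s : A)
    (hs : s ∉ p.asIdeal) : IsUnit ((chartGerm j (j p) h).hom s) := by
  apply isUnit_of_map_unit (j.stalkMap p).hom
  rw [← CommRingCat.comp_apply, chartGerm_comp_stalkMap]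
  let p' : PrimeSpectrum A := p
  exact IsLocalization.map_units (M := p'.asIdeal.primeCompl)
    ((Spec.structureSheaf A).presheaf.stalk p') ⟨s, hs⟩

variable {j} in
lemma exists_chartGerm_mul_eq (p : Spec (CommRingCat.of A)) (h : j p ∈ j ''ᵁ ⊤)
    (f : V.presheaf.stalk (j p)) :
    ∃ a s : A, s ∉ p.asIdeal ∧ f * (chartGerm j (j p) h).hom s = (chartGerm j (j p) h).hom a := by
  let p' : PrimeSpectrum A := p
  obtain ⟨⟨a, s⟩, e⟩ := IsLocalization.surj (M := p'.asIdeal.primeCompl)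
    (S := (Spec.structureSheaf A).presheaf.stalk p') ((j.stalkMap p).hom f)
  refine ⟨a, s, s.2, ?_⟩
  apply (ConcreteCategory.bijective_of_isIso (j.stalkMap p)).1
  refine (map_mul _ _ _).trans ?_
  rw [← CommRingCat.comp_apply, ← CommRingCat.comp_apply, chartGerm_comp_stalkMap]
  exact e

lemma isUnit_stalkEval (x : X) (h : x ∈ g ⁻¹ᵁ (j ''ᵁ ⊤)) (p : Spec (CommRingCat.of A))
    (hp : j p = g x) (s : A) (hs : s ∉ p.asIdeal) : IsUnit (stalkEval g j x h s) := by
  have h' : g x ∈ j ''ᵁ ⊤ := h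
  have e : stalkEval g j x h s = (g.stalkMap x).hom ((chartGerm j (g x) h').hom s) :=
    congr($(stalkEval_eq g j x h h').hom s)
  rw [e]
  refine IsUnit.map _ ?_
  have aux : ∀ v (hv : v ∈ j ''ᵁ ⊤), j p = v → IsUnit ((chartGerm j v hv).hom s) := by
    rintro v hv rfl
    exact isUnit_chartGerm p hv s hs
  exact aux _ h' hp

/-- An open immersion of an affine scheme presents the stalks as localizations. -/
lemma exists_stalkEval_mul_eq {j : Spec (CommRingCat.of A) ⟶ X} [IsOpenImmersion j] {x : X}
    (p : Spec (CommRingCat.of A)) (hp : j p = x) (h : x ∈ 𝟙 X ⁻¹ᵁ (j ''ᵁ ⊤))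
    (f : X.presheaf.stalk x) :
    ∃ a s : A, s ∉ p.asIdeal ∧ f * stalkEval (𝟙 X) j x h s = stalkEval (𝟙 X) j x h a := by
  subst hp
  have h' : j p ∈ j ''ᵁ ⊤ := h
  obtain ⟨a, s, hs, e⟩ := exists_chartGerm_mul_eq p h' f
  have e' : ∀ a, stalkEval (𝟙 X) j (j p) h a = (chartGerm j (j p) h').hom a := fun a => by
    have := congr($(stalkEval_eq (𝟙 X) j (j p) h h').hom a)
    refine this.trans ?_
    rw [CommRingCat.comp_apply]
    exact congr($(Scheme.Hom.stalkMap_id X (j p)).hom _)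
  exact ⟨a, s, hs, by rw [e', e', e]⟩

end StalkEval

/-! ### Rational functions on integral schemes -/

section Integral
variable {X V : Scheme.{u}} [IsIntegral X] (g : X ⟶ V) {A : Type u} [CommRing A]
  (j : Spec (CommRingCat.of A) ⟶ V) [IsOpenImmersion j]

lemma genericPoint_mem {U : X.Opens} {x : X} (hx : x ∈ U) : genericPoint X ∈ U :=
  ((genericPoint_spec X).mem_open_set_iff U.isOpen).mpr ⟨x, trivial, hx⟩

/-- The rational function on `X` given by pulling back along `g` a function on the affine open
subscheme `j`. -/
def ratEval (h : genericPoint X ∈ g ⁻¹ᵁ (j ''ᵁ ⊤)) : A →+* X.functionField :=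
  stalkEval g j (genericPoint X) h

lemma ratFun_pulledFun (h : genericPoint X ∈ g ⁻¹ᵁ (j ''ᵁ ⊤)) (a : A) :
    ratFun (pulledFun g j a) = ratEval g j h a := dif_pos h

/-- The germ of a function at any point has the same image in the function field. -/
lemma algebraMap_stalkEval (x : X) (h : x ∈ g ⁻¹ᵁ (j ''ᵁ ⊤))
    (h' : genericPoint X ∈ g ⁻¹ᵁ (j ''ᵁ ⊤)) (a : A) :
    algebraMap _ X.functionField (stalkEval g j x h a) = ratEval g j h' a := by
  have := X.presheaf.germ_stalkSpecializes h ((genericPoint_spec X).specializes trivial : _ ⤳ x)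
  exact congr($(this).hom (pulledFun g j a))

lemma specMap_ratEval (h : genericPoint X ∈ g ⁻¹ᵁ (j ''ᵁ ⊤)) :
    specMap (ratEval g j h) ≫ j = X.fromSpecStalk (genericPoint X) ≫ g :=
  specMap_stalkEval g j _ h

lemma ringHom_eq_of_specMap_comp {B : Type u} [CommRing B] {f f' : A →+* B}
    (h : specMap f ≫ j = specMap f' ≫ j) : f = f' := by
  rw [cancel_mono] at h
  exact congrArg CommRingCat.Hom.hom (Spec.map_injective h)

lemma ratEval_mem_localRing {x : X} (h : x ∈ g ⁻¹ᵁ (j ''ᵁ ⊤))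
    (h' : genericPoint X ∈ g ⁻¹ᵁ (j ''ᵁ ⊤)) (a : A) : ratEval g j h' a ∈ localRing X x :=
  ⟨stalkEval g j x h a, algebraMap_stalkEval g j x h h' a⟩

/-- A function is invertible in the local rings of the points where it does not vanish. -/
lemma ratEval_inv_mem_localRing {x : X} (h' : genericPoint X ∈ g ⁻¹ᵁ (j ''ᵁ ⊤))
    (p : Spec (CommRingCat.of A)) (hp : j p = g x) {s : A} (hs : s ∉ p.asIdeal) :
    ratEval g j h' s ≠ 0 ∧ (ratEval g j h' s)⁻¹ ∈ localRing X x := by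
  have h := (mem_preimage_iff g j x).mpr ⟨p, hp⟩
  obtain ⟨v, hv⟩ := isUnit_stalkEval g j x h p hp s hs
  have e : algebraMap _ X.functionField (v : X.presheaf.stalk x) = ratEval g j h' s := by
    rw [hv]; exact algebraMap_stalkEval g j x h h' s
  have e2 : algebraMap _ X.functionField (v : X.presheaf.stalk x) *
      algebraMap _ X.functionField ((v⁻¹ : (X.presheaf.stalk x)ˣ) : X.presheaf.stalk x) = 1 := by
    rw [← map_mul, Units.mul_inv, map_one]
  rw [← e]
  exact ⟨left_ne_zero_of_mul_eq_one e2, _, eq_inv_of_mul_eq_one_right e2⟩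

/-- The local ring at a point of an affine open subscheme consists of the fractions of functions on
that subscheme. -/
lemma exists_mul_ratEval_eq {j : Spec (CommRingCat.of A) ⟶ X} [IsOpenImmersion j]
    (h' : genericPoint X ∈ 𝟙 X ⁻¹ᵁ (j ''ᵁ ⊤)) {x : X}
    (p : Spec (CommRingCat.of A)) (hp : j p = x) {f : X.functionField} (hf : f ∈ localRing X x) :
    ∃ a s : A, s ∉ p.asIdeal ∧ f * ratEval (𝟙 X) j h' s = ratEval (𝟙 X) j h' a := by
  obtain ⟨f, rfl⟩ := hf
  have h := (mem_preimage_iff (𝟙 X) j x).mpr ⟨p, hp⟩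
  obtain ⟨a, s, hs, e⟩ := exists_stalkEval_mul_eq p hp h f
  refine ⟨a, s, hs, ?_⟩
  rw [← algebraMap_stalkEval (𝟙 X) j x h h', ← algebraMap_stalkEval (𝟙 X) j x h h', ← map_mul, e]

lemma ratEval_injective {j : Spec (CommRingCat.of A) ⟶ X} [IsOpenImmersion j]
    (h' : genericPoint X ∈ 𝟙 X ⁻¹ᵁ (j ''ᵁ ⊤)) : Function.Injective (ratEval (𝟙 X) j h') := by
  have : Function.Injective (pulledFun (𝟙 X) j) :=
    (ConcreteCategory.bijective_of_isIso ((Scheme.ΓSpecIso (CommRingCat.of A)).inv ≫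
      (j.appIso ⊤).inv ≫ (𝟙 X : X ⟶ X).app (j ''ᵁ ⊤))).1
  exact (germ_injective_of_isIntegral X _ h').comp this

/-- A rational function on an integral scheme that is regular on each member of a covering is
a global regular function. -/
lemma exists_germ_top_eq {ι : Type u} (U : ι → X.Opens) (hU : ∀ x, ∃ i, x ∈ U i)
    (hη : ∀ i, genericPoint X ∈ U i) (f : X.functionField)
    (hf : ∀ i, ∃ s : Γ(X, U i), X.presheaf.germ (U i) (genericPoint X) (hη i) s = f) :
    ∃ s : Γ(X, ⊤), X.presheaf.germ ⊤ (genericPoint X) trivial s = f := by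
  choose s hs using hf
  obtain ⟨i₀, hi₀⟩ := hU (genericPoint X)
  obtain ⟨t, ht, -⟩ := X.sheaf.existsUnique_gluing' U ⊤ (fun i => homOfLE le_top)
    (fun x _ => by simpa using hU x) s (fun i k => by
      have hik : genericPoint X ∈ U i ⊓ U k := ⟨hη i, hη k⟩
      apply germ_injective_of_isIntegral X _ hik
      refine (TopCat.Presheaf.germ_res_apply X.presheaf _ _ hik _).trans
        (Eq.trans ?_ (TopCat.Presheaf.germ_res_apply X.presheaf _ _ hik _).symm)
      rw [hs, hs])
  refine ⟨t, ?_⟩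
  rw [← hs i₀, ← ht i₀]
  exact (TopCat.Presheaf.germ_res_apply X.presheaf _ _ _ _).symm

end Integral

section Fiber
variable {V T W Y Z : Scheme.{u}} (l : V ⟶ T) (pt : W ⟶ T) {j : Z ⟶ V} {a : Y ⟶ Z} {b : Y ⟶ W}
  (H : IsPullback a b (j ≫ l) pt)

/-- The chart of the fiber product of `l` and `pt` induced by a chart of its first factor. -/
def fiberChart : Y ⟶ pullback l pt :=
  pullback.lift (a ≫ j) b (by rw [Category.assoc, H.w])

lemma fiberChart_fst : fiberChart l pt H ≫ pullback.fst l pt = a ≫ j := pullback.lift_fst _ _ _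
lemma fiberChart_snd : fiberChart l pt H ≫ pullback.snd l pt = b := pullback.lift_snd _ _ _

lemma fiberChart_isPullback : IsPullback a (fiberChart l pt H) j (pullback.fst l pt) :=
  IsPullback.of_bot ((fiberChart_snd l pt H).symm ▸ H) (fiberChart_fst l pt H).symm
    (IsPullback.of_hasPullback l pt)

lemma fiberChart_isOpenImmersion [IsOpenImmersion j] : IsOpenImmersion (fiberChart l pt H) :=
  MorphismProperty.of_isPullback (fiberChart_isPullback l pt H) ‹_›

lemma exists_fiberChart_eq (z : Z) (x : ↑(pullback l pt)) (h : j z = pullback.fst l pt x) :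
    ∃ y, fiberChart l pt H y = x ∧ a y = z := by
  obtain ⟨y, h1, h2⟩ := Scheme.exists_preimage_of_isPullback (fiberChart_isPullback l pt H) z x h
  exact ⟨y, h2, h1⟩

end Fiber

section Integrality
variable {X : Scheme.{u}} {ι : Type u} {Y : Option ι → Scheme.{u}} (c : ∀ k, Y k ⟶ X)
  [∀ k, IsOpenImmersion (c k)] [∀ k, IsIntegral (Y k)]

/-- A scheme covered by integral open subschemes, each of which meets a fixed one, is integral. -/
lemma isIntegral_of_cover (hc : ∀ x, ∃ k y, c k y = x)
    (hm : ∀ k, ∃ y z, c k y = c none z) : IsIntegral X := by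
  have hred : IsReduced X := by
    have (x : X) : _root_.IsReduced (X.presheaf.stalk x) := by
      obtain ⟨k, y, rfl⟩ := hc x
      exact isReduced_of_injective _
        (asIso <| (c k).stalkMap y).commRingCatIsoToRingEquiv.injective
    exact isReduced_of_isReduced_stalk _
  have hirr : IrreducibleSpace X := by
    have hmem : ∀ k l (y : Y k) (z : Y l), c k y = c l z →
        c l (genericPoint (Y l)) ⤳ c k (genericPoint (Y k)) := by
      intro k l y z e
      have h : genericPoint (Y k) ∈ c k ⁻¹ᵁ (c l).opensRange :=
        genericPoint_mem (x := y) ⟨z, e.symm⟩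
      obtain ⟨w, hw⟩ := h
      have hw' : c l w = c k (genericPoint (Y k)) := hw
      rw [← hw']
      exact ((genericPoint_spec (Y l)).specializes trivial).map (c l).continuous
    have hη : ∀ k, c k (genericPoint (Y k)) = c none (genericPoint (Y none)) := by
      intro k
      obtain ⟨y, z, e⟩ := hm k
      exact ((hmem none k z y e.symm).antisymm (hmem k none y z e)).eq
    -- All the pieces have the same generic point.
    have hgen : closure {c none (genericPoint (Y none))} = Set.univ := by
      refine Set.eq_univ_of_forall fun x => ?_
      obtain ⟨k, y, rfl⟩ := hc x
      rw [← hη k, ← specializes_iff_mem_closure]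
      exact ((genericPoint_spec (Y k)).specializes trivial).map (c k).continuous
    have h1 : IsIrreducible (closure {c none (genericPoint (Y none))}) :=
      isIrreducible_singleton.closure
    rw [hgen] at h1
    exact irreducibleSpace_def X |>.mpr h1
  exact isIntegral_of_irreducibleSpace_of_isReduced X

end Integrality

/-! ### Restriction of monoid algebras to fibers -/

section Pushout
open AddMonoidAlgebra
variable {kk : Type u} [Field kk] {P Q Λ : Type u} [AddCommGroup P] [AddCommGroup Q]
  [AddCommGroup Λ] (π : P →+ Λ) (τ : Multiplicative P →* kkˣ) {C : Type u} [AddCommMonoid C]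
  (σ : C →+ P)

/-- The characters of `Λ` that are restrictions of characters of a chart. -/
abbrev restrCone : AddSubmonoid Λ := AddMonoidHom.mrange (π.comp σ)

/-- The restriction to the fiber of a character of the chart. -/
def toRestrCone (c : C) : restrCone π σ := ⟨π (σ c), c, rfl⟩

/-- The restriction of functions from a chart to its fiber: `z^c ↦ τ(σ c) z^{π (σ c)}`. -/
def twistHom : AddMonoidAlgebra kk C →ₐ[kk] AddMonoidAlgebra kk (restrCone π σ) :=
  AddMonoidAlgebra.lift kk _ C
    { toFun := fun c => single (toRestrCone π σ c.toAdd) (τ (Multiplicative.ofAdd (σ c.toAdd)) : kk)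
      map_one' := by
        rw [toAdd_one, map_zero, ofAdd_zero, map_one, AddMonoidAlgebra.one_def, Units.val_one]
        congr 1
        exact Subtype.ext (by simp [toRestrCone])
      map_mul' := fun c d => by
        rw [single_mul_single, toAdd_mul, map_add, ofAdd_add, map_mul, Units.val_mul]
        congr 1
        exact Subtype.ext (by simp [toRestrCone]) }

lemma twistHom_single (c : C) (a : kk) : twistHom π τ σ (single c a) =
    single (toRestrCone π σ c) (a * (τ (Multiplicative.ofAdd (σ c)) : kk)) := by
  simp [twistHom]

lemma twistHom_surjective : Function.Surjective (twistHom π τ σ) := by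
  intro x
  induction x using AddMonoidAlgebra.induction_linear with
  | zero => exact ⟨0, map_zero _⟩
  | add a b ha hb =>
    obtain ⟨a, rfl⟩ := ha
    obtain ⟨b, rfl⟩ := hb
    exact ⟨a + b, map_add _ _ _⟩
  | single p a =>
    obtain ⟨_, c, rfl⟩ := p
    refine ⟨single c (a * ((τ (Multiplicative.ofAdd (σ c)))⁻¹ : kkˣ)), ?_⟩
    rw [twistHom_single, Units.inv_mul_cancel_right]
    rfl

/-- A ring homomorphism that is constant, up to the twist, on the fibers of `C → Λ` descends. -/
lemma exists_twistHom_desc {h : Q →+ P} (hπ : ∀ p, π p = 0 ↔ p ∈ h.range)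
    {χ : Multiplicative Q →* kkˣ}
    (hχ : ∀ q, χ (Multiplicative.ofAdd q) = τ (Multiplicative.ofAdd (h q)))
    (hσ : Function.Injective σ) {hC : Q →+ C} (hhC : ∀ q, σ (hC q) = h q)
    {R : Type u} [CommRing R] (a : AddMonoidAlgebra kk C →+* R) (b : kk →+* R)
    (hab : ∀ q r, a (single (hC q) r) = b (r * χ (Multiplicative.ofAdd q))) :
    ∃ d : AddMonoidAlgebra kk (restrCone π σ) →+* R,
      (∀ x, d (twistHom π τ σ x) = a x) ∧ ∀ r, d (algebraMap kk _ r) = b r := by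
  have hb : ∀ r, a (single 0 r) = b r := fun r => by
    have := hab 0 r
    rwa [map_zero, ofAdd_zero, map_one, Units.val_one, mul_one] at this
  have hτ : ∀ p, b (τ (Multiplicative.ofAdd (-p)) : kk) * b (τ (Multiplicative.ofAdd p) : kk) = 1 :=
    fun p => by
    rw [← map_mul, ← Units.val_mul, ← map_mul, ← ofAdd_add, neg_add_cancel, ofAdd_zero, map_one,
      Units.val_one, map_one]
  -- The value at `z^{π (σ c)}` has to be the value at `z^c`, divided by the constant `τ (σ c)`.
  let g₀ : C → R := fun c => a (single c 1) * b (τ (Multiplicative.ofAdd (-σ c)) : kk)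
  have hg₀ : ∀ c c', g₀ (c + c') = g₀ c * g₀ c' := fun c c' => by
    simp only [g₀]
    rw [map_add, neg_add, ofAdd_add, map_mul, Units.val_mul, map_mul, ← one_mul (1 : kk),
      ← single_mul_single, map_mul, one_mul]
    ring
  have hwd : ∀ c c', π (σ c) = π (σ c') → g₀ c = g₀ c' := fun c c' e => by
    obtain ⟨q, hq⟩ := (hπ (σ c - σ c')).mp (by rw [map_sub, e, sub_self])
    have hc : c = hC q + c' := hσ (by rw [map_add, hhC, hq, sub_add_cancel])
    have h1 : g₀ (hC q) = 1 := by
      simp only [g₀]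
      rw [hab, one_mul, hχ, hhC, mul_comm, hτ]
    rw [hc, hg₀, h1, one_mul]
  let g : restrCone π σ → R := fun m => g₀ m.2.choose
  have hg : ∀ c, g (toRestrCone π σ c) = g₀ c := fun c =>
    hwd _ _ (toRestrCone π σ c).2.choose_spec
  let G : Multiplicative (restrCone π σ) →* R :=
    { toFun := fun m => g m.toAdd
      map_one' := by
        have : (Multiplicative.toAdd (1 : Multiplicative (restrCone π σ))) =
            toRestrCone π σ 0 := Subtype.ext (by simp [toRestrCone])
        rw [this, hg]
        simp only [g₀]
        rw [map_zero, neg_zero, ofAdd_zero, map_one, Units.val_one, map_one, mul_one, hb, map_one]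
      map_mul' := by
        rintro ⟨_, c, rfl⟩ ⟨_, c', rfl⟩
        have := (hg (c + c')).trans ((hg₀ c c').trans (congrArg₂ (· * ·) (hg c) (hg c')).symm)
        refine Eq.trans (congrArg g (Subtype.ext ?_)) this
        exact (map_add (π.comp σ) c c').symm }
  refine ⟨AddMonoidAlgebra.liftNCRingHom b G (fun _ _ => Commute.all _ _), fun x => ?_, fun r => ?_⟩
  · induction x using AddMonoidAlgebra.induction_linear with
    | zero => rw [map_zero, map_zero, map_zero]
    | add x y hx hy => rw [map_add, map_add, map_add, hx, hy]
    | single c r =>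
      rw [twistHom_single]
      refine (AddMonoidAlgebra.liftNC_single _ _ _ _).trans ?_
      change b _ * g (toRestrCone π σ c) = _
      rw [hg, map_mul]
      simp only [g₀]
      have h1 : (single c r : AddMonoidAlgebra kk C) = single 0 r * single c 1 := by
        rw [single_mul_single, zero_add, mul_one]
      rw [h1, map_mul, hb]
      linear_combination (b r * a (single c 1)) * hτ (σ c)
  · refine (AddMonoidAlgebra.liftNC_single _ _ _ _).trans ?_
    rw [ofAdd_zero, map_one, mul_one]
    rfl

/-- Let `π` be a homomorphism with kernel `h(Q)`. The fiber of `Spec kk[C] → Spec kk[Q]` over the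
point `χ` is the spectrum of the algebra of the monoid `π(σ(C))`. -/
lemma twistHom_isPushout {h : Q →+ P} (hπ : ∀ p, π p = 0 ↔ p ∈ h.range)
    {χ : Multiplicative Q →* kkˣ}
    (hχ : ∀ q, χ (Multiplicative.ofAdd q) = τ (Multiplicative.ofAdd (h q)))
    (hσ : Function.Injective σ) {hC : Q →+ C} (hhC : ∀ q, σ (hC q) = h q) : IsPushout
    (CommRingCat.ofHom (mapDomainAlgHom kk kk hC).toRingHom)
    (CommRingCat.ofHom (AddMonoidAlgebra.lift kk kk Q ((Units.coeHom kk).comp χ)).toRingHom)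
    (CommRingCat.ofHom (twistHom π τ σ).toRingHom)
    (CommRingCat.ofHom (algebraMap kk (AddMonoidAlgebra kk (restrCone π σ)))) := by
  have hπ0 : ∀ q, π (h q) = 0 := fun q => (hπ _).mpr ⟨q, rfl⟩
  have key : ∀ (s : PushoutCocone (CommRingCat.ofHom (mapDomainAlgHom kk kk hC).toRingHom)
      (CommRingCat.ofHom (AddMonoidAlgebra.lift kk kk Q ((Units.coeHom kk).comp χ)).toRingHom)),
      ∃ d : AddMonoidAlgebra kk (restrCone π σ) →+* s.pt,
      (∀ x, d (twistHom π τ σ x) = s.inl.hom x) ∧ ∀ r, d (algebraMap kk _ r) = s.inr.hom r :=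
    fun s => exists_twistHom_desc π τ σ hπ hχ hσ hhC s.inl.hom s.inr.hom (fun q r => by
      have h1 := congr($(s.condition).hom (single q r))
      simpa [AddMonoidAlgebra.lift_single] using h1)
  choose d hd using key
  refine ⟨⟨?_⟩, ⟨PushoutCocone.IsColimit.mk _ (fun s => CommRingCat.ofHom (d s)) ?_ ?_ ?_⟩⟩
  · refine CommRingCat.hom_ext (RingHom.ext fun x => ?_)
    change twistHom π τ σ (mapDomainAlgHom kk kk hC x) =
      algebraMap kk _ (AddMonoidAlgebra.lift kk kk Q ((Units.coeHom kk).comp χ) x)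
    induction x using AddMonoidAlgebra.induction_linear with
    | zero => simp only [map_zero]
    | add x y hx hy => simp only [map_add, hx, hy]
    | single q r =>
      rw [mapDomainAlgHom_apply, mapDomain_single, twistHom_single, AddMonoidAlgebra.lift_single]
      change _ = single 0 _
      have : toRestrCone π σ (hC q) = 0 := Subtype.ext (by simp [toRestrCone, hhC, hπ0])
      rw [this, hhC, ← hχ]
      rfl
  · intro s
    refine CommRingCat.hom_ext (RingHom.ext fun x => ?_)
    exact (hd s).1 x
  · intro s
    refine CommRingCat.hom_ext (RingHom.ext fun x => ?_)
    exact (hd s).2 x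
  · intro s m hm _
    refine CommRingCat.hom_ext (RingHom.ext fun x => ?_)
    obtain ⟨x, rfl⟩ := twistHom_surjective π τ σ x
    exact congr($(hm).hom x).trans ((hd s).1 x).symm

instance [TwoUniqueSums Λ] (Λ' : AddSubmonoid Λ) : UniqueSums Λ' :=
  haveI : TwoUniqueSums Λ' := TwoUniqueSums.of_injective_addHom (Λ'.subtype : Λ' →+ Λ).toAddHom
    Subtype.val_injective inferInstance
  inferInstance

instance [TwoUniqueSums Λ] (Λ' : AddSubmonoid Λ) : IsDomain (AddMonoidAlgebra kk Λ') :=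
  inferInstance
end Pushout

/-! ### Fibers of a cluster variety over a torus -/

namespace ClusterData
variable {P : Type u} [AddCommGroup P] {I : Type u} (D : ClusterData P I)
variable (kk : Type u) [Field kk]

/-- The monoid of characters that are regular on a piece: all of `P` for the central torus. -/
def PieceMonoid : Option I → Type u
  | none => P
  | some i => D.cone i

instance : ∀ k, AddCommMonoid (D.PieceMonoid k)
  | none => inferInstanceAs (AddCommMonoid P)
  | some i => inferInstanceAs (AddCommMonoid (D.cone i))

/-- The inclusion of the regular characters of a piece in all characters. -/
def pieceIncl : ∀ k, D.PieceMonoid k →+ P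
  | none => AddMonoidHom.id P
  | some i => (D.cone i).subtype

lemma pieceIncl_injective : ∀ k, Function.Injective (D.pieceIncl k)
  | none => Function.injective_id
  | some _ => Subtype.val_injective

/-- A piece as an open subscheme of the cluster variety. -/
def piece : ∀ k, Spec (CommRingCat.of (AddMonoidAlgebra kk (D.PieceMonoid k))) ⟶ D.variety kk
  | none => D.centralChart kk
  | some i => D.chart kk i

instance : ∀ k, IsOpenImmersion (D.piece kk k)
  | none => inferInstanceAs (IsOpenImmersion (D.centralChart kk))
  | some i => inferInstanceAs (IsOpenImmersion (D.chart kk i))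

lemma exists_piece_eq (x : D.variety kk) : ∃ k y, D.piece kk k y = x := by
  obtain ⟨k, y, h⟩ := (D.star kk).exists_ι_eq x
  cases k with
  | none => exact ⟨none, y, h⟩
  | some i => exact ⟨some i, y, h⟩

lemma mem_range_toCenter (i : I) (w : Spec (CommRingCat.of (AddMonoidAlgebra kk P))) :
    (∃ z, (D.star kk).toCenter i z = w) ↔ D.den kk i ∉ w.asIdeal := by
  have := PrimeSpectrum.localization_away_comap_range (Localization.Away (D.den kk i)) (D.den kk i)
  exact Set.ext_iff.mp this w

/-- A point of the chart `i` that also lies in another piece is a point of the central torus at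
which the denominator of the chart `i` does not vanish. -/
lemma exists_center_of_piece_eq {i : I} {k : Option I} (hk : k ≠ some i)
    {z : Spec (CommRingCat.of (AddMonoidAlgebra kk (D.PieceMonoid (some i))))}
    {y : Spec (CommRingCat.of (AddMonoidAlgebra kk (D.PieceMonoid k)))}
    (h : D.piece kk (some i) z = D.piece kk k y) :
    ∃ w, D.piece kk none w = D.piece kk k y ∧ D.den kk i ∉ w.asIdeal := by
  have h' : ∃ y', (D.star kk).ι (some i) z = (D.star kk).ι k y' := by
    cases k with
    | none => exact ⟨y, h⟩
    | some l => exact ⟨y, h⟩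
  obtain ⟨y', h'⟩ := h'
  obtain ⟨w, hw⟩ := (D.star kk).exists_ι_eq_ι₀ hk.symm h'
  exact ⟨(D.star kk).toCenter i w, hw.symm.trans h, (D.mem_range_toCenter kk i _).mp ⟨w, rfl⟩⟩

lemma exists_piece_some_eq {i : I} {w : Spec (CommRingCat.of (AddMonoidAlgebra kk P))}
    (hw : D.den kk i ∉ w.asIdeal) : ∃ z, D.piece kk (some i) z = D.piece kk none w := by
  obtain ⟨v, rfl⟩ := (D.mem_range_toCenter kk i w).mpr hw
  exact ⟨(D.star kk).toChart i v, congr($((D.star kk).glue_comp i) v)⟩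

section
variable {Q : Type u} [AddCommGroup Q] (h : Q →+ P) (hu : ∀ i q, D.u i (h q) = 0)

/-- The invariant characters `h q`, as regular characters of a piece. -/
def toPiece : ∀ k, Q →+ D.PieceMonoid k
  | none => h
  | some i => h.codRestrict (D.cone i) (fun q _ => (hu i q).ge)

lemma pieceIncl_toPiece : ∀ k q, D.pieceIncl k (D.toPiece h hu k q) = h q
  | none, _ => rfl
  | some _, _ => rfl

lemma piece_toTorus : ∀ k, D.piece kk k ≫ D.toTorus kk h hu =
    specMap (AddMonoidAlgebra.mapDomainAlgHom kk kk (D.toPiece h hu k)).toRingHom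
  | none => (D.star kk).ι₀_desc _ _ _
  | some i => (D.star kk).ι₁_desc _ _ _ i

variable {kk} {Λ : Type u} [AddCommGroup Λ] (π : P →+ Λ) (τ : Multiplicative P →* kkˣ)

/-- The lattice data that identifies the fiber of `D.toTorus kk h hu` over the point `χ`: the map
`π` exhibits `P / h(Q)` as a subgroup of `Λ`, and `τ` extends `χ` to `P`. The last condition says
that no chart misses the central torus of the fiber. -/
structure FiberData (χ : Multiplicative Q →* kkˣ) : Prop where
  map_eq_zero_iff : ∀ p, π p = 0 ↔ p ∈ h.range
  extends_ : ∀ q, χ (Multiplicative.ofAdd q) = τ (Multiplicative.ofAdd (h q))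
  den_ne_zero : ∀ i, twistHom π τ (AddMonoidHom.id P) (D.den kk i) ≠ 0

/-- The fiber of the morphism to the torus over a point. -/
abbrev fiber (χ : Multiplicative Q →* kkˣ) : Scheme.{u} :=
  pullback (D.toTorus kk h hu) (Seed.point kk χ)

/-- The inclusion of the fiber in the cluster variety. -/
abbrev fiberIncl (χ : Multiplicative Q →* kkˣ) : D.fiber h hu χ ⟶ D.variety kk :=
  pullback.fst (D.toTorus kk h hu) (Seed.point kk χ)

variable {D h π τ} {χ : Multiplicative Q →* kkˣ} (E : D.FiberData h π τ χ)

/-- The coordinate ring of the fiber of a piece. -/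
abbrev FiberRing (D : ClusterData P I) (kk : Type u) [Field kk] (π : P →+ Λ) (k : Option I) :
    Type u := AddMonoidAlgebra kk (restrCone π (D.pieceIncl k))

/-- Restriction of functions from a piece to its fiber. -/
abbrev toFiberRing (D : ClusterData P I) (π : P →+ Λ) (τ : Multiplicative P →* kkˣ) (k : Option I) :
    AddMonoidAlgebra kk (D.PieceMonoid k) →ₐ[kk] D.FiberRing kk π k :=
  twistHom π τ (D.pieceIncl k)

include E in
lemma piece_isPullback (k : Option I) : IsPullback (specMap (D.toFiberRing π τ k).toRingHom)
    (specMap (algebraMap kk (D.FiberRing kk π k))) (D.piece kk k ≫ D.toTorus kk h hu)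
    (Seed.point kk χ) := by
  rw [piece_toTorus]
  exact isPullback_SpecMap_of_isPushout _ _ _ _
    (twistHom_isPushout π τ (D.pieceIncl k) E.map_eq_zero_iff E.extends_
      (D.pieceIncl_injective k) (D.pieceIncl_toPiece h hu k))

/-- The piece of the fiber that lies in the piece `k` of the cluster variety. -/
def fiberPiece (k : Option I) :
    Spec (CommRingCat.of (D.FiberRing kk π k)) ⟶ D.fiber h hu χ :=
  fiberChart _ _ (piece_isPullback hu E k)

instance (k : Option I) : IsOpenImmersion (fiberPiece hu E k) :=
  fiberChart_isOpenImmersion _ _ (piece_isPullback hu E k)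

lemma fiberPiece_incl (k : Option I) : fiberPiece hu E k ≫ D.fiberIncl h hu χ =
    specMap (D.toFiberRing π τ k).toRingHom ≫ D.piece kk k :=
  fiberChart_fst _ _ (piece_isPullback hu E k)

include E in
lemma exists_fiberPiece_eq {k : Option I} {x : D.fiber h hu χ}
    {z : Spec (CommRingCat.of (AddMonoidAlgebra kk (D.PieceMonoid k)))}
    (hz : D.piece kk k z = D.fiberIncl h hu χ x) :
    ∃ y, fiberPiece hu E k y = x ∧ specMap (D.toFiberRing π τ k).toRingHom y = z :=
  exists_fiberChart_eq _ _ (piece_isPullback hu E k) z x hz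

include E in
lemma fiber_isIntegral [TwoUniqueSums Λ] : IsIntegral (D.fiber h hu χ) := by
  refine isIntegral_of_cover (fiberPiece hu E) (fun x => ?_) (fun k => ?_)
  · obtain ⟨k, z, hz⟩ := D.exists_piece_eq kk (D.fiberIncl h hu χ x)
    obtain ⟨y, hy, -⟩ := exists_fiberPiece_eq hu E hz
    exact ⟨k, y, hy⟩
  · cases k with
    | none =>
      let y : Spec (CommRingCat.of (D.FiberRing kk π none)) :=
        (⊥ : PrimeSpectrum (D.FiberRing kk π none))
      exact ⟨y, y, rfl⟩
    | some i =>
      -- The generic point of the central torus lies in the chart, as the denominator is nonzero.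
      let y : Spec (CommRingCat.of (D.FiberRing kk π none)) :=
        (⊥ : PrimeSpectrum (D.FiberRing kk π none))
      have hy : D.den kk i ∉ (specMap (D.toFiberRing π τ none).toRingHom y).asIdeal :=
        E.den_ne_zero i
      obtain ⟨z, hz⟩ := D.exists_piece_some_eq kk hy
      have h1 : D.piece kk none (specMap (D.toFiberRing π τ none).toRingHom y) =
          D.fiberIncl h hu χ (fiberPiece hu E none y) :=
        congr($(fiberPiece_incl hu E none) y).symm
      obtain ⟨w, hw, -⟩ := exists_fiberPiece_eq hu E (hz.trans h1)
      exact ⟨w, y, hw⟩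

end
end ClusterData

/-! ### Rational functions on a fiber -/

namespace ClusterData
variable {P : Type u} [AddCommGroup P] {I : Type u} {D : ClusterData P I}
variable {kk : Type u} [Field kk] {Q : Type u} [AddCommGroup Q] {h : Q →+ P}
  (hu : ∀ i q, D.u i (h q) = 0) {Λ : Type u} [AddCommGroup Λ] [TwoUniqueSums Λ] {π : P →+ Λ}
  {τ : Multiplicative P →* kkˣ} {χ : Multiplicative Q →* kkˣ} (E : D.FiberData h π τ χ)
  [IsIntegral (D.fiber h hu χ)]

lemma genericPoint_mem_fiberPiece (k : Option I) :
    genericPoint (D.fiber h hu χ) ∈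
      𝟙 (D.fiber h hu χ) ⁻¹ᵁ (fiberPiece hu E k ''ᵁ ⊤) := by
  let y : Spec (CommRingCat.of (D.FiberRing kk π k)) := (⊥ : PrimeSpectrum (D.FiberRing kk π k))
  exact genericPoint_mem (x := fiberPiece hu E k y) ⟨y, trivial, rfl⟩

include E in
lemma genericPoint_mem_piece (k : Option I) :
    genericPoint (D.fiber h hu χ) ∈ D.fiberIncl h hu χ ⁻¹ᵁ (D.piece kk k ''ᵁ ⊤) := by
  let y : Spec (CommRingCat.of (D.FiberRing kk π k)) := (⊥ : PrimeSpectrum (D.FiberRing kk π k))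
  refine genericPoint_mem (x := fiberPiece hu E k y) ?_
  exact (mem_preimage_iff _ _ _).mpr ⟨specMap (D.toFiberRing π τ k).toRingHom y,
    congr($(fiberPiece_incl hu E k) y).symm⟩

/-- The rational function on the fiber defined by a function on a piece of the cluster variety. -/
def pieceRat (k : Option I) :
    AddMonoidAlgebra kk (D.PieceMonoid k) →+* (D.fiber h hu χ).functionField :=
  ratEval (D.fiberIncl h hu χ) (D.piece kk k) (genericPoint_mem_piece hu E k)

/-- The rational function defined by a function on a piece of the fiber. -/
def fiberRat (k : Option I) : D.FiberRing kk π k →+* (D.fiber h hu χ).functionField :=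
  ratEval (𝟙 (D.fiber h hu χ)) (fiberPiece hu E k) (genericPoint_mem_fiberPiece hu E k)

lemma fiberRat_injective (k : Option I) : Function.Injective (fiberRat hu E k) :=
  ratEval_injective _

/-- A function on a piece and its restriction to the fiber define the same rational function. -/
lemma fiberRat_toFiberRing (k : Option I) (x : AddMonoidAlgebra kk (D.PieceMonoid k)) :
    fiberRat hu E k (D.toFiberRing π τ k x) = pieceRat hu E k x := by
  have : (fiberRat hu E k).comp (D.toFiberRing π τ k).toRingHom = pieceRat hu E k := by
    apply ringHom_eq_of_specMap_comp (D.piece kk k)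
    have e1 := specMap_ratEval (D.fiberIncl h hu χ) (D.piece kk k)
      (genericPoint_mem_piece hu E k)
    have e2 := specMap_ratEval (𝟙 (D.fiber h hu χ)) (fiberPiece hu E k)
      (genericPoint_mem_fiberPiece hu E k)
    have e3 : specMap ((fiberRat hu E k).comp (D.toFiberRing π τ k).toRingHom) =
        specMap (fiberRat hu E k) ≫ specMap (D.toFiberRing π τ k).toRingHom := by
      rw [specMap, specMap, specMap, ← Spec.map_comp, ← CommRingCat.ofHom_comp]
    rw [e3, Category.assoc, ← fiberPiece_incl hu E k]
    refine Eq.trans ?_ e1.symm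
    rw [← Category.assoc]
    exact (congrArg (· ≫ D.fiberIncl h hu χ) e2).trans (by rw [Category.comp_id])
  exact congr($this x)

lemma pieceRat_eq_iff (k : Option I) (x y : AddMonoidAlgebra kk (D.PieceMonoid k)) :
    pieceRat hu E k x = pieceRat hu E k y ↔ D.toFiberRing π τ k x = D.toFiberRing π τ k y := by
  rw [← fiberRat_toFiberRing, ← fiberRat_toFiberRing, (fiberRat_injective hu E k).eq_iff]

/-- The rational function on the fiber defined by a function on the central torus. -/
def centerRat : AddMonoidAlgebra kk P →+* (D.fiber h hu χ).functionField := pieceRat hu E none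

lemma centerRat_eq_iff (x y : AddMonoidAlgebra kk P) : centerRat hu E x = centerRat hu E y ↔
    twistHom π τ (AddMonoidHom.id P) x = twistHom π τ (AddMonoidHom.id P) y :=
  pieceRat_eq_iff hu E none x y

lemma centerRat_den_ne_zero (i : I) : centerRat hu E (D.den kk i) ≠ 0 := by
  intro h0
  exact E.den_ne_zero i
    (((centerRat_eq_iff hu E _ 0).mp (h0.trans (map_zero _).symm)).trans (map_zero _))

/-- The mutation formula, for rational functions on the fiber. -/
lemma pieceRat_some (i : I) (c : D.cone i) (a : kk) :
    pieceRat hu E (some i) (AddMonoidAlgebra.single (M := D.cone i) c a) =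
      centerRat hu E (AddMonoidAlgebra.single (c : P) a) *
        centerRat hu E (D.den kk i) ^ (-(D.u i c)) := by
  have hunit : IsUnit (centerRat hu E (D.den kk i)) :=
    isUnit_iff_ne_zero.mpr (centerRat_den_ne_zero hu E i)
  -- The extension of `centerRat` to the overlap; `pieceRat` is its composite with `chartRing`.
  let β : Localization.Away (D.den kk i) →+* (D.fiber h hu χ).functionField :=
    IsLocalization.Away.lift (S := Localization.Away (D.den kk i)) (D.den kk i)
      (g := centerRat hu E) hunit
  have hβ : ∀ x, β (algebraMap _ _ x) = centerRat hu E x :=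
    fun x => IsLocalization.Away.lift_eq _ hunit x
  have key : β.comp (D.chartRing kk i).toRingHom = pieceRat hu E (some i) := by
    apply ringHom_eq_of_specMap_comp (D.piece kk (some i))
    have e1 := specMap_ratEval (D.fiberIncl h hu χ) (D.piece kk (some i))
      (genericPoint_mem_piece hu E (some i))
    have e2 := specMap_ratEval (D.fiberIncl h hu χ) (D.piece kk none)
      (genericPoint_mem_piece hu E none)
    refine Eq.trans ?_ e1.symm
    refine Eq.trans ?_ e2
    have e3 : specMap (β.comp (D.chartRing kk i).toRingHom) =
        specMap β ≫ specMap (D.chartRing kk i).toRingHom := by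
      rw [specMap, specMap, specMap, ← Spec.map_comp, ← CommRingCat.ofHom_comp]
    have e4 : specMap (centerRat hu E) = specMap β ≫
        specMap (algebraMap (AddMonoidAlgebra kk P) (Localization.Away (D.den kk i))) := by
      rw [specMap, specMap, specMap, ← Spec.map_comp, ← CommRingCat.ofHom_comp]
      congr 2
      exact RingHom.ext fun x => (hβ x).symm
    have e5 : specMap (D.chartRing kk i).toRingHom ≫ D.piece kk (some i) =
        specMap (algebraMap (AddMonoidAlgebra kk P) (Localization.Away (D.den kk i))) ≫
          D.piece kk none := (D.star kk).glue_comp i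
    refine (congrArg (· ≫ D.piece kk (some i)) e3).trans
      (Eq.trans ?_ (congrArg (· ≫ D.piece kk none) e4).symm)
    exact (Category.assoc _ _ _).trans ((congrArg (specMap β ≫ ·) e5).trans
      (Category.assoc _ _ _).symm)
  have e6 : Units.map β.toMonoidHom (denUnit (D.den kk i)) = hunit.unit := Units.ext (hβ _)
  have e7 : Units.map β.toMonoidHom (denUnit (D.den kk i) ^ (-(D.u i c))) =
      hunit.unit ^ (-(D.u i c)) := by rw [map_zpow, e6]
  have e8 : D.chartRing kk i (AddMonoidAlgebra.single c a) =
      algebraMap _ _ (AddMonoidAlgebra.single (c : P) a) * ((denUnit (D.den kk i) ^ (-(D.u i c)) :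
      (Localization.Away (D.den kk i))ˣ) : Localization.Away (D.den kk i)) := by
    have h1 := congrArg (a • ·) (chartRing_single D kk i c)
    have h2 : algebraMap (AddMonoidAlgebra kk P) (Localization.Away (D.den kk i))
        (AddMonoidAlgebra.single (c : P) a) = a • algebraMap _ _ (monomial kk (c : P)) := by
      have h3 : (AddMonoidAlgebra.single (c : P) a : AddMonoidAlgebra kk P) =
          algebraMap kk _ a * monomial kk (c : P) := by
        change _ = AddMonoidAlgebra.single 0 a * AddMonoidAlgebra.single (c : P) 1
        rw [AddMonoidAlgebra.single_mul_single, zero_add, mul_one]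
      rw [h3, map_mul, ← IsScalarTower.algebraMap_apply, Algebra.smul_def]
    simp only [← map_smul, AddMonoidAlgebra.smul_single, smul_eq_mul, mul_one] at h1
    rw [h1, ← smul_mul_assoc, h2]
  rw [← key]
  change β (D.chartRing kk i _) = _
  rw [e8, map_mul, hβ]
  congr 1
  exact (congrArg Units.val e7).trans (Units.val_zpow_eq_zpow_val _ _)

/-- The factor `(1 + z^{ψ i})^{-⟨u i, p⟩}` by which the monomials of a piece and of the center
differ. -/
def mutFactor : Option I → P → (D.fiber h hu χ).functionField
  | none, _ => 1
  | some i, p => centerRat hu E (D.den kk i) ^ (-(D.u i p))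

lemma pieceRat_single (k : Option I) (c : D.PieceMonoid k) (a : kk) :
    pieceRat hu E k (AddMonoidAlgebra.single c a) =
      centerRat hu E (AddMonoidAlgebra.single (D.pieceIncl k c) a) *
        mutFactor hu E k (D.pieceIncl k c) := by
  cases k with
  | none => exact (mul_one _).symm
  | some i => exact pieceRat_some hu E i c a

section points
variable {k : Option I} {x : D.fiber h hu χ}
  {z : Spec (CommRingCat.of (AddMonoidAlgebra kk (D.PieceMonoid k)))}
  (hz : D.piece kk k z = D.fiberIncl h hu χ x)

include hz in
lemma pieceRat_mem_localRing (a : AddMonoidAlgebra kk (D.PieceMonoid k)) :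
    pieceRat hu E k a ∈ localRing _ x :=
  ratEval_mem_localRing _ _ ((mem_preimage_iff _ _ _).mpr ⟨z, hz⟩) _ a

include hz in
lemma pieceRat_inv_mem_localRing {s : AddMonoidAlgebra kk (D.PieceMonoid k)}
    (hs : s ∉ z.asIdeal) : pieceRat hu E k s ≠ 0 ∧ (pieceRat hu E k s)⁻¹ ∈ localRing _ x :=
  ratEval_inv_mem_localRing _ _ _ z hz hs

include hz in
/-- The local ring at a point of a piece consists of the fractions of functions on the piece. -/
lemma exists_mul_pieceRat_eq {f : (D.fiber h hu χ).functionField} (hf : f ∈ localRing _ x) :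
    ∃ a s, s ∉ z.asIdeal ∧ f * pieceRat hu E k s = pieceRat hu E k a := by
  obtain ⟨y, hy, hyz⟩ := exists_fiberPiece_eq hu E hz
  obtain ⟨a, s, hs, e⟩ := exists_mul_ratEval_eq (genericPoint_mem_fiberPiece hu E k) y hy hf
  obtain ⟨a, rfl⟩ := twistHom_surjective π τ (D.pieceIncl k) a
  obtain ⟨s, rfl⟩ := twistHom_surjective π τ (D.pieceIncl k) s
  refine ⟨a, s, ?_, ?_⟩
  · subst hyz
    exact hs
  · rw [← fiberRat_toFiberRing, ← fiberRat_toFiberRing]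
    exact e

/-- An ideal of functions on a piece that contains the equations of the fiber but has no zero on
the fiber is the unit ideal. -/
lemma eq_top_of_fiber (k : Option I) (J : Ideal (AddMonoidAlgebra kk (D.PieceMonoid k)))
    (hJ : RingHom.ker (pieceRat hu E k) ≤ J)
    (H : ∀ (x : D.fiber h hu χ) (z : Spec (CommRingCat.of (AddMonoidAlgebra kk (D.PieceMonoid k)))),
      D.piece kk k z = D.fiberIncl h hu χ x → ¬ J ≤ z.asIdeal) : J = ⊤ := by
  by_contra hne
  have h1 : J.map (D.toFiberRing π τ k) ≠ ⊤ := by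
    intro e
    apply hne
    have h2 : (1 : D.FiberRing kk π k) ∈ J.map (D.toFiberRing π τ k) := e ▸ trivial
    obtain ⟨s, hs, hs1⟩ := (Ideal.mem_map_iff_of_surjective _
      (twistHom_surjective π τ (D.pieceIncl k))).mp h2
    -- `s` is an element of `J` that restricts to `1` on the fiber.
    have h3 : s - 1 ∈ J := hJ (by
      rw [RingHom.mem_ker, map_sub, sub_eq_zero, pieceRat_eq_iff, map_one]
      exact hs1)
    rw [Ideal.eq_top_iff_one]
    simpa using sub_mem hs h3
  obtain ⟨m, hm, hmJ⟩ := Ideal.exists_le_maximal _ h1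
  let y : Spec (CommRingCat.of (D.FiberRing kk π k)) := (⟨m, hm.isPrime⟩ : PrimeSpectrum _)
  refine H (fiberPiece hu E k y) (specMap (D.toFiberRing π τ k).toRingHom y)
    congr($(fiberPiece_incl hu E k) y).symm ?_
  exact Ideal.map_le_iff_le_comap.mp hmJ

omit [IsIntegral (D.fiber h hu χ)] in
include hz in
/-- A point of the fiber in the intersection of the chart `i` with another piece lies on the central
torus, and the denominator of the chart does not vanish there. -/
lemma exists_center_of_fiberIncl_eq {i : I} (hk : k ≠ some i)
    {z' : Spec (CommRingCat.of (AddMonoidAlgebra kk (D.PieceMonoid (some i))))}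
    (hz' : D.piece kk (some i) z' = D.fiberIncl h hu χ x) :
    ∃ w : Spec (CommRingCat.of (AddMonoidAlgebra kk (D.PieceMonoid none))),
      D.piece kk none w = D.fiberIncl h hu χ x ∧ D.den kk i ∉ w.asIdeal := by
  obtain ⟨w, hw, hd⟩ := D.exists_center_of_piece_eq kk hk (hz'.trans hz.symm)
  exact ⟨w, hw.trans hz, hd⟩

end points

/-- The functions in the image of all the pieces are the global functions. -/
lemma exists_germ_top_eq_of_forall (f : (D.fiber h hu χ).functionField)
    (hf : ∀ k, ∃ a, pieceRat hu E k a = f) :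
    ∃ s : Γ(D.fiber h hu χ, ⊤), (D.fiber h hu χ).presheaf.germ ⊤ _ trivial s = f := by
  refine exists_germ_top_eq (fun k => D.fiberIncl h hu χ ⁻¹ᵁ (D.piece kk k ''ᵁ ⊤)) (fun x => ?_)
    (genericPoint_mem_piece hu E) f (fun k => ?_)
  · obtain ⟨k, z, hz⟩ := D.exists_piece_eq kk (D.fiberIncl h hu χ x)
    exact ⟨k, (mem_preimage_iff _ _ _).mpr ⟨z, hz⟩⟩
  · obtain ⟨a, rfl⟩ := hf k
    exact ⟨_, rfl⟩

/-- A global function restricts to a function on each piece of the fiber, which extends to the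
piece of the cluster variety. -/
lemma exists_pieceRat_eq_germ_top (s : Γ(D.fiber h hu χ, ⊤)) (k : Option I) :
    ∃ a, pieceRat hu E k a = (D.fiber h hu χ).presheaf.germ ⊤ (genericPoint _) trivial s := by
  let ι := fiberPiece hu E k
  let U := ι ''ᵁ ⊤
  have hsurj : Function.Surjective (pulledFun (𝟙 (D.fiber h hu χ)) ι) :=
    (ConcreteCategory.bijective_of_isIso ((Scheme.ΓSpecIso (CommRingCat.of _)).inv ≫
      (ι.appIso ⊤).inv ≫ (𝟙 (D.fiber h hu χ) : _ ⟶ D.fiber h hu χ).app (ι ''ᵁ ⊤))).2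
  obtain ⟨b, hb⟩ := hsurj ((D.fiber h hu χ).presheaf.map (homOfLE le_top).op s)
  obtain ⟨a, rfl⟩ := twistHom_surjective π τ (D.pieceIncl k) b
  refine ⟨a, ?_⟩
  rw [← fiberRat_toFiberRing]
  change (D.fiber h hu χ).presheaf.germ _ _ (genericPoint_mem_fiberPiece hu E k) _ = _
  rw [hb]
  exact TopCat.Presheaf.germ_res_apply _ _ _ _ _

end ClusterData

/-! ### Evaluation of the Cox ring in a field -/

section CoxEval
variable {X : Scheme.{u}} [IsIntegral X] {Λ : Type u} [AddCommGroup Λ]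
  {d : X → (Multiplicative Λ →* X.functionFieldˣ)} {Λ₀ : AddSubgroup Λ} (ρ : ShiftingFamily d Λ₀)

lemma single_mem_rStalk {x : X} {m : Λ} {f : X.functionField} (hf : f ∈ divStalk d x m) :
    AddMonoidAlgebra.single m f ∈ rStalk d x := fun m' => by
  rw [AddMonoidAlgebra.coeff_single]
  by_cases h : m = m'
  · subst h; rwa [Finsupp.single_eq_same]
  · rw [Finsupp.single_eq_of_ne (Ne.symm h)]; exact zero_mem _

/-- For sections `f` of `𝒪(D m)` at `x`, the relation `f z^m ≡ ρ(m₀) f z^{m + m₀}` holds in `ℛ /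
ℐ`. -/
lemma exists_relIdeal_single (x : X) {m : Λ} (m₀ : Λ₀) {f : X.functionField}
    (hf : f ∈ divStalk d x m) : ∃ r ∈ relIdeal ρ x, (r : AddMonoidAlgebra X.functionField Λ) =
      AddMonoidAlgebra.single m f - AddMonoidAlgebra.single (m + m₀)
        (f * (ρ.toHom (Multiplicative.ofAdd m₀) : X.functionField)) := by
  have h2 : f * (ρ.toHom (Multiplicative.ofAdd m₀) : X.functionField) ∈ divStalk d x (m + m₀) := by
    rw [mul_comm, add_comm]
    exact ρ.shift x m₀ m f hf
  refine ⟨⟨_, single_mem_rStalk hf⟩ - ⟨_, single_mem_rStalk h2⟩,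
    Ideal.subset_span ⟨⟨_, single_mem_rStalk hf⟩, m₀, ?_⟩, rfl⟩
  rw [AddMonoidAlgebra.single_mul_single]
  rfl

variable {L : Type u} [Field L] (Θ : AddMonoidAlgebra X.functionField Λ →+* L)
  (hΘ : ∀ m₀ : Λ₀, Θ (AddMonoidAlgebra.single (m₀ : Λ)
    (ρ.toHom (Multiplicative.ofAdd m₀) : X.functionField)) = 1)

include hΘ in
lemma eval_eq_zero_of_mem_relIdeal {x : X} {r : rStalk d x} (hr : r ∈ relIdeal ρ x) :
    Θ r = 0 := by
  have : relIdeal ρ x ≤ RingHom.ker (Θ.comp (rStalk d x).subtype) := by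
    rw [relIdeal, Ideal.span_le]
    rintro r ⟨F, m₀, hr⟩
    change Θ r = 0
    rw [hr, map_sub, map_mul, hΘ, mul_one, sub_self]
  exact this hr

section LocalModel
variable {kk A : Type u} [Field kk] [CommRing A] (α : A →+* X.functionField) (z : Ideal A)
  [z.IsPrime] (w : Λ → X.functionField) {T : AddSubmonoid Λ}
  (lft : AddMonoidAlgebra kk T →+* AddMonoidAlgebra X.functionField Λ) {x : X}
  (ha : ∀ m, ∀ f ∈ divStalk d x m, ∃ a s, s ∉ z ∧ α s * f = α a * w m)
  (hb : ∀ a m, ∃ B, ∃ r ∈ relIdeal ρ x, (r : AddMonoidAlgebra X.functionField Λ) =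
    AddMonoidAlgebra.single m (α a * w m) - lft B)

include ha hb in
/-- Up to a denominator that is invertible at `x`, every element of the stalk at `x` is congruent,
modulo the relations, to the lift of an element of the model. -/
lemma exists_mul_sub_lift_mem (F : rStalk d x) : ∃ s ∉ z, ∃ B, ∃ r ∈ relIdeal ρ x,
    (r : AddMonoidAlgebra X.functionField Λ) = AddMonoidAlgebra.single 0 (α s) * F.1 - lft B := by
  classical
  have h1 : ∀ t : Finset Λ, ∃ s ∉ z, ∀ m ∈ t, ∃ a,
      α s * (F : AddMonoidAlgebra X.functionField Λ).coeff m = α a * w m := by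
    intro t
    induction t using Finset.induction_on with
    | empty => exact ⟨1, (Ideal.ne_top_iff_one z).mp (Ideal.IsPrime.ne_top ‹_›), by simp⟩
    | insert m t _ ih =>
      obtain ⟨s, hs, h⟩ := ih
      obtain ⟨a, s', hs', h'⟩ := ha m _ (F.2 m)
      refine ⟨s * s', fun hm => (Ideal.IsPrime.mem_or_mem ‹_› hm).elim hs hs', fun m' hm' => ?_⟩
      rcases Finset.mem_insert.mp hm' with rfl | hm'
      · exact ⟨s * a, by rw [map_mul, map_mul, mul_assoc, h', mul_assoc]⟩
      · obtain ⟨a', h''⟩ := h m' hm'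
        exact ⟨s' * a', by rw [mul_comm s, map_mul, map_mul, mul_assoc, h'', mul_assoc]⟩
  obtain ⟨s, hs, h⟩ := h1 (F : AddMonoidAlgebra X.functionField Λ).coeff.support
  have h2 : ∀ m ∈ (F : AddMonoidAlgebra X.functionField Λ).coeff.support,
      ∃ B, ∃ r ∈ relIdeal ρ x, (r : AddMonoidAlgebra X.functionField Λ) =
        AddMonoidAlgebra.single m (α s * (F : AddMonoidAlgebra X.functionField Λ).coeff m) -
          lft B := by
    intro m hm
    obtain ⟨a, e⟩ := h m hm
    rw [e]
    exact hb a m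
  choose! B r hr e using h2
  refine ⟨s, hs, ∑ m ∈ (F : AddMonoidAlgebra X.functionField Λ).coeff.support, B m,
    ∑ m ∈ (F : AddMonoidAlgebra X.functionField Λ).coeff.support, r m,
    sum_mem fun m hm => hr m hm, ?_⟩
  rw [AddSubmonoidClass.coe_finsetSum, Finset.sum_congr rfl e, Finset.sum_sub_distrib, map_sum]
  congr 1
  have hF : (F : AddMonoidAlgebra X.functionField Λ) =
      ∑ m ∈ (F : AddMonoidAlgebra X.functionField Λ).coeff.support,
        AddMonoidAlgebra.single m ((F : AddMonoidAlgebra X.functionField Λ).coeff m) :=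
    (AddMonoidAlgebra.sum_coeff_single _).symm
  conv_rhs => rw [hF, Finset.mul_sum]
  simp [AddMonoidAlgebra.single_mul_single]

include hΘ ha hb in
/-- If evaluation is injective on the lifts, then its kernel on the stalk consists of the
relations. -/
lemma mem_relIdeal_of_eval_eq_zero
    (hs : ∀ s ∉ z, α s ≠ 0 ∧ (α s)⁻¹ ∈ localRing X x)
    (hlft : ∀ B, Θ (lft B) = 0 → B = 0) (F : rStalk d x) (hF : Θ F = 0) : F ∈ relIdeal ρ x := by
  obtain ⟨s, hsz, B, r, hr, e⟩ := exists_mul_sub_lift_mem ρ α z w lft ha hb F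
  have h1 := eval_eq_zero_of_mem_relIdeal ρ Θ hΘ hr
  rw [e, map_sub, map_mul, hF, mul_zero, zero_sub, neg_eq_zero] at h1
  rw [hlft B h1, map_zero, sub_zero] at e
  obtain ⟨hs0, hs1⟩ := hs s hsz
  have h2 : AddMonoidAlgebra.single (0 : Λ) (α s)⁻¹ ∈ rStalk d x := by
    apply single_mem_rStalk
    change _ ∈ localRing X x
    rw [ofAdd_zero, map_one, Units.val_one, mul_one]
    exact hs1
  have h3 : F = ⟨_, h2⟩ * r := by
    apply Subtype.ext
    change (F : AddMonoidAlgebra X.functionField Λ) = AddMonoidAlgebra.single (0 : Λ) (α s)⁻¹ * r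
    rw [e, ← mul_assoc, AddMonoidAlgebra.single_mul_single, zero_add, inv_mul_cancel₀ hs0,
      ← AddMonoidAlgebra.one_def, one_mul]
  rw [h3]
  exact Ideal.mul_mem_left _ _ hr

end LocalModel

/-- The value of an element of the Cox ring under a homomorphism that kills the relations. -/
def coxEval : Cox ρ →+* L :=
  (Ideal.Quotient.lift (relIdeal ρ (genericPoint X)) (Θ.comp (rStalk d (genericPoint X)).subtype)
    (fun _ hr => eval_eq_zero_of_mem_relIdeal ρ Θ hΘ hr)).comp
  ((Pi.evalRingHom (fun x => rStalk d x ⧸ relIdeal ρ x) (genericPoint X)).comp (Cox ρ).subtype)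

/-- The value does not depend on the point at which it is computed. -/
lemma coxEval_eq (c : Cox ρ) (x : X) (F : rStalk d x) (hF : c.1 x = Ideal.Quotient.mk _ F) :
    coxEval ρ Θ hΘ c = Θ F := by
  obtain ⟨U, hU, G, hG, h⟩ := c.2 x
  have hη := genericPoint_mem hU
  have h1 : coxEval ρ Θ hΘ c = Θ G := by
    exact congrArg (Ideal.Quotient.lift (relIdeal ρ (genericPoint X))
      (Θ.comp (rStalk d (genericPoint X)).subtype)
      (fun _ hr => eval_eq_zero_of_mem_relIdeal ρ Θ hΘ hr)) (h _ hη)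
  have h2 : (F - ⟨G, hG x hU⟩ : rStalk d x) ∈ relIdeal ρ x := by
    rw [← Ideal.Quotient.eq, ← hF, h x hU]
  have h3 := eval_eq_zero_of_mem_relIdeal ρ Θ hΘ h2
  have h4 : Θ F - Θ G = 0 := (map_sub Θ _ _).symm.trans h3
  rw [h1, sub_eq_zero.mp h4]

variable (hinj : ∀ (x : X) (F : rStalk d x), Θ F = 0 → F ∈ relIdeal ρ x)

include hinj in
lemma coxEval_injective : Function.Injective (coxEval ρ Θ hΘ) := by
  rw [injective_iff_map_eq_zero]
  intro c hc
  apply Subtype.ext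
  funext x
  obtain ⟨F, hF⟩ := Ideal.Quotient.mk_surjective (c.1 x)
  rw [coxEval_eq ρ Θ hΘ c x F hF.symm] at hc
  rw [← hF]
  exact Ideal.Quotient.eq_zero_iff_mem.mpr (hinj x F hc)

include hinj in
/-- As evaluation separates the elements of the stalks of `ℛ / ℐ`, local sections with the same
value glue. -/
lemma exists_coxEval_eq (l : L) (hl : ∀ x : X, ∃ U : X.Opens, x ∈ U ∧
    ∃ F : AddMonoidAlgebra X.functionField Λ, (∀ y ∈ U, F ∈ rStalk d y) ∧ Θ F = l) :
    ∃ c, coxEval ρ Θ hΘ c = l := by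
  choose U hU F hF hFl using hl
  let c : ∀ x, rStalk d x ⧸ relIdeal ρ x := fun x => Ideal.Quotient.mk _ ⟨F x, hF x x (hU x)⟩
  refine ⟨⟨c, fun x => ⟨U x, hU x, F x, hF x, fun y hy => ?_⟩⟩, ?_⟩
  · rw [Ideal.Quotient.eq]
    apply hinj
    change Θ (F y - F x) = 0
    rw [map_sub, hFl, hFl, sub_self]
  · rw [coxEval_eq ρ Θ hΘ _ (genericPoint X) _ rfl]
    exact hFl _

end CoxEval

/-! ### Function fields, and lattice data of the leaf and of `𝒜_t` -/

section Dominant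
variable {X Y V : Scheme.{u}} [IsIntegral X] [IsIntegral Y] (f : Y ⟶ X)
  (hf : f (genericPoint Y) = genericPoint X)

/-- The map of function fields induced by a dominant morphism of integral schemes. -/
def funFieldMap : X.functionField →+* Y.functionField :=
  (f.stalkMap (genericPoint Y)).hom.comp
    (X.presheaf.stalkSpecializes (specializes_of_eq hf)).hom

lemma specMap_funFieldMap : specMap (funFieldMap f hf) ≫ X.fromSpecStalk (genericPoint X) =
    Y.fromSpecStalk (genericPoint Y) ≫ f := by
  have e : specMap (funFieldMap f hf) = Spec.map (f.stalkMap (genericPoint Y)) ≫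
      Spec.map (X.presheaf.stalkSpecializes (specializes_of_eq hf)) := by
    rw [specMap, ← Spec.map_comp]
    rfl
  rw [e, Category.assoc, Scheme.SpecMap_stalkSpecializes_fromSpecStalk,
    Scheme.SpecMap_stalkMap_fromSpecStalk]

lemma algebraMap_stalkMap (y : Y) (a : X.presheaf.stalk (f y)) :
    algebraMap _ Y.functionField ((f.stalkMap y).hom a) =
      funFieldMap f hf (algebraMap _ X.functionField a) := by
  have h1 := Scheme.Hom.stalkSpecializes_stalkMap f _ _
    ((genericPoint_spec Y).specializes trivial : genericPoint Y ⤳ y)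
  have h2 := congr($(h1).hom a)
  refine h2.symm.trans ?_
  change (f.stalkMap (genericPoint Y)).hom _ = (f.stalkMap (genericPoint Y)).hom _
  congr 1
  have h3 := X.presheaf.stalkSpecializes_comp (specializes_of_eq hf)
    ((genericPoint_spec X).specializes trivial : genericPoint X ⤳ f y)
  exact congr($(h3).hom a).symm

end Dominant

section Twist
open AddMonoidAlgebra
variable {kk : Type u} [Field kk] {P Λ : Type u} [AddCommGroup P] [AddCommGroup Λ] (π : P →+ Λ)
  (τ : Multiplicative P →* kkˣ)

lemma twistHom_one_add_ne_zero (p : P)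
    (hp : π p = 0 → (τ (Multiplicative.ofAdd p) : kk) ≠ -1) :
    twistHom π τ (AddMonoidHom.id P) (1 + monomial kk p) ≠ 0 := by
  intro h0
  rw [map_add, map_one, twistHom_single, one_mul, AddMonoidAlgebra.one_def] at h0
  have h1 := congr($(h0).coeff 0)
  rw [coeff_add, coeff_single, coeff_single, Finsupp.add_apply, Finsupp.single_eq_same] at h1
  by_cases h : π p = 0
  · have : toRestrCone π (AddMonoidHom.id P) p = 0 := Subtype.ext h
    rw [AddMonoidHom.id_apply, this, Finsupp.single_eq_same] at h1
    exact hp h (eq_neg_of_add_eq_zero_right h1)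
  · have : (0 : restrCone π (AddMonoidHom.id P)) ≠ toRestrCone π (AddMonoidHom.id P) p :=
      fun e => h (congrArg Subtype.val e).symm
    rw [AddMonoidHom.id_apply, Finsupp.single_eq_of_ne this] at h1
    simp at h1

lemma twistHom_single_eq_iff (p q : P) (a b : kk) (h : π p = π q)
    (hab : a * (τ (Multiplicative.ofAdd p) : kk) = b * (τ (Multiplicative.ofAdd q) : kk)) :
    twistHom π τ (AddMonoidHom.id P) (single p a) =
      twistHom π τ (AddMonoidHom.id P) (single q b) := by
  rw [twistHom_single, twistHom_single, AddMonoidHom.id_apply, AddMonoidHom.id_apply, hab]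
  congr 1
  exact Subtype.ext h

end Twist

namespace Seed
variable {N : Type u} [AddCommGroup N] {I : Type u} (S : Seed N I) {kk : Type u} [Field kk]

instance : TwoUniqueSums S.MI :=
  TwoUniqueSums.of_injective_addHom
    ({ toFun := fun m x => m x, map_add' := fun _ _ => rfl } : S.MI →ₙ+ (S.NI → ℤ))
    DFunLike.coe_injective inferInstance

variable {S} in
/-- The leaf over `φ`: the character `t` extends `φ` to `N`, and `p̄₁` embeds `N / K₁` in `M_I`. -/
lemma xFiberData {φ : Multiplicative S.K₁ →* kkˣ} {t : Multiplicative N →* kkˣ}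
    (ht : S.res t = φ) (hφ : ∀ i, i ∉ S.frozen → ∀ h : S.e i ∈ S.K₁,
      (φ (Multiplicative.ofAdd ⟨S.e i, h⟩) : kk) ≠ -1) :
    S.xData.FiberData S.K₁.subtype S.p₁bar.toAddMonoidHom t φ where
  map_eq_zero_iff p := by
    rw [AddSubgroup.range_subtype]
    rfl
  extends_ q := by rw [← ht]; rfl
  den_ne_zero i := by
    by_cases hi : i ∈ S.frozen
    · have : S.xData.den kk i = 1 := if_pos hi
      rw [this, map_one]
      exact one_ne_zero
    · have : S.xData.den kk i = 1 + monomial kk (S.e i) := if_neg hi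
      rw [this]
      refine twistHom_one_add_ne_zero _ _ _ (fun h => ?_)
      have := hφ i hi h
      rwa [← ht] at this

/-- Restriction of characters of the central torus of `𝒜_prin` to `N_I`. -/
def resI : Module.Dual ℤ (S.NI × Module.Dual ℤ N) →+ S.MI :=
  (LinearMap.inl ℤ S.NI (Module.Dual ℤ N)).dualMap.toAddMonoidHom

variable [Module.Free ℤ N] [Module.Finite ℤ N]

/-- The coordinate in `N` of a character of the central torus of `𝒜_prin`. -/
def coordN : Module.Dual ℤ (S.NI × Module.Dual ℤ N) →+ N :=
  ((Module.evalEquiv ℤ N).symm.toLinearMap ∘ₗ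
    (LinearMap.inr ℤ S.NI (Module.Dual ℤ N)).dualMap).toAddMonoidHom

lemma apply_coordN (l : Module.Dual ℤ (S.NI × Module.Dual ℤ N)) (m : Module.Dual ℤ N) :
    m (S.coordN l) = l (0, m) := by
  have h := LinearEquiv.apply_symm_apply (Module.evalEquiv ℤ N)
    ((LinearMap.inr ℤ S.NI (Module.Dual ℤ N)).dualMap l)
  exact congr($h m)

lemma coordN_eq {l : Module.Dual ℤ (S.NI × Module.Dual ℤ N)} {n : N}
    (h : ∀ m : Module.Dual ℤ N, l (0, m) = m n) : S.coordN l = n := by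
  apply (Module.evalEquiv ℤ N).injective
  refine LinearMap.ext fun m => ?_
  exact (S.apply_coordN l m).trans (h m)

/-- The character of `M_I ⊕ N` that is `t` on `N` and trivial on `M_I`. -/
def extChar (t : Multiplicative N →* kkˣ) :
    Multiplicative (Module.Dual ℤ (S.NI × Module.Dual ℤ N)) →* kkˣ :=
  t.comp S.coordN.toMultiplicative

lemma extChar_ofAdd (t : Multiplicative N →* kkˣ) (l : Module.Dual ℤ (S.NI × Module.Dual ℤ N)) :
    S.extChar t (Multiplicative.ofAdd l) = t (Multiplicative.ofAdd (S.coordN l)) := rfl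

variable {S} in
/-- The variety `𝒜_t`: the characters of the central torus modulo those of `T_M` are `M_I`. -/
lemma aFiberData {t : Multiplicative N →* kkˣ} (hφ : ∀ i, i ∉ S.frozen → S.e i ∈ S.K₁ →
      (t (Multiplicative.ofAdd (S.e i)) : kk) ≠ -1) :
    S.prin.aData.FiberData (dualChar S.piLat) S.resI (S.extChar t) t where
  map_eq_zero_iff l := by
    constructor
    · intro h
      refine ⟨S.coordN l, LinearMap.ext fun x => ?_⟩
      have h1 : l (x.1, 0) = 0 := congr($h x.1)
      have h2 : l x = l (x.1, 0) + l (0, x.2) := by rw [← map_add]; simp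
      rw [dualChar_apply, h2, h1, zero_add, ← S.apply_coordN]
      rfl
    · rintro ⟨n, rfl⟩
      exact LinearMap.ext fun x => rfl
  extends_ n := by
    rw [extChar_ofAdd, S.coordN_eq (n := n) (fun m => rfl)]
  den_ne_zero i := by
    by_cases hi : i ∈ S.frozen
    · have : S.prin.aData.den kk i = 1 := if_pos hi
      rw [this, map_one]
      exact one_ne_zero
    · have : S.prin.aData.den kk i = 1 + monomial kk (S.prinForm (S.eI i, 0)) := if_neg hi
      rw [this]
      refine twistHom_one_add_ne_zero _ _ _ (fun h => ?_)
      have h1 : S.coordN (S.prinForm (S.eI i, 0)) = S.e i := S.coordN_eq fun m => by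
        rw [prinForm_apply]
        simp [eI]
      rw [extChar_ofAdd, h1]
      refine hφ i hi ?_
      have h2 : ∀ x : S.NI, S.form (S.e i) x = 0 := fun x => by
        have h3 : S.prinForm (S.eI i, 0) (x, 0) = 0 := congr($h x)
        rw [prinForm_apply] at h3
        simpa [eI] using h3
      exact LinearMap.ext h2

end Seed

/-! ### Rational functions and divisors on the leaf -/

namespace Seed

section Leaf
open ClusterData Multiplicative
variable {N : Type u} [AddCommGroup N] {I : Type u} {S : Seed N I} {kk : Type u} [Field kk]
  {φ : Multiplicative S.K₁ →* kkˣ} {t : Multiplicative N →* kkˣ}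

variable (S) in
lemma xData_u_K₁ (i : I) (k : S.K₁) : S.xData.u i (S.K₁.subtype k) = 0 :=
  S.form_of_mem_K₁ k.2 (S.eI i).2

lemma leaf_isIntegral (E : S.xData.FiberData S.K₁.subtype S.p₁bar.toAddMonoidHom t φ) :
    IsIntegral (S.leaf φ) :=
  fiber_isIntegral S.xData_u_K₁ E

variable [hX : IsIntegral (S.leaf φ)]
  (E : S.xData.FiberData S.K₁.subtype S.p₁bar.toAddMonoidHom t φ)

-- In what follows `IsIntegral` has to be restated for `ClusterData.fiber`, as instance search does
-- not unfold `S.leaf φ` to it.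

/-- The rational function on the leaf defined by a function on a piece. -/
def xPiece (k : Option I) :
    AddMonoidAlgebra kk (S.xData.PieceMonoid k) →+* (S.leaf φ).functionField :=
  haveI : IsIntegral (S.xData.fiber S.K₁.subtype S.xData_u_K₁ φ) := hX
  pieceRat S.xData_u_K₁ E k

/-- The rational function on the leaf defined by a function on the central torus. -/
def xCenter : AddMonoidAlgebra kk N →+* (S.leaf φ).functionField :=
  haveI : IsIntegral (S.xData.fiber S.K₁.subtype S.xData_u_K₁ φ) := hX
  centerRat S.xData_u_K₁ E

lemma leafRat_eq (f : AddMonoidAlgebra kk N) : S.leafRat φ f = xCenter E f :=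
  haveI : IsIntegral (S.xData.fiber S.K₁.subtype S.xData_u_K₁ φ) := hX
  ratFun_pulledFun _ _ (genericPoint_mem_piece S.xData_u_K₁ E none) f

/-- On the leaf, the monomials `z^p` with the same `p̄₁ p` are proportional. -/
lemma xCenter_single_eq (p q : N) (a b : kk) (h : S.p₁bar p = S.p₁bar q)
    (hab : a * (t (ofAdd p) : kk) = b * (t (ofAdd q) : kk)) :
    xCenter E (AddMonoidAlgebra.single p a) = xCenter E (AddMonoidAlgebra.single q b) :=
  haveI : IsIntegral (S.xData.fiber S.K₁.subtype S.xData_u_K₁ φ) := hX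
  (centerRat_eq_iff S.xData_u_K₁ E _ _).mpr (twistHom_single_eq_iff _ _ _ _ _ _ h hab)

/-- The constants in the function field of the leaf. -/
def xCoef : kk →+* (S.leaf φ).functionField :=
  (xCenter E).comp (algebraMap kk (AddMonoidAlgebra kk N))

/-- The monomials `z^n`, as rational functions on the leaf. -/
def xMon : Multiplicative N →* (S.leaf φ).functionFieldˣ :=
  ((xCenter E : AddMonoidAlgebra kk N →* (S.leaf φ).functionField).comp
    (AddMonoidAlgebra.of kk N)).toHomUnits

lemma coe_xMon (n : N) : (xMon E (ofAdd n) : (S.leaf φ).functionField) =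
    xCenter E (monomial kk n) := rfl

lemma xCenter_single (n : N) (a : kk) : xCenter E (AddMonoidAlgebra.single n a) =
    xCoef E a * (xMon E (ofAdd n) : (S.leaf φ).functionField) := by
  rw [coe_xMon, xCoef, RingHom.comp_apply, ← map_mul]
  congr 1
  change _ = AddMonoidAlgebra.single 0 a * AddMonoidAlgebra.single n 1
  rw [AddMonoidAlgebra.single_mul_single, zero_add, mul_one]

/-- The function `1 + z^{e i}`, for `i` unfrozen, as a rational function on the leaf. -/
def xDen (i : I) : (S.leaf φ).functionFieldˣ :=
  haveI : IsIntegral (S.xData.fiber S.K₁.subtype S.xData_u_K₁ φ) := hX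
  Units.mk0 (xCenter E (S.xData.den kk i)) (centerRat_den_ne_zero S.xData_u_K₁ E i)

lemma coe_xDen (i : I) : (xDen E i : (S.leaf φ).functionField) = xCenter E (S.xData.den kk i) := rfl

/-- The factor by which a monomial with exponent `m` changes between a piece and the center. -/
def xMut : Option I → Multiplicative S.MI →* (S.leaf φ).functionFieldˣ
  | none => 1
  | some i =>
    { toFun := fun m => xDen E i ^ (-(m.toAdd (S.eI i)))
      map_one' := by simp
      map_mul' := fun m m' => by
        rw [toAdd_mul, LinearMap.add_apply, neg_add, zpow_add] }

lemma xMut_some (i : I) (m : S.MI) :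
    xMut E (some i) (ofAdd m) = xDen E i ^ (-(m (S.eI i))) := rfl

lemma xPiece_single (k : Option I) (c : S.xData.PieceMonoid k) (a : kk) :
    xPiece E k (AddMonoidAlgebra.single c a) =
      xCoef E a * ((xMon E (ofAdd (S.xData.pieceIncl k c)) *
        xMut E k (ofAdd (S.p₁bar (S.xData.pieceIncl k c))) : (S.leaf φ).functionFieldˣ) :
          (S.leaf φ).functionField) := by
  have h1 : xPiece E k (AddMonoidAlgebra.single c a) =
      xCenter E (AddMonoidAlgebra.single (S.xData.pieceIncl k c) a) *
        ((xMut E k (ofAdd (S.p₁bar (S.xData.pieceIncl k c))) : (S.leaf φ).functionFieldˣ) :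
          (S.leaf φ).functionField) := by
    cases k with
    | none =>
      change _ = _ * ((1 : (S.leaf φ).functionFieldˣ) : (S.leaf φ).functionField)
      rw [Units.val_one, mul_one]
      rfl
    | some i =>
      have : IsIntegral (S.xData.fiber S.K₁.subtype S.xData_u_K₁ φ) := hX
      have h2 : xPiece E (some i) (AddMonoidAlgebra.single c a) =
          xCenter E (AddMonoidAlgebra.single (S.xData.pieceIncl (some i) c) a) *
            (xDen E i : (S.leaf φ).functionField) ^
              (-(S.p₁bar (S.xData.pieceIncl (some i) c) (S.eI i))) :=
        pieceRat_some S.xData_u_K₁ E i c a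
      rw [h2, xMut_some, Units.val_zpow_eq_zpow_val]
  rw [h1, xCenter_single, Units.val_mul, mul_assoc]

/-- Rational functions that are invertible at a point. -/
def localUnits (x : S.leaf φ) : Subgroup (S.leaf φ).functionFieldˣ where
  carrier := {f | (f : (S.leaf φ).functionField) ∈ localRing _ x ∧
    ((f⁻¹ : (S.leaf φ).functionFieldˣ) : (S.leaf φ).functionField) ∈ localRing _ x}
  one_mem' := by simp [one_mem]
  mul_mem' := fun {f g} hf hg => by
    refine ⟨?_, ?_⟩
    · rw [Units.val_mul]; exact mul_mem hf.1 hg.1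
    · rw [mul_inv, Units.val_mul]; exact mul_mem hf.2 hg.2
  inv_mem' := fun {f} hf => ⟨hf.2, by rw [inv_inv]; exact hf.1⟩

section Points
variable {k : Option I} {x : S.leaf φ}
  {z : Spec (CommRingCat.of (AddMonoidAlgebra kk (S.xData.PieceMonoid k)))}
  (hz : S.xData.piece kk k z = S.leafIncl φ x)

include hz in
lemma xPiece_mem (a : AddMonoidAlgebra kk (S.xData.PieceMonoid k)) :
    xPiece E k a ∈ localRing _ x :=
  haveI : IsIntegral (S.xData.fiber S.K₁.subtype S.xData_u_K₁ φ) := hX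
  pieceRat_mem_localRing S.xData_u_K₁ E hz a

include hz in
lemma xPiece_inv_mem {s : AddMonoidAlgebra kk (S.xData.PieceMonoid k)} (hs : s ∉ z.asIdeal) :
    xPiece E k s ≠ 0 ∧ (xPiece E k s)⁻¹ ∈ localRing _ x :=
  haveI : IsIntegral (S.xData.fiber S.K₁.subtype S.xData_u_K₁ φ) := hX
  pieceRat_inv_mem_localRing S.xData_u_K₁ E hz hs

include hz in
lemma exists_mul_xPiece_eq {f : (S.leaf φ).functionField} (hf : f ∈ localRing _ x) :
    ∃ a s, s ∉ z.asIdeal ∧ f * xPiece E k s = xPiece E k a :=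
  haveI : IsIntegral (S.xData.fiber S.K₁.subtype S.xData_u_K₁ φ) := hX
  exists_mul_pieceRat_eq S.xData_u_K₁ E hz hf

include hz in
lemma mem_localRing_of_piece {n : N} {c : S.xData.PieceMonoid k} (hc : S.xData.pieceIncl k c = n)
    (a : kk) : xCoef E a * ((xMon E (ofAdd n) * xMut E k (ofAdd (S.p₁bar n)) :
      (S.leaf φ).functionFieldˣ) : (S.leaf φ).functionField) ∈ localRing _ x := by
  subst hc
  rw [← xPiece_single]
  exact xPiece_mem E hz _

lemma eq_top_of_leaf (k : Option I) (J : Ideal (AddMonoidAlgebra kk (S.xData.PieceMonoid k)))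
    (hJ : RingHom.ker (xPiece E k) ≤ J)
    (H : ∀ (x : S.leaf φ) (z : Spec (CommRingCat.of (AddMonoidAlgebra kk (S.xData.PieceMonoid k)))),
      S.xData.piece kk k z = S.leafIncl φ x → ¬ J ≤ z.asIdeal) : J = ⊤ :=
  haveI : IsIntegral (S.xData.fiber S.K₁.subtype S.xData_u_K₁ φ) := hX
  eq_top_of_fiber S.xData_u_K₁ E k J hJ H

/-- On the central torus monomials are invertible. -/
lemma xMon_mem_localUnits
    {w : Spec (CommRingCat.of (AddMonoidAlgebra kk (S.xData.PieceMonoid none)))}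
    (hw : S.xData.piece kk none w = S.leafIncl φ x) (n : N) : xMon E (ofAdd n) ∈ localUnits x :=
  ⟨xPiece_mem E hw (monomial kk (P := N) n), by
    rw [← map_inv, ← ofAdd_neg]
    exact xPiece_mem E hw (monomial kk (P := N) (-n))⟩

lemma xDen_mem_localUnits {i : I}
    {w : Spec (CommRingCat.of (AddMonoidAlgebra kk (S.xData.PieceMonoid none)))}
    (hw : S.xData.piece kk none w = S.leafIncl φ x) (hd : S.xData.den kk i ∉ w.asIdeal) :
    xDen E i ∈ localUnits x :=
  ⟨xPiece_mem E hw (S.xData.den kk i), by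
    rw [Units.val_inv_eq_inv_val]
    exact (xPiece_inv_mem E hw hd).2⟩

end Points

/-- The equation of the divisor with index `i` on its chart. -/
def xEqn (E : S.xData.FiberData S.K₁.subtype S.p₁bar.toAddMonoidHom t φ) (i : I) :
    (S.leaf φ).functionFieldˣ :=
  open scoped Classical in
  if i ∈ S.frozen then xMon E (ofAdd (Classical.epsilon fun n : N => S.form n (S.e i) = 1))
  else xDen E i

lemma coe_xEqn (i : I) : (xEqn E i : (S.leaf φ).functionField) =
    S.leafRat φ (S.divisorFun (kk := kk) i) := by
  rw [leafRat_eq E]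
  by_cases hi : i ∈ S.frozen
  · rw [xEqn, if_pos hi, divisorFun, if_pos hi, coe_xMon]
  · rw [xEqn, if_neg hi, divisorFun, if_neg hi, coe_xDen]
    congr 1
    exact if_neg hi

lemma localEqn_of_mem {i : I} {x : S.leaf φ} (hx : x ∈ S.leafOpen φ i) :
    S.localEqn φ i x = xEqn E i := by
  have h : S.leafRat φ (S.divisorFun (kk := kk) i) ≠ 0 := by
    rw [← coe_xEqn E]; exact Units.ne_zero _
  rw [localEqn, dif_pos ⟨hx, h⟩]
  exact Units.ext (coe_xEqn E i).symm

lemma localEqn_of_notMem {i : I} {x : S.leaf φ} (hx : x ∉ S.leafOpen φ i) :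
    S.localEqn φ i x = 1 := by
  rw [localEqn, dif_neg fun h => hx h.1]

omit hX in
lemma mem_leafOpen_iff {i : I} {x : S.leaf φ} :
    x ∈ S.leafOpen φ i ↔ ∃ z, S.xData.piece kk (some i) z = S.leafIncl φ x := Iff.rfl

include E in
/-- At a point of a piece, the divisors of the other pieces are trivial. -/
lemma localEqn_mem_localUnits {k : Option I} {x : S.leaf φ}
    {z : Spec (CommRingCat.of (AddMonoidAlgebra kk (S.xData.PieceMonoid k)))}
    (hz : S.xData.piece kk k z = S.leafIncl φ x) {i : I} (hi : k ≠ some i) :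
    S.localEqn φ i x ∈ localUnits x := by
  by_cases hx : x ∈ S.leafOpen φ i
  · obtain ⟨z', hz'⟩ := mem_leafOpen_iff.mp hx
    obtain ⟨w, hw, hd⟩ := exists_center_of_fiberIncl_eq S.xData_u_K₁ hz hi hz'
    rw [localEqn_of_mem E hx, xEqn]
    split_ifs
    · exact xMon_mem_localUnits E hw _
    · exact xDen_mem_localUnits E hw hd
  · rw [localEqn_of_notMem hx]
    exact one_mem _

end Leaf
end Seed

/-! ### The shifting family and lifts of coordinate functions -/

namespace Seed
open ClusterData Multiplicative
variable {N : Type u} [AddCommGroup N] {I : Type u} {S : Seed N I} {kk : Type u} [Field kk]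
  {φ : Multiplicative S.K₁ →* kkˣ} {t : Multiplicative N →* kkˣ}

lemma map_ofAdd_sub {A G : Type*} [AddGroup A] [Group G] (f : Multiplicative A →* G) (a b : A) :
    f (ofAdd (a - b)) = f (ofAdd a) * (f (ofAdd b))⁻¹ := by
  rw [ofAdd_sub, map_div, div_eq_mul_inv]

lemma mul_cancel_aux {G : Type*} [CommGroup G] (a b c d : G) :
    a * b * (c * d⁻¹) * (a⁻¹ * d) = c * b := by
  calc _ = (a * a⁻¹) * (d * d⁻¹) * (c * b) := by ac_rfl
    _ = _ := by rw [mul_inv_cancel, mul_inv_cancel, one_mul, one_mul]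

/-- A primitive linear form takes the value one. -/
lemma exists_eq_one_of_primitive (f : Module.Dual ℤ N) (hf : f ≠ 0)
    (h : ∀ (k : ℤ) (m : Module.Dual ℤ N), f = k • m → IsUnit k) : ∃ n, f n = 1 := by
  obtain ⟨k, hk⟩ := (IsPrincipalIdealRing.principal (LinearMap.range f)).principal
  have hdvd : ∀ n, k ∣ f n := fun n => by
    have : f n ∈ LinearMap.range f := ⟨n, rfl⟩
    rw [hk] at this
    exact Ideal.mem_span_singleton.mp this
  have hk0 : k ≠ 0 := by
    rintro rfl
    exact hf (LinearMap.ext fun n => zero_dvd_iff.mp (hdvd n))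
  let g : Module.Dual ℤ N := AddMonoidHom.toIntLinearMap
    { toFun := fun n => f n / k
      map_zero' := by simp
      map_add' := fun a b => by rw [map_add, Int.add_ediv_of_dvd_left (hdvd a)] }
  have hu := h k g (LinearMap.ext fun n => (Int.mul_ediv_cancel' (hdvd n)).symm)
  have h1 : (1 : ℤ) ∈ LinearMap.range f := by
    rw [hk]
    exact Ideal.mem_span_singleton.mpr hu.dvd
  exact h1

variable (S) in
/-- The exponent of a monomial that defines the divisor `W(m)` on the chart of a frozen index; zero
for the other pieces. -/
def frozenExp : Option I → S.MI → N
  | none, _ => 0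
  | some i, m =>
    open scoped Classical in
    if i ∈ S.frozen then m (S.eI i) • Classical.epsilon (fun n : N => S.form n (S.e i) = 1) else 0

variable (S) in
/-- The condition that the character `z^{(m, 0)}` is regular on a piece of `𝒜_prin`; it is vacuous
for the central torus and the charts of unfrozen indices. -/
def IsRegularOn : Option I → S.MI → Prop
  | none, _ => True
  | some i, m => i ∈ S.frozen → 0 ≤ m (S.eI i)

lemma exists_pieceIncl_eq (k : Option I) (n : N) (h : S.IsRegularOn k (S.p₁bar n)) :
    ∃ c, S.xData.pieceIncl k c = n := by
  cases k with
  | none => exact ⟨n, rfl⟩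
  | some i => exact ⟨⟨n, h⟩, rfl⟩

lemma isRegularOn_pieceIncl (k : Option I) (c : S.xData.PieceMonoid k) :
    S.IsRegularOn k (S.p₁bar (S.xData.pieceIncl k c)) := by
  cases k with
  | none => trivial
  | some i => exact c.2

lemma mem_restrCone_iff (k : Option I) (m : S.MI) :
    m ∈ restrCone S.resI (S.prin.aData.pieceIncl k) ↔ S.IsRegularOn k m := by
  constructor
  · rintro ⟨l, rfl⟩
    cases k with
    | none => trivial
    | some i => exact l.2
  · intro h
    cases k with
    | none => exact ⟨m ∘ₗ LinearMap.fst ℤ S.NI (Module.Dual ℤ N), rfl⟩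
    | some i => exact ⟨⟨m ∘ₗ LinearMap.fst ℤ S.NI (Module.Dual ℤ N), h⟩, rfl⟩

section FrozenExp
variable (hS : ∀ i ∈ S.frozen, ∃ n, S.form n (S.e i) = 1)

include hS in
lemma p₁bar_frozenExp {i : I} (hi : i ∈ S.frozen) (m : S.MI) :
    S.p₁bar (S.frozenExp (some i) m) (S.eI i) = m (S.eI i) := by
  rw [frozenExp, if_pos hi, map_smul, LinearMap.smul_apply]
  have : S.p₁bar (Classical.epsilon (fun n : N => S.form n (S.e i) = 1)) (S.eI i) = 1 :=
    Classical.epsilon_spec (hS i hi)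
  rw [this, smul_eq_mul, mul_one]

include hS in
lemma isRegularOn_add_sub (k : Option I) (m m' : S.MI) (h : S.IsRegularOn k m') :
    S.IsRegularOn k (m + m' - S.p₁bar (S.frozenExp k m)) := by
  cases k with
  | none => trivial
  | some i =>
    intro hi
    rw [LinearMap.sub_apply, LinearMap.add_apply, p₁bar_frozenExp hS hi]
    have := h hi
    omega

include hS in
lemma isRegularOn_frozenExp_sub (k : Option I) (n : N) :
    S.IsRegularOn k (S.p₁bar (S.frozenExp k (S.p₁bar n) - n)) := by
  cases k with
  | none => trivial
  | some i =>
    intro hi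
    rw [map_sub, LinearMap.sub_apply, p₁bar_frozenExp hS hi, sub_self]

include hS in
lemma isRegularOn_frozenExp (k : Option I) (m : S.MI) (h : S.IsRegularOn k m) :
    S.IsRegularOn k (S.p₁bar (S.frozenExp k m)) := by
  cases k with
  | none => trivial
  | some i =>
    intro hi
    rw [p₁bar_frozenExp hS hi]
    exact h hi

end FrozenExp

section Leaf
lemma exists_piece_eq_leafIncl (x : S.leaf φ) :
    ∃ k z, S.xData.piece kk k z = S.leafIncl φ x := S.xData.exists_piece_eq kk _

variable [hX : IsIntegral (S.leaf φ)]
  (E : S.xData.FiberData S.K₁.subtype S.p₁bar.toAddMonoidHom t φ)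

lemma xMut_frozenExp (k : Option I) (m : S.MI) :
    xMut E k (ofAdd (S.p₁bar (S.frozenExp k m))) = 1 := by
  cases k with
  | none => rfl
  | some i =>
    by_cases hi : i ∈ S.frozen
    · have : xDen E i = 1 := Units.ext (by
        rw [coe_xDen, den, if_pos (show i ∈ S.xData.frozen from hi), map_one, Units.val_one])
      rw [xMut_some, this, one_zpow]
    · rw [frozenExp, if_neg hi, map_zero, ofAdd_zero, map_one]

/-- A generator, on a piece, of the sheaf `𝒪(W(m))`. -/
def xGen (k : Option I) : S.MI → (S.leaf φ).functionFieldˣ :=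
  fun m => xMut E k (ofAdd m) * (xMon E (ofAdd (S.frozenExp k m)))⁻¹

/-- The values `t(n) z^{-n}` of the shifting family. -/
def shiftUnit : Multiplicative N →* (S.leaf φ).functionFieldˣ :=
  ((Units.map (xCoef E).toMonoidHom).comp t) * (xMon E)⁻¹

lemma coe_shiftUnit (n : N) : (shiftUnit E (ofAdd n) : (S.leaf φ).functionField) =
    xCenter E (AddMonoidAlgebra.single (-n) (t (ofAdd n) : kk)) := by
  rw [xCenter_single, ofAdd_neg, map_inv]
  rfl

/-- The value only depends on `p̄₁ n`. -/
lemma shiftUnit_eq {n n' : N} (h : S.p₁bar n = S.p₁bar n') :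
    shiftUnit E (ofAdd n) = shiftUnit E (ofAdd n') := by
  apply Units.ext
  rw [coe_shiftUnit, coe_shiftUnit]
  apply xCenter_single_eq
  · rw [map_neg, map_neg, h]
  · rw [← Units.val_mul, ← Units.val_mul, ofAdd_neg, ofAdd_neg, map_inv, map_inv, mul_inv_cancel,
      mul_inv_cancel]

/-- The coordinate functions of a piece of `𝒜_t` lift to sections of the sheaf `ℛ` over the
corresponding piece of the leaf. -/
def xLift (k : Option I) :
    AddMonoidAlgebra kk (restrCone S.resI (S.prin.aData.pieceIncl k)) →+*
      AddMonoidAlgebra (S.leaf φ).functionField S.MI :=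
  AddMonoidAlgebra.liftNCRingHom (AddMonoidAlgebra.singleZeroRingHom.comp (xCoef E))
    { toFun := fun m => AddMonoidAlgebra.single (m.toAdd : S.MI)
        (xMut E k (ofAdd (m.toAdd : S.MI)) : (S.leaf φ).functionField)
      map_one' := by
        rw [toAdd_one, AddSubmonoid.coe_zero, ofAdd_zero, map_one, Units.val_one]; rfl
      map_mul' := fun m m' => by
        rw [toAdd_mul, AddSubmonoid.coe_add, ofAdd_add, map_mul, Units.val_mul,
          AddMonoidAlgebra.single_mul_single] }
    (fun _ _ => Commute.all _ _)

lemma xLift_single (k : Option I) (m : restrCone S.resI (S.prin.aData.pieceIncl k)) (a : kk) :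
    xLift E k (AddMonoidAlgebra.single m a) = AddMonoidAlgebra.single (m : S.MI)
      (xCoef E a * (xMut E k (ofAdd (m : S.MI)) : (S.leaf φ).functionField)) := by
  refine (AddMonoidAlgebra.liftNC_single _ _ _ _).trans ?_
  change AddMonoidAlgebra.single 0 _ * AddMonoidAlgebra.single _ _ = _
  rw [AddMonoidAlgebra.single_mul_single, zero_add]
  rfl

variable [Fintype I]

/-- On a piece the divisor `W(m)` is principal, with the inverse of the generator as an equation. -/
lemma W_mul_xGen_mem {k : Option I} {x : S.leaf φ}
    {z : Spec (CommRingCat.of (AddMonoidAlgebra kk (S.xData.PieceMonoid k)))}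
    (hz : S.xData.piece kk k z = S.leafIncl φ x) (m : S.MI) :
    S.W φ x (ofAdd m) * xGen E k m ∈ localUnits x := by
  classical
  have hW : S.W φ x (ofAdd m) = ∏ i, S.localEqn φ i x ^ (m (S.eI i)) := rfl
  cases k with
  | none =>
    have : xGen E none m = 1 := by
      rw [xGen, frozenExp, ofAdd_zero, map_one, inv_one, mul_one]; rfl
    rw [this, mul_one, hW]
    exact prod_mem fun i _ => zpow_mem (localEqn_mem_localUnits E hz (by simp)) _
  | some i =>
    have h1 : S.localEqn φ i x ^ (m (S.eI i)) * xGen E (some i) m = 1 := by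
      rw [localEqn_of_mem E (mem_leafOpen_iff.mpr ⟨z, hz⟩), xGen, frozenExp, xEqn, xMut_some]
      split_ifs with hi
      · have : xDen E i = 1 := Units.ext (by
          rw [coe_xDen, den, if_pos (show i ∈ S.xData.frozen from hi), map_one, Units.val_one])
        rw [this, one_zpow, one_mul, ofAdd_zsmul, map_zpow, mul_inv_cancel]
      · rw [ofAdd_zero, map_one, inv_one, mul_one, ← zpow_add, add_neg_cancel, zpow_zero]
    rw [hW, ← Finset.prod_erase_mul _ _ (Finset.mem_univ i), mul_assoc, h1, mul_one]
    refine prod_mem fun i' hi' => zpow_mem (localEqn_mem_localUnits E hz fun e => ?_) _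
    exact (Finset.mem_erase.mp hi').1 (Option.some.inj e).symm

lemma mem_divStalk_iff {k : Option I} {x : S.leaf φ}
    {z : Spec (CommRingCat.of (AddMonoidAlgebra kk (S.xData.PieceMonoid k)))}
    (hz : S.xData.piece kk k z = S.leafIncl φ x) (m : S.MI) (f : (S.leaf φ).functionField) :
    f ∈ divStalk (S.W φ) x m ↔
      f * (((xGen E k m)⁻¹ : (S.leaf φ).functionFieldˣ) : (S.leaf φ).functionField) ∈
        localRing _ x := by
  obtain ⟨h1, h2⟩ := W_mul_xGen_mem E hz m
  have e1 : (S.W φ x (ofAdd m) : (S.leaf φ).functionField) =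
      (((xGen E k m)⁻¹ : (S.leaf φ).functionFieldˣ) : (S.leaf φ).functionField) *
        ((S.W φ x (ofAdd m) * xGen E k m : (S.leaf φ).functionFieldˣ) :
          (S.leaf φ).functionField) := by
    rw [← Units.val_mul]; congr 1; rw [mul_comm, mul_inv_cancel_right]
  have e2 : (((xGen E k m)⁻¹ : (S.leaf φ).functionFieldˣ) : (S.leaf φ).functionField) =
      (S.W φ x (ofAdd m) : (S.leaf φ).functionField) *
        (((S.W φ x (ofAdd m) * xGen E k m)⁻¹ : (S.leaf φ).functionFieldˣ) :
          (S.leaf φ).functionField) := by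
    rw [← Units.val_mul]; congr 1; rw [mul_inv, mul_inv_cancel_left]
  constructor
  · intro hf
    rw [e2, ← mul_assoc]
    exact mul_mem hf h2
  · intro hf
    change f * (S.W φ x (ofAdd m) : (S.leaf φ).functionField) ∈ localRing (S.leaf φ) x
    rw [e1, ← mul_assoc]
    exact mul_mem hf h1

/-- The shifting family `ρ(p̄₁ n) = t(n) z^{-n}`. -/
def xShift (hS : ∀ i ∈ S.frozen, ∃ n, S.form n (S.e i) = 1) : ShiftingFamily (S.W φ) S.Λ₀ where
  toHom :=
    { toFun := fun m => shiftUnit E (ofAdd (m.toAdd.2 : ∃ n, S.p₁bar n = (m.toAdd : S.MI)).choose)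
      map_one' := by
        have h := ((1 : Multiplicative S.Λ₀).toAdd.2 :
          ∃ n, S.p₁bar n = ((1 : Multiplicative S.Λ₀).toAdd : S.MI)).choose_spec
        rw [shiftUnit_eq E (n' := 0) (h.trans (map_zero _).symm), ofAdd_zero, map_one]
      map_mul' := fun m m' => by
        have h := (m.toAdd.2 : ∃ n, S.p₁bar n = (m.toAdd : S.MI)).choose_spec
        have h' := (m'.toAdd.2 : ∃ n, S.p₁bar n = (m'.toAdd : S.MI)).choose_spec
        have h'' := ((m * m').toAdd.2 : ∃ n, S.p₁bar n = ((m * m').toAdd : S.MI)).choose_spec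
        rw [← map_mul, ← ofAdd_add]
        refine shiftUnit_eq E ?_
        rw [h'', map_add, h, h']
        rfl }
  shift := by
    rintro x ⟨m₀, hm₀⟩ m f hf
    obtain ⟨k, z, hz⟩ := exists_piece_eq_leafIncl x
    obtain ⟨n, hn, hn'⟩ : ∃ n, S.p₁bar n = m₀ ∧ (hm₀ : ∃ n, S.p₁bar n = m₀).choose = n :=
      ⟨_, (hm₀ : ∃ n, S.p₁bar n = m₀).choose_spec, rfl⟩
    change (shiftUnit E (ofAdd (hm₀ : ∃ n, S.p₁bar n = m₀).choose) :
      (S.leaf φ).functionField) * f ∈ divStalk (S.W φ) x (m₀ + m)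
    rw [hn']
    subst hn
    refine mul_mem_divStalk (S.W φ) ?_ hf
    rw [mem_divStalk_iff E hz]
    obtain ⟨c, hc⟩ := exists_pieceIncl_eq k _ (isRegularOn_frozenExp_sub hS k n)
    have h1 := mem_localRing_of_piece E hz hc (t (ofAdd n) : kk)
    refine (congrArg (· ∈ localRing _ x) ?_).mp h1
    have h2 : (shiftUnit E (ofAdd n) : (S.leaf φ).functionField) = xCoef E (t (ofAdd n) : kk) *
        (((xMon E (ofAdd n))⁻¹ : (S.leaf φ).functionFieldˣ) : (S.leaf φ).functionField) := rfl
    rw [h2, mul_assoc, ← Units.val_mul]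
    congr 2
    rw [xGen, map_sub S.p₁bar, map_ofAdd_sub, map_ofAdd_sub, xMut_frozenExp, mul_inv, inv_inv,
      one_mul]
    exact (mul_rotate _ _ _).trans (mul_assoc _ _ _)

lemma xShift_apply (hS : ∀ i ∈ S.frozen, ∃ n, S.form n (S.e i) = 1) (n : N) :
    (xShift E hS).toHom (ofAdd ⟨S.p₁bar n, n, rfl⟩) = shiftUnit E (ofAdd n) :=
  shiftUnit_eq E (⟨n, rfl⟩ : ∃ n', S.p₁bar n' = S.p₁bar n).choose_spec

section
variable (hS : ∀ i ∈ S.frozen, ∃ n, S.form n (S.e i) = 1) {k : Option I} {x : S.leaf φ}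
    {z : Spec (CommRingCat.of (AddMonoidAlgebra kk (S.xData.PieceMonoid k)))}
    (hz : S.xData.piece kk k z = S.leafIncl φ x)

include hS hz in
lemma xLift_mem_rStalk (B : AddMonoidAlgebra kk (restrCone S.resI (S.prin.aData.pieceIncl k))) :
    xLift E k B ∈ rStalk (S.W φ) x := by
  induction B using AddMonoidAlgebra.induction_linear with
  | zero => rw [map_zero]; exact zero_mem _
  | add a b ha hb => rw [map_add]; exact add_mem ha hb
  | single m a =>
    rw [xLift_single]
    apply single_mem_rStalk
    rw [mem_divStalk_iff E hz]
    obtain ⟨c, hc⟩ := exists_pieceIncl_eq k _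
      (isRegularOn_frozenExp hS k m ((mem_restrCone_iff k _).mp m.2))
    have h1 := mem_localRing_of_piece E hz hc a
    refine (congrArg (· ∈ localRing _ x) ?_).mp h1
    rw [mul_assoc, ← Units.val_mul]
    congr 2
    rw [xGen, mul_inv, inv_inv, xMut_frozenExp, mul_inv_cancel_left, mul_one]

include hz in
/-- Sections of `𝒪(W(m))` are fractions of functions on the piece, times the generator. -/
lemma exists_mul_eq_of_mem_divStalk (m : S.MI) (f : (S.leaf φ).functionField)
    (hf : f ∈ divStalk (S.W φ) x m) : ∃ a s, s ∉ z.asIdeal ∧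
      xPiece E k s * f = xPiece E k a * (xGen E k m : (S.leaf φ).functionField) := by
  rw [mem_divStalk_iff E hz] at hf
  obtain ⟨a, s, hs, e⟩ := exists_mul_xPiece_eq E hz hf
  refine ⟨a, s, hs, ?_⟩
  rw [← e]
  have := (xGen E k m).inv_mul
  linear_combination (-(f * xPiece E k s)) * this

include hS hz in
/-- Modulo the relations, the sections of `𝒪(W(m)) z^m` over a piece are lifts of functions on the
corresponding piece of `𝒜_t`. -/
lemma exists_relIdeal_sub_xLift (a : AddMonoidAlgebra kk (S.xData.PieceMonoid k)) (m : S.MI) :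
    ∃ B, ∃ r ∈ relIdeal (xShift E hS) x,
      (r : AddMonoidAlgebra (S.leaf φ).functionField S.MI) =
        AddMonoidAlgebra.single m (xPiece E k a * (xGen E k m : (S.leaf φ).functionField)) -
          xLift E k B := by
  induction a using AddMonoidAlgebra.induction_linear with
  | zero => exact ⟨0, 0, zero_mem _, by simp⟩
  | add a b ha hb =>
    obtain ⟨A, r, hr, e⟩ := ha
    obtain ⟨B, r', hr', e'⟩ := hb
    refine ⟨A + B, r + r', add_mem hr hr', ?_⟩
    rw [Subring.coe_add, e, e', map_add, map_add, add_mul, AddMonoidAlgebra.single_add]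
    ring
  | single c a =>
    set n := S.xData.pieceIncl k c with hn
    -- Shifting by `p̄₁ n'` cancels the monomial `z^n` and the monomial in the generator.
    let n' : N := n - S.frozenExp k m
    have hf : xPiece E k (AddMonoidAlgebra.single c a) *
        (xGen E k m : (S.leaf φ).functionField) ∈ divStalk (S.W φ) x m := by
      rw [mem_divStalk_iff E hz, Units.mul_inv_cancel_right]
      exact xPiece_mem E hz _
    obtain ⟨r, hr, e⟩ := exists_relIdeal_single (xShift E hS) x ⟨S.p₁bar n', n', rfl⟩ hf
    have hmem : m + S.p₁bar n' ∈ restrCone S.resI (S.prin.aData.pieceIncl k) := by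
      rw [mem_restrCone_iff, map_sub, ← add_sub_assoc]
      exact isRegularOn_add_sub hS k m _ (isRegularOn_pieceIncl k c)
    refine ⟨AddMonoidAlgebra.single ⟨_, hmem⟩ (a * (t (ofAdd n') : kk)), r, hr, ?_⟩
    rw [e, xLift_single]
    congr 2
    rw [xShift_apply, xPiece_single]
    have h2 : (shiftUnit E (ofAdd n') : (S.leaf φ).functionField) = xCoef E (t (ofAdd n') : kk) *
        (((xMon E (ofAdd n'))⁻¹ : (S.leaf φ).functionFieldˣ) : (S.leaf φ).functionField) := rfl
    have h3 : xMon E (ofAdd n) * xMut E k (ofAdd (S.p₁bar n)) * xGen E k m *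
        (xMon E (ofAdd n'))⁻¹ = xMut E k (ofAdd (m + S.p₁bar n')) := by
      simp only [xGen, n']
      rw [map_sub S.p₁bar, ofAdd_add, map_mul, map_ofAdd_sub, map_ofAdd_sub, xMut_frozenExp,
        inv_one, mul_one, mul_inv, inv_inv]
      exact mul_cancel_aux _ _ _ _
    rw [h2, map_mul, ← h3]
    simp only [Units.val_mul, ← hn]
    ring

end
end Leaf
end Seed

/-! ### Rational functions on `𝒜_t` -/

namespace ClusterData
variable {P : Type u} [AddCommGroup P] {I : Type u} {D : ClusterData P I}
variable {kk : Type u} [Field kk] {Q : Type u} [AddCommGroup Q] {h : Q →+ P}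
  (hu : ∀ i q, D.u i (h q) = 0) {Λ : Type u} [AddCommGroup Λ] [TwoUniqueSums Λ] {π : P →+ Λ}
  {τ : Multiplicative P →* kkˣ} {χ : Multiplicative Q →* kkˣ} (E : D.FiberData h π τ χ)
  [IsIntegral (D.fiber h hu χ)]

lemma fiberPiece_bot (k : Option I) :
    fiberPiece hu E k (⊥ : PrimeSpectrum (D.FiberRing kk π k)) = genericPoint _ := by
  have h1 := genericPoint_eq_of_isOpenImmersion (fiberPiece hu E k)
  rw [genericPoint_eq_bot_of_affine] at h1
  exact h1

include E in
/-- A point of the fiber is the generic point if it lies over a point of a piece whose ideal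
consists of equations of the fiber. -/
lemma eq_genericPoint {k : Option I} {x : D.fiber h hu χ}
    {z : Spec (CommRingCat.of (AddMonoidAlgebra kk (D.PieceMonoid k)))}
    (hz : D.piece kk k z = D.fiberIncl h hu χ x)
    (H : ∀ a ∈ z.asIdeal, D.toFiberRing π τ k a = 0) : x = genericPoint _ := by
  obtain ⟨y, rfl, rfl⟩ := exists_fiberPiece_eq hu E hz
  have : y = (⊥ : PrimeSpectrum (D.FiberRing kk π k)) := by
    refine PrimeSpectrum.ext (le_bot_iff.mp fun b hb => ?_)
    obtain ⟨a, rfl⟩ := twistHom_surjective π τ (D.pieceIncl k) b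
    exact H a hb
  rw [this, fiberPiece_bot]

end ClusterData

namespace Seed
open ClusterData Multiplicative
section Lattice
variable {N : Type u} [AddCommGroup N] {I : Type u} (S : Seed N I)

/-- The character `(m, 0)` of the central torus of `𝒜_prin`. -/
def inM (m : S.MI) : Module.Dual ℤ (S.NI × Module.Dual ℤ N) :=
  m ∘ₗ LinearMap.fst ℤ S.NI (Module.Dual ℤ N)

lemma resI_inM (m : S.MI) : S.resI (S.inM m) = m := rfl

lemma resI_ptilde (n : N) : S.resI (dualChar S.ptilde n) = S.p₁bar n :=
  LinearMap.ext fun x => by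
    change S.form n (x : N) + (0 : Module.Dual ℤ N) n = S.form n (x : N)
    rw [LinearMap.zero_apply, add_zero]

variable [Module.Free ℤ N] [Module.Finite ℤ N]

lemma coordN_inM (m : S.MI) : S.coordN (S.inM m) = 0 :=
  S.coordN_eq fun l => by
    change m 0 = l 0
    rw [map_zero, map_zero]

lemma coordN_ptilde (n : N) : S.coordN (dualChar S.ptilde n) = n :=
  S.coordN_eq fun m => by
    change S.form n ((0 : S.NI) : N) + m n = m n
    rw [Submodule.coe_zero, map_zero, zero_add]

end Lattice

section AFiber
variable {N : Type u} [AddCommGroup N] {I : Type u} {S : Seed N I} {kk : Type u} [Field kk]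
  {φ : Multiplicative S.K₁ →* kkˣ} {t : Multiplicative N →* kkˣ}

variable (S) in
lemma prin_u_piLat (i : I) (n : N) : S.prin.aData.u i (dualChar S.piLat n) = 0 := rfl

variable [Module.Free ℤ N] [Module.Finite ℤ N]
  (A : S.prin.aData.FiberData (dualChar S.piLat) S.resI (S.extChar t) t)

include A in
lemma aFiber_isIntegral : IsIntegral (S.aFiber t) := fiber_isIntegral S.prin_u_piLat A

variable [hA : IsIntegral (S.aFiber t)]

/-- The rational function on `𝒜_t` defined by a function on the fiber of a piece. -/
def aRat (k : Option I) :
    AddMonoidAlgebra kk (restrCone S.resI (S.prin.aData.pieceIncl k)) →+*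
      (S.aFiber t).functionField :=
  haveI : IsIntegral (S.prin.aData.fiber (dualChar S.piLat) S.prin_u_piLat t) := hA
  fiberRat S.prin_u_piLat A k

lemma aRat_injective (k : Option I) : Function.Injective (aRat A k) :=
  haveI : IsIntegral (S.prin.aData.fiber (dualChar S.piLat) S.prin_u_piLat t) := hA
  fiberRat_injective S.prin_u_piLat A k

/-- The rational function on `𝒜_t` defined by a function on the central torus. -/
def aCenter : AddMonoidAlgebra kk (Module.Dual ℤ (S.NI × Module.Dual ℤ N)) →+*
    (S.aFiber t).functionField :=
  haveI : IsIntegral (S.prin.aData.fiber (dualChar S.piLat) S.prin_u_piLat t) := hA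
  centerRat S.prin_u_piLat A

lemma aCenter_single_eq (p q : Module.Dual ℤ (S.NI × Module.Dual ℤ N)) (a b : kk)
    (h : S.resI p = S.resI q)
    (hab : a * (t (ofAdd (S.coordN p)) : kk) = b * (t (ofAdd (S.coordN q)) : kk)) :
    aCenter A (AddMonoidAlgebra.single p a) = aCenter A (AddMonoidAlgebra.single q b) :=
  haveI : IsIntegral (S.prin.aData.fiber (dualChar S.piLat) S.prin_u_piLat t) := hA
  (centerRat_eq_iff S.prin_u_piLat A _ _).mpr (twistHom_single_eq_iff _ _ _ _ _ _ h hab)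

/-- The constants in the function field of `𝒜_t`. -/
def aCoef : kk →+* (S.aFiber t).functionField :=
  (aCenter A).comp (algebraMap kk (AddMonoidAlgebra kk _))

/-- The monomials `z^{(m, 0)}`, as rational functions on `𝒜_t`. -/
def aMon : Multiplicative S.MI →* (S.aFiber t).functionField where
  toFun m := aCenter A (monomial kk (S.inM m.toAdd))
  map_one' := map_one _
  map_mul' m m' := by
    rw [← map_mul, monomial, monomial, monomial, AddMonoidAlgebra.single_mul_single, one_mul]
    rfl

/-- On `𝒜_t` the monomial with exponent `l` is a multiple of `z^{(m, 0)}`, for `m` the restriction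
of `l` to `N_I`. -/
lemma aCenter_single (l : Module.Dual ℤ (S.NI × Module.Dual ℤ N)) (a : kk) :
    aCenter A (AddMonoidAlgebra.single l a) =
      aCoef A (a * (t (ofAdd (S.coordN l)) : kk)) * aMon A (ofAdd (S.resI l)) := by
  change _ = aCenter A (AddMonoidAlgebra.single 0 _) * aCenter A (AddMonoidAlgebra.single _ 1)
  rw [← map_mul, AddMonoidAlgebra.single_mul_single, zero_add, mul_one]
  refine aCenter_single_eq A _ _ _ _ (S.resI_inM _).symm ?_
  rw [toAdd_ofAdd, coordN_inM, ofAdd_zero, map_one, Units.val_one, mul_one]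
  rfl

/-- The factor by which a monomial with exponent `m` changes between a piece and the center. -/
def aMut : Option I → S.MI → (S.aFiber t).functionField
  | none, _ => 1
  | some i, m => aCenter A (S.prin.aData.den kk i) ^ (-(m (S.eI i)))

lemma aRat_single (k : Option I) (m : restrCone S.resI (S.prin.aData.pieceIncl k)) (a : kk) :
    aRat A k (AddMonoidAlgebra.single m a) =
      aCoef A a * aMut A k m * aMon A (ofAdd (m : S.MI)) := by
  have : IsIntegral (S.prin.aData.fiber (dualChar S.piLat) S.prin_u_piLat t) := hA
  obtain ⟨_, c, rfl⟩ := m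
  have h1 := fiberRat_toFiberRing S.prin_u_piLat A k (AddMonoidAlgebra.single c
    (a * ((S.extChar t (ofAdd (S.prin.aData.pieceIncl k c)))⁻¹ : kkˣ)))
  rw [twistHom_single, Units.inv_mul_cancel_right, pieceRat_single] at h1
  have h2 : mutFactor S.prin_u_piLat A k (S.prin.aData.pieceIncl k c) =
      aMut A k (S.resI (S.prin.aData.pieceIncl k c)) := by
    cases k with
    | none => rfl
    | some i => rfl
  have h3 := aCenter_single A (S.prin.aData.pieceIncl k c)
    (a * ((S.extChar t (ofAdd (S.prin.aData.pieceIncl k c)))⁻¹ : kkˣ))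
  rw [extChar_ofAdd, Units.inv_mul_cancel_right] at h3
  rw [h2] at h1
  refine h1.trans ((congrArg (· * aMut A k (S.resI (S.prin.aData.pieceIncl k c))) h3).trans ?_)
  exact mul_right_comm _ _ _

lemma exists_germ_top_eq_aRat (f : (S.aFiber t).functionField)
    (hf : ∀ k, ∃ b, aRat A k b = f) :
    ∃ s : Γ(S.aFiber t, ⊤), (S.aFiber t).presheaf.germ ⊤ (genericPoint _) trivial s = f := by
  have : IsIntegral (S.prin.aData.fiber (dualChar S.piLat) S.prin_u_piLat t) := hA
  refine exists_germ_top_eq_of_forall S.prin_u_piLat A f (fun k => ?_)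
  obtain ⟨b, hb⟩ := hf k
  obtain ⟨a, rfl⟩ := twistHom_surjective _ (S.extChar t) _ b
  exact ⟨a, (fiberRat_toFiberRing S.prin_u_piLat A k a).symm.trans hb⟩

lemma exists_aRat_eq_germ_top (s : Γ(S.aFiber t, ⊤)) (k : Option I) :
    ∃ b, aRat A k b = (S.aFiber t).presheaf.germ ⊤ (genericPoint _) trivial s := by
  have : IsIntegral (S.prin.aData.fiber (dualChar S.piLat) S.prin_u_piLat t) := hA
  obtain ⟨a, ha⟩ := exists_pieceRat_eq_germ_top S.prin_u_piLat A s k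
  exact ⟨_, (fiberRat_toFiberRing S.prin_u_piLat A k a).trans ha⟩

/-- The germ at a point of a function on the central torus, as a rational function. -/
lemma algebraMap_germ_aFun (y : S.aFiber t) (hy : y ∈ S.aCentral t)
    (a : AddMonoidAlgebra kk (Module.Dual ℤ (S.NI × Module.Dual ℤ N))) :
    algebraMap _ (S.aFiber t).functionField
      ((S.aFiber t).presheaf.germ (S.aCentral t) y hy (S.aFun t a)) = aCenter A a :=
  algebraMap_stalkEval (S.aIncl t) (S.prin.aData.centralChart kk) y hy
    (haveI : IsIntegral (S.prin.aData.fiber (dualChar S.piLat) S.prin_u_piLat t) := hA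
     genericPoint_mem_piece S.prin_u_piLat A none) a

end AFiber
end Seed

/-! ### The pullback of rational functions and the image of the Cox ring -/

section Denominators
variable {A B L : Type u} [CommRing A] [CommRing B] [CommRing L] (α : A →+* L) (β : B →+* L)
  (h : ∀ a, ∃ b, β b = α a) (l : L)

/-- The ideal of the denominators in `A` of an element `l`, with respect to the subring `β(B)` that
contains the image of `A`. -/
def denomIdeal : Ideal A where
  carrier := {s | ∃ b, β b = α s * l}
  zero_mem' := ⟨0, by simp⟩
  add_mem' := by
    rintro s s' ⟨b, hb⟩ ⟨b', hb'⟩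
    exact ⟨b + b', by rw [map_add, hb, hb', map_add, add_mul]⟩
  smul_mem' := by
    rintro a s ⟨b, hb⟩
    obtain ⟨a', ha'⟩ := h a
    exact ⟨a' * b, by rw [smul_eq_mul, map_mul, hb, ha', map_mul, mul_assoc]⟩

variable {α β h l} in
lemma mem_denomIdeal {s : A} : s ∈ denomIdeal α β h l ↔ ∃ b, β b = α s * l := Iff.rfl

end Denominators

namespace Seed
open ClusterData Multiplicative

variable {N : Type u} [AddCommGroup N] {I : Type u} {S : Seed N I} {kk : Type u} [Field kk]
  {φ : Multiplicative S.K₁ →* kkˣ} {t : Multiplicative N →* kkˣ} (ht : S.res t = φ)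

lemma pLeaf_leafIncl : S.pLeaf φ t ht ≫ S.leafIncl φ = S.aIncl t ≫ S.pTildeMor kk :=
  pullback.lift_fst _ _ _

lemma centralChart_pTildeMor : S.prin.aData.centralChart kk ≫ S.pTildeMor kk =
    specMap (charHom kk (dualChar S.ptilde)).toRingHom ≫ S.xData.centralChart kk :=
  ι₀_map _ _ _ _ _ _ _

variable [Module.Free ℤ N] [Module.Finite ℤ N]

/-- The pullback of functions from the central torus of the leaf to that of `𝒜_t` is injective. -/
lemma twistHom_eq_zero_of_charHom (a : AddMonoidAlgebra kk N)
    (ha : twistHom S.resI (S.extChar t) (AddMonoidHom.id _)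
      (charHom kk (dualChar S.ptilde) a) = 0) :
    twistHom S.p₁bar.toAddMonoidHom t (AddMonoidHom.id N) a = 0 := by
  let g : restrCone S.p₁bar.toAddMonoidHom (AddMonoidHom.id N) →+
      restrCone S.resI (AddMonoidHom.id (Module.Dual ℤ (S.NI × Module.Dual ℤ N))) :=
    AddSubmonoid.inclusion (by
      rintro _ ⟨n, rfl⟩
      exact ⟨dualChar S.ptilde n, S.resI_ptilde n⟩)
  have hg : Function.Injective g := AddSubmonoid.inclusion_injective _
  apply AddMonoidAlgebra.mapDomain_injective hg
  rw [AddMonoidAlgebra.mapDomain_zero, ← ha]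
  clear ha
  induction a using AddMonoidAlgebra.induction_linear with
  | zero => simp
  | add a b ha hb => rw [map_add, AddMonoidAlgebra.mapDomain_add, ha, hb, map_add, map_add]
  | single n r =>
    rw [twistHom_single, AddMonoidAlgebra.mapDomain_single, charHom_single, twistHom_single,
      extChar_ofAdd, AddMonoidHom.id_apply, AddMonoidHom.id_apply, coordN_ptilde]
    congr 1
    exact Subtype.ext (S.resI_ptilde n).symm

variable [hX : IsIntegral (S.leaf φ)] [hA : IsIntegral (S.aFiber t)]
  (E : S.xData.FiberData S.K₁.subtype S.p₁bar.toAddMonoidHom t φ)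
  (A : S.prin.aData.FiberData (dualChar S.piLat) S.resI (S.extChar t) t)

include E A in
lemma pLeaf_genericPoint :
    S.pLeaf φ t ht (genericPoint (S.aFiber t)) = genericPoint (S.leaf φ) := by
  have iX : IsIntegral (S.xData.fiber S.K₁.subtype S.xData_u_K₁ φ) := hX
  have iA : IsIntegral (S.prin.aData.fiber (dualChar S.piLat) S.prin_u_piLat t) := hA
  let y : Spec (CommRingCat.of (S.prin.aData.FiberRing kk S.resI none)) :=
    (⊥ : PrimeSpectrum (S.prin.aData.FiberRing kk S.resI none))
  let w : Spec (CommRingCat.of (AddMonoidAlgebra kk (S.prin.aData.PieceMonoid none))) :=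
    specMap (S.prin.aData.toFiberRing S.resI (S.extChar t) none).toRingHom y
  have hy : fiberPiece S.prin_u_piLat A none y = genericPoint (S.aFiber t) :=
    fiberPiece_bot S.prin_u_piLat A none
  have h1 : S.prin.aData.piece kk none w = S.aIncl t (genericPoint (S.aFiber t)) := by
    rw [← hy]
    exact congr($(fiberPiece_incl S.prin_u_piLat A none) y).symm
  let w' : Spec (CommRingCat.of (AddMonoidAlgebra kk
    (Module.Dual ℤ (S.NI × Module.Dual ℤ N)))) := w
  let v' : Spec (CommRingCat.of (AddMonoidAlgebra kk N)) :=
    specMap (charHom kk (dualChar S.ptilde)).toRingHom w'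
  let v : Spec (CommRingCat.of (AddMonoidAlgebra kk (S.xData.PieceMonoid none))) := v'
  have h2 : S.xData.piece kk none v =
      S.leafIncl φ (S.pLeaf φ t ht (genericPoint (S.aFiber t))) := by
    have h3 := congr($(pLeaf_leafIncl ht) (genericPoint (S.aFiber t)))
    refine Eq.trans ?_ h3.symm
    refine Eq.trans ?_ (congrArg (S.pTildeMor kk) h1)
    exact congr($(centralChart_pTildeMor (S := S) (kk := kk)) w').symm
  have H : ∀ a : AddMonoidAlgebra kk N, a ∈ v'.asIdeal →
      twistHom S.p₁bar.toAddMonoidHom t (AddMonoidHom.id N) a = 0 :=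
    fun a ha => twistHom_eq_zero_of_charHom a ha
  exact eq_genericPoint S.xData_u_K₁ E h2 H

/-- The pullback `p̃₂^*` of rational functions from the leaf to `𝒜_t`. -/
def pStar : (S.leaf φ).functionField →+* (S.aFiber t).functionField :=
  funFieldMap (S.pLeaf φ t ht) (pLeaf_genericPoint ht E A)

lemma pStar_xCenter (a : AddMonoidAlgebra kk N) :
    pStar ht E A (xCenter E a) = aCenter A (charHom kk (dualChar S.ptilde) a) := by
  have iX : IsIntegral (S.xData.fiber S.K₁.subtype S.xData_u_K₁ φ) := hX
  have iA : IsIntegral (S.prin.aData.fiber (dualChar S.piLat) S.prin_u_piLat t) := hA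
  have : (pStar ht E A).comp (xCenter E) =
      (aCenter A).comp (charHom kk (dualChar S.ptilde)).toRingHom := by
    apply ringHom_eq_of_specMap_comp (S.xData.centralChart kk)
    have e1 : specMap (xCenter E) ≫ S.xData.centralChart kk =
        (S.leaf φ).fromSpecStalk (genericPoint _) ≫ S.leafIncl φ :=
      specMap_ratEval _ _ (genericPoint_mem_piece S.xData_u_K₁ E none)
    have e2 : specMap (aCenter A) ≫ S.prin.aData.centralChart kk =
        (S.aFiber t).fromSpecStalk (genericPoint _) ≫ S.aIncl t :=
      specMap_ratEval _ _ (genericPoint_mem_piece S.prin_u_piLat A none)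
    have e3 := specMap_funFieldMap (S.pLeaf φ t ht) (pLeaf_genericPoint ht E A)
    have e4 : specMap ((pStar ht E A).comp (xCenter E)) =
        specMap (pStar ht E A) ≫ specMap (xCenter E) := by
      rw [specMap, specMap, specMap, ← Spec.map_comp, ← CommRingCat.ofHom_comp]
    have e5 : specMap ((aCenter A).comp (charHom kk (dualChar S.ptilde)).toRingHom) =
        specMap (aCenter A) ≫ specMap (charHom kk (dualChar S.ptilde)).toRingHom := by
      rw [specMap, specMap, specMap, ← Spec.map_comp, ← CommRingCat.ofHom_comp]
    calc specMap ((pStar ht E A).comp (xCenter E)) ≫ S.xData.centralChart kk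
        = specMap (pStar ht E A) ≫ (S.leaf φ).fromSpecStalk (genericPoint _) ≫ S.leafIncl φ := by
          rw [e4, Category.assoc, e1]
      _ = (S.aFiber t).fromSpecStalk (genericPoint _) ≫ S.pLeaf φ t ht ≫ S.leafIncl φ := by
          rw [← Category.assoc, ← Category.assoc]
          exact congrArg (· ≫ S.leafIncl φ) e3
      _ = specMap (aCenter A) ≫ S.prin.aData.centralChart kk ≫ S.pTildeMor kk := by
          rw [pLeaf_leafIncl, ← Category.assoc, ← Category.assoc, e2]
      _ = _ := by rw [centralChart_pTildeMor, e5, Category.assoc]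
  exact congr($this a)

lemma pStar_xCoef (a : kk) : pStar ht E A (xCoef E a) = aCoef A a := by
  rw [xCoef, RingHom.comp_apply, pStar_xCenter, AlgHom.commutes]
  rfl

lemma pStar_xMut (k : Option I) (m : S.MI) :
    pStar ht E A (xMut E k (ofAdd m) : (S.leaf φ).functionField) = aMut A k m := by
  cases k with
  | none => exact map_one _
  | some i =>
    rw [xMut_some, Units.val_zpow_eq_zpow_val, coe_xDen, map_zpow₀, pStar_xCenter]
    have : charHom kk (dualChar S.ptilde) (S.xData.den kk i) = S.prin.aData.den kk i :=
      charHom_den S.prin.aData kk S.xData (dualChar S.ptilde) rfl (fun i _ =>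
          LinearMap.ext fun x => by
        change S.form (S.e i) (x.1 : N) + x.2 (S.e i) = S.prinForm (S.eI i, 0) x
        rw [prinForm_apply]
        simp [eI]) i
    rw [this]
    rfl

lemma pStar_xMon (n : N) : pStar ht E A (xMon E (ofAdd n) : (S.leaf φ).functionField) =
    aCoef A (t (ofAdd n) : kk) * aMon A (ofAdd (S.p₁bar n)) := by
  rw [coe_xMon, pStar_xCenter, charHom_single, aCenter_single, one_mul, coordN_ptilde, resI_ptilde]

lemma exists_aRat_eq_pStar (k : Option I) (a : AddMonoidAlgebra kk (S.xData.PieceMonoid k)) :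
    ∃ b, aRat A k b = pStar ht E A (xPiece E k a) := by
  induction a using AddMonoidAlgebra.induction_linear with
  | zero => exact ⟨0, by simp⟩
  | add a b ha hb =>
    obtain ⟨a', ha⟩ := ha
    obtain ⟨b', hb⟩ := hb
    exact ⟨a' + b', by rw [map_add, ha, hb, map_add, map_add]⟩
  | single c a =>
    refine ⟨AddMonoidAlgebra.single ⟨S.p₁bar (S.xData.pieceIncl k c),
      (mem_restrCone_iff k _).mpr (isRegularOn_pieceIncl k c)⟩
      (a * (t (ofAdd (S.xData.pieceIncl k c)) : kk)), ?_⟩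
    rw [aRat_single, xPiece_single, Units.val_mul, map_mul (pStar ht E A),
      map_mul (pStar ht E A), pStar_xCoef, pStar_xMut, pStar_xMon, map_mul]
    ring

/-- The homomorphism `f z^m ↦ p̃₂^*(f) z^{(m, 0)}`. -/
def pEval : AddMonoidAlgebra (S.leaf φ).functionField S.MI →+* (S.aFiber t).functionField :=
  AddMonoidAlgebra.liftNCRingHom (pStar ht E A) (aMon A) (fun _ _ => Commute.all _ _)

lemma pEval_single (m : S.MI) (f : (S.leaf φ).functionField) :
    pEval ht E A (AddMonoidAlgebra.single m f) = pStar ht E A f * aMon A (ofAdd m) :=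
  AddMonoidAlgebra.liftNC_single _ _ _ _

lemma algebraMap_pSharp (y : S.aFiber t) (hy : y ∈ S.aCentral t)
    (G : AddMonoidAlgebra ((S.leaf φ).presheaf.stalk (S.pLeaf φ t ht y)) S.MI) :
    algebraMap _ (S.aFiber t).functionField (S.pSharp ht y hy G) =
      pEval ht E A
        (AddMonoidAlgebra.mapRingHom S.MI (algebraMap _ (S.leaf φ).functionField) G) := by
  induction G using AddMonoidAlgebra.induction_linear with
  | zero => simp only [map_zero]
  | add a b ha hb => simp only [map_add, ha, hb]
  | single m f =>
    have h1 : S.pSharp ht y hy (AddMonoidAlgebra.single m f) =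
        ((S.pLeaf φ t ht).stalkMap y).hom f *
          (S.aFiber t).presheaf.germ (S.aCentral t) y hy (S.zM t (ofAdd m)) :=
      AddMonoidAlgebra.liftNC_single _ _ _ _
    rw [h1, map_mul, algebraMap_stalkMap (S.pLeaf φ t ht) (pLeaf_genericPoint ht E A),
      AddMonoidAlgebra.mapRingHom_single, pEval_single]
    congr 1
    exact algebraMap_germ_aFun A y hy _

/-- The lift of a coordinate function of a piece of `𝒜_t` evaluates to that function. -/
lemma pEval_xLift (k : Option I)
    (B : AddMonoidAlgebra kk (restrCone S.resI (S.prin.aData.pieceIncl k))) :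
    pEval ht E A (xLift E k B) = aRat A k B := by
  induction B using AddMonoidAlgebra.induction_linear with
  | zero => simp only [map_zero]
  | add a b ha hb => simp only [map_add, ha, hb]
  | single m a =>
    rw [xLift_single, pEval_single, aRat_single, map_mul, pStar_xCoef, pStar_xMut]

variable [Fintype I] (hS : ∀ i ∈ S.frozen, ∃ n, S.form n (S.e i) = 1)

/-- The homomorphism kills the relations, since `p̃₂^*(t(n) z^{-n}) z^{(p̄₁ n, 0)} = 1` on `𝒜_t`. -/
lemma pEval_shift (m₀ : S.Λ₀) : pEval ht E A (AddMonoidAlgebra.single (m₀ : S.MI)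
    ((xShift E hS).toHom (ofAdd m₀) : (S.leaf φ).functionField)) = 1 := by
  obtain ⟨_, n, rfl⟩ := m₀
  have h1 : (xShift E hS).toHom (ofAdd ⟨S.p₁bar n, n, rfl⟩) = shiftUnit E (ofAdd n) :=
    xShift_apply E hS n
  have h2 : ((xShift E hS).toHom (ofAdd ⟨S.p₁bar n, n, rfl⟩) : (S.leaf φ).functionField) =
      xCenter E (AddMonoidAlgebra.single (-n) (t (ofAdd n) : kk)) := by rw [h1, coe_shiftUnit]
  refine (pEval_single ht E A _ _).trans ?_
  refine (congrArg (fun f => pStar ht E A f * aMon A (ofAdd (S.p₁bar n))) h2).trans ?_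
  rw [pStar_xCenter, charHom_single, aCenter_single, coordN_ptilde, resI_ptilde, map_neg S.p₁bar,
    ofAdd_neg, ofAdd_neg, map_inv, Units.mul_inv, map_one, one_mul, ← map_mul, inv_mul_cancel,
    map_one]

lemma mem_relIdeal_of_pEval_eq_zero (x : S.leaf φ) (F : rStalk (S.W φ) x)
    (hF : pEval ht E A F = 0) : F ∈ relIdeal (xShift E hS) x := by
  obtain ⟨k, z, hz⟩ := exists_piece_eq_leafIncl x
  have : z.asIdeal.IsPrime := z.isPrime
  exact mem_relIdeal_of_eval_eq_zero (xShift E hS) (pEval ht E A) (pEval_shift ht E A hS)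
    (xPiece E k) z.asIdeal (fun m => (xGen E k m : (S.leaf φ).functionField)) (xLift E k)
    (exists_mul_eq_of_mem_divStalk E hz) (exists_relIdeal_sub_xLift E hS hz)
    (fun s hs => xPiece_inv_mem E hz hs)
    (fun B hB => aRat_injective A k (by rw [← pEval_xLift ht E A, hB, map_zero])) F hF

/-- The map from the Cox ring to the rational functions on `𝒜_t`. -/
def coxRat : Cox (xShift E hS) →+* (S.aFiber t).functionField :=
  coxEval (xShift E hS) (pEval ht E A) (pEval_shift ht E A hS)

lemma coxRat_eq (c : Cox (xShift E hS)) (x : S.leaf φ) (F : rStalk (S.W φ) x)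
    (hF : c.1 x = Ideal.Quotient.mk _ F) : coxRat ht E A hS c = pEval ht E A F.1 :=
  coxEval_eq _ _ _ c x F hF

lemma coxRat_injective : Function.Injective (coxRat ht E A hS) :=
  coxEval_injective _ _ _ (mem_relIdeal_of_pEval_eq_zero ht E A hS)

/-- The image of an element of the Cox ring is a function on every piece of `𝒜_t`: its denominators
form an ideal that has no zero on the leaf. -/
lemma exists_aRat_eq_coxRat (c : Cox (xShift E hS)) (k : Option I) :
    ∃ b, aRat A k b = coxRat ht E A hS c := by
  let J := denomIdeal ((pStar ht E A).comp (xPiece E k)) (aRat A k) (exists_aRat_eq_pStar ht E A k)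
    (coxRat ht E A hS c)
  have hJ : J = ⊤ := by
    refine eq_top_of_leaf E k J (fun s hs => ?_) (fun x z hz hle => ?_)
    · refine mem_denomIdeal.mpr ⟨0, ?_⟩
      rw [RingHom.comp_apply, RingHom.mem_ker.mp hs, map_zero, map_zero, zero_mul]
    · have : z.asIdeal.IsPrime := z.isPrime
      obtain ⟨F, hF⟩ := Ideal.Quotient.mk_surjective (c.1 x)
      obtain ⟨s, hs, B, r, hr, e⟩ := exists_mul_sub_lift_mem (xShift E hS) (xPiece E k) z.asIdeal
        (fun m => (xGen E k m : (S.leaf φ).functionField)) (xLift E k)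
        (exists_mul_eq_of_mem_divStalk E hz) (exists_relIdeal_sub_xLift E hS hz) F
      refine hs (hle (mem_denomIdeal.mpr ⟨B, ?_⟩))
      have h0 := eval_eq_zero_of_mem_relIdeal (xShift E hS) (pEval ht E A)
        (pEval_shift ht E A hS) hr
      have h1 : coxRat ht E A hS c = pEval ht E A F.1 :=
        coxRat_eq ht E A hS c x F hF.symm
      have h2 : pEval ht E A (AddMonoidAlgebra.single (0 : S.MI) (xPiece E k s)) =
          pStar ht E A (xPiece E k s) := by
        rw [pEval_single, ofAdd_zero, map_one, mul_one]
      rw [e, map_sub, map_mul, h2, pEval_xLift, ← h1] at h0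
      exact (sub_eq_zero.mp h0).symm
  obtain ⟨b, hb⟩ := mem_denomIdeal.mp ((Ideal.eq_top_iff_one J).mp hJ)
  exact ⟨b, by rw [hb, map_one, one_mul]⟩

/-- The lifts of a rational function that is regular on every piece of `𝒜_t` glue to an element of
the Cox ring. -/
lemma exists_coxRat_eq (l : (S.aFiber t).functionField) (hl : ∀ k, ∃ b, aRat A k b = l) :
    ∃ c, coxRat ht E A hS c = l := by
  refine exists_coxEval_eq _ _ _ (mem_relIdeal_of_pEval_eq_zero ht E A hS) l (fun x => ?_)
  obtain ⟨k, z, hz⟩ := exists_piece_eq_leafIncl x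
  obtain ⟨b, hb⟩ := hl k
  refine ⟨S.leafIncl φ ⁻¹ᵁ (S.xData.piece kk k ''ᵁ ⊤), (mem_preimage_iff _ _ _).mpr ⟨z, hz⟩,
    xLift E k b, fun y hy => ?_, (pEval_xLift ht E A k b).trans hb⟩
  obtain ⟨w, hw⟩ := (mem_preimage_iff _ _ _).mp hy
  exact xLift_mem_rStalk E hS hw b

/-- The germ at the generic point, on global functions. -/
def topRat : Γ(S.aFiber t, ⊤) →+* (S.aFiber t).functionField :=
  ((S.aFiber t).presheaf.germ ⊤ (genericPoint _) trivial).hom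

include ht E A in
/-- The Cox ring and the ring of global functions on `𝒜_t` have the same image in the field of
rational functions. -/
lemma exists_cox_ringEquiv : ∃ Ψ : Cox (xShift E hS) ≃+* Γ(S.aFiber t, ⊤),
    ∀ c, topRat (Ψ c) = coxRat ht E A hS c := by
  have hinj : Function.Injective (topRat (S := S) (t := t)) := germ_injective_of_isIntegral _ _ _
  have h1 : ∀ c, ∃ s, topRat (S := S) (t := t) s = coxRat ht E A hS c := fun c =>
    exists_germ_top_eq_aRat A _ (exists_aRat_eq_coxRat ht E A hS c)
  have h2 : ∀ s, ∃ c, coxRat ht E A hS c = topRat s := fun s =>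
    exists_coxRat_eq ht E A hS _ (exists_aRat_eq_germ_top A s)
  have h3 : (coxRat ht E A hS).range = (topRat (S := S) (t := t)).range := by
    ext l
    constructor
    · rintro ⟨c, rfl⟩; exact h1 c
    · rintro ⟨s, rfl⟩; exact h2 s
  let e₁ := RingEquiv.ofBijective (coxRat ht E A hS).rangeRestrict
    ⟨fun _ _ h => coxRat_injective ht E A hS (congrArg Subtype.val h),
      (coxRat ht E A hS).rangeRestrict_surjective⟩
  let e₂ := RingEquiv.ofBijective (topRat (S := S) (t := t)).rangeRestrict
    ⟨fun _ _ h => hinj (congrArg Subtype.val h), RingHom.rangeRestrict_surjective _⟩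
  refine ⟨(e₁.trans (RingEquiv.subringCongr h3)).trans e₂.symm, fun c => ?_⟩
  exact congrArg Subtype.val (e₂.apply_symm_apply (RingEquiv.subringCongr h3 (e₁ c)))

end Seed

end ClusterCox
end

theorem corollary3p6 {kk : Type u} [Field kk] {N : Type u} [AddCommGroup N] [Module.Free ℤ N]
    [Module.Finite ℤ N] {I : Type u} [Fintype I] (S : Seed N I)
    (hS₁ : ∀ i, S.p₂ (S.e i) ≠ 0)
    (hS₂ : ∀ i ∈ S.frozen, ∀ (k : ℤ) (m : Module.Dual ℤ N), S.p₂ (S.e i) = k • m → IsUnit k)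
    (φ : Multiplicative S.K₁ →* kkˣ) (t : Multiplicative N →* kkˣ) (ht : S.res t = φ)
    (hφ : ∀ i, i ∉ S.frozen → ∀ h : S.e i ∈ S.K₁, (φ (Multiplicative.ofAdd ⟨S.e i, h⟩) : kk) ≠ -1) :
    ∃ _ : IsIntegral (S.leaf φ), ∃ ρ : ShiftingFamily (S.W φ) S.Λ₀,
      (∀ n : N, (ρ.toHom (Multiplicative.ofAdd ⟨S.p₁bar n, n, rfl⟩) : (S.leaf φ).functionField) =
        S.leafRat φ (AddMonoidAlgebra.single (-n) (t (Multiplicative.ofAdd n) : kk))) ∧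
      ∃ Ψ : Cox ρ ≃+* Γ(S.aFiber t, ⊤), ∀ (c : Cox ρ) (y : S.aFiber t) (hy : y ∈ S.aCentral t)
        (G : AddMonoidAlgebra ((S.leaf φ).presheaf.stalk (S.pLeaf φ t ht y)) S.MI)
        (hG : AddMonoidAlgebra.mapRingHom S.MI (algebraMap _ (S.leaf φ).functionField) G ∈
          rStalk (S.W φ) (S.pLeaf φ t ht y)),
        c.1 (S.pLeaf φ t ht y) = Ideal.Quotient.mk _ ⟨_, hG⟩ →
        (S.aFiber t).presheaf.germ ⊤ y trivial (Ψ c) = S.pSharp ht y hy G := by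
  have hS : ∀ i ∈ S.frozen, ∃ n, S.form n (S.e i) = 1 := fun i hi =>
    Seed.exists_eq_one_of_primitive (S.p₂ (S.e i)) (hS₁ i) (hS₂ i hi)
  have E := Seed.xFiberData ht hφ
  have A := Seed.aFiberData (S := S) (t := t) (fun i hi h => by
    have := hφ i hi h
    rwa [← ht] at this)
  have hX : IsIntegral (S.leaf φ) := Seed.leaf_isIntegral E
  have hA : IsIntegral (S.aFiber t) := Seed.aFiber_isIntegral A
  obtain ⟨Ψ, hΨ⟩ := Seed.exists_cox_ringEquiv ht E A hS
  refine ⟨hX, Seed.xShift E hS, fun n => ?_, Ψ, fun c y hy G hG hc => ?_⟩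
  · rw [Seed.xShift_apply, Seed.coe_shiftUnit, Seed.leafRat_eq]
  · apply IsFractionRing.injective ((S.aFiber t).presheaf.stalk y) (S.aFiber t).functionField
    rw [Seed.algebraMap_pSharp ht E A]
    have h1 := (S.aFiber t).presheaf.germ_stalkSpecializes (U := ⊤) (y := y) trivial
      ((genericPoint_spec (S.aFiber t)).specializes trivial)
    have h2 : algebraMap _ (S.aFiber t).functionField
        ((S.aFiber t).presheaf.germ ⊤ y trivial (Ψ c)) = Seed.topRat (Ψ c) :=
      congr($(h1).hom (Ψ c))
    rw [h2, hΨ]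
    exact Seed.coxRat_eq ht E A hS c _ ⟨_, hG⟩ hc
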